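/- **Theorem (offline range successor queries).** Let $\Sigma=\{0,1,\dots,\sigma-1\}$ and let $s$ be a string of length $n$ over $\Sigma$, where $2\le\sigma\le n$. A *range successor query* consists of a range $R=[i,j]$ of positions of $s$ and a character $c\in\Sigma$; its answer is $$c'=\min\{\,s[k] : k\in R,\ s[k]\ge c\,\},$$ or the statement that no such character exists (reported as the value $\sigma$) if this set is empty. There is a deterministic word RAM algorithm that, given $s$ and a collection of $q\ge 0$ range successor queries on $s$ (all known in advance), answers all of them in total time $$\mathcal{O}\big((n+q)\sqrt{\log\sigma}\big).$$ Here the word RAM has words of $w$ bits and a memory of $2^w$ words, and in one unit of time it loads or stores a word, loads a constant, adds, subtracts or multiplies two words (modulo $2^w$), takes a bitwise Boolean operation or a bit shift, or makes a jump that is conditional on comparing two words. The input is stored with one integer per word. Precisely: there are a single program and constants $K$, $C$ such that for all $n,\sigma,q$ as above, every word length $w$ with $2^w\ge K(n+q)$ (that is, $w\ge\log_2(n+q)+O(1)$), every string $s$ and every collection of $q$ queries, the program halts within $C(n+q)\sqrt{\log_2\sigma}$ steps with the correct answers to all $q$ queries in memory. -/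

import Mathlib

namespace WordRAM

/-- The binary operations on machine words that the machine performs in one step.
Arithmetic is modulo `2 ^ w`; shifting by `w` or more positions gives `0`. -/
inductive BinOp where
  | add | sub | mul | and | or | xor | shl | shr

/-- The value of a binary operation on `w`-bit words. -/
def BinOp.eval {w : ℕ} (o : BinOp) (x y : BitVec w) : BitVec w :=
  match o with
  | .add => x + y
  | .sub => x - y
  | .mul => x * y
  | .and => x &&& y
  | .or => x ||| y
  | .xor => x ^^^ y
  | .shl => x <<< y
  | .shr => x >>> y

/-- The instructions of the word RAM. Registers and program lines are numbered from `0`.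
* `const d k`: put the constant `k` into register `d`;
* `bin o d a b`: put the value of the operation `o` on registers `a`, `b` into register `d`;
* `load d a`: put the content of the memory cell addressed by register `a` into register `d`;
* `store a b`: put register `b` into the memory cell addressed by register `a`;
* `jumpLt a b l`: go to line `l` if register `a` is smaller than register `b` (unsigned);
* `jumpEq a b l`: go to line `l` if registers `a` and `b` are equal. -/
inductive Instr where
  | const (d k : ℕ)
  | bin (o : BinOp) (d a b : ℕ)
  | load (d a : ℕ)
  | store (a b : ℕ)
  | jumpLt (a b l : ℕ)
  | jumpEq (a b l : ℕ)

/-- A program is a finite list of instructions. It does not depend on the word length, and being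
finite it mentions only finitely many registers. -/
abbrev Program := List Instr

/-- A configuration of the machine with `w`-bit words: the number of the current line, the
registers, and a random access memory of `2 ^ w` words, addressed by words. -/
structure Config (w : ℕ) where
  pc : ℕ
  reg : ℕ → BitVec w
  mem : BitVec w → BitVec w

/-- The effect of one instruction. -/
def Instr.exec {w : ℕ} (i : Instr) (x : Config w) : Config w :=
  match i with
  | .const d k =>
      { x with pc := x.pc + 1, reg := Function.update x.reg d (BitVec.ofNat w k) }
  | .bin o d a b =>
      { x with pc := x.pc + 1, reg := Function.update x.reg d (o.eval (x.reg a) (x.reg b)) }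
  | .load d a =>
      { x with pc := x.pc + 1, reg := Function.update x.reg d (x.mem (x.reg a)) }
  | .store a b =>
      { x with pc := x.pc + 1, mem := Function.update x.mem (x.reg a) (x.reg b) }
  | .jumpLt a b l =>
      { x with pc := if x.reg a < x.reg b then l else x.pc + 1 }
  | .jumpEq a b l =>
      { x with pc := if x.reg a = x.reg b then l else x.pc + 1 }

/-- The machine has halted when there is no line with the current number. -/
def Halted {w : ℕ} (P : Program) (x : Config w) : Prop :=
  P.length ≤ x.pc

/-- One step of the program `P`, at unit cost: execute the current line. A halted machine keeps
its configuration. -/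
def step {w : ℕ} (P : Program) (x : Config w) : Config w :=
  match P[x.pc]? with
  | some i => i.exec x
  | none => x

/-- The initial configuration: line `0`, all registers `0`, and the memory holds the given input
words in the cells `0, 1, 2, …` and `0` in all other cells. -/
def init (w : ℕ) (input : List ℕ) : Config w where
  pc := 0
  reg := fun _ => 0
  mem := fun a => BitVec.ofNat w (input.getD a.toNat 0)

/-- The configuration reached on the given input after `t` steps. -/
def run (P : Program) (w : ℕ) (input : List ℕ) (t : ℕ) : Config w :=
  (step P)^[t] (init w input)

end WordRAM

namespace RangeSuccessor

/-- A range successor query on a string of length `n` over the alphabet `{0, …, σ - 1}`: a range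
`[lo, hi]` of positions (numbered from `0`; empty if `hi < lo`) and a character. -/
structure Query (n σ : ℕ) where
  lo : Fin n
  hi : Fin n
  char : Fin σ

/-- The characters `s[k] ≥ c` with `k` in the range of the query. -/
def candidates {n σ : ℕ} (s : Fin n → Fin σ) (Q : Query n σ) : Set (Fin σ) :=
  {c | Q.char ≤ c ∧ ∃ k : Fin n, Q.lo ≤ k ∧ k ≤ Q.hi ∧ s k = c}

/-- The number `a` is the answer to the query: the least candidate if there is a candidate, and
the number `σ`, which is not a character, if there is none. -/
def IsAnswer {n σ : ℕ} (s : Fin n → Fin σ) (Q : Query n σ) (a : ℕ) : Prop :=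
  (∃ c : Fin σ, IsLeast (candidates s Q) c ∧ a = c.val) ∨ (candidates s Q = ∅ ∧ a = σ)

/-- The input, one number per memory word: `n, σ, q`, the `n` characters of the string, and three
words `lo, hi, char` for each of the `q` queries. -/
def encodeInput {n σ q : ℕ} (s : Fin n → Fin σ) (Q : Fin q → Query n σ) : List ℕ :=
  [n, σ, q] ++ List.ofFn (fun i => (s i).val) ++
    (List.ofFn Q).flatMap (fun x => [x.lo.val, x.hi.val, x.char.val])

/-- The content of the `j`-th of the memory cells that directly follow the input, which has
`3 + n + 3 * q` words. These cells receive the answers. -/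
def outputWord {w : ℕ} (n q : ℕ) (x : WordRAM.Config w) (j : ℕ) : ℕ :=
  (x.mem (BitVec.ofNat w (3 + n + 3 * q + j))).toNat

end RangeSuccessor

/-!
Let `b` be the least number with `σ < 2 ^ (b * b)`, so that `b` is at most twice the square root of
the logarithm of `σ` (`IsDigitSize.le_sqrt`). Characters are written with `b` digits of `b` bits
each. The algorithm makes two passes over the `b` levels of digits and spends linear time on each
level.

*Items.* The string positions and the two ends of each query range are merged into one sequence of
`m = n + 2 * q` items (`events`). The ends carry the character of their query, but are no
candidates; string characters are stored increased by one, so that the least character above that of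
the query is asked for. If the items are sorted stably by a prefix of their characters, then the
items in the range of a query that agree with the query in this prefix form the block between the
two ends (`lexRank_mem_Ico`). What is known of the answer so far is written to the ends, which makes
the ends of a query move along with the prefix of its answer.

*First pass* (`resolvePass`). The answer to a query is a candidate with the longest possible common
prefix with the query character. So the levels are taken from the lowest digit up, until the block
of the query has a digit that exceeds that of the query. Then the prefix of the answer consists of
the common prefix and the least such digit (`unresolved_step`, `resolve_step`). A range maximum
query decides in constant time whether such a digit exists. If it does, a wavelet matrix finds the
least one in time `O(b)`, but this happens only once for each query (`runs_resolveQuery`).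

*Second pass* (`refinePass`). The levels are taken from the top down, and the next digit of the
answer of a resolved query is the least digit in its block (`refine_step`). It is found in constant
time by a range maximum query on the complemented digits.

*Linear time for each level.* Each word holds `g` packed digits, where `g` is about the square root
of the logarithm of `m`. Tables indexed by all packed words have linear total size
(`Par.good_of_size`). Packing the digits into words, and the maxima of these words into words again,
leaves about `m / g ^ 2` values, for which a sparse table of logarithmic depth is linear in size
(`runs_buildMax`, `runs_rangeMax`). A wavelet matrix has `b` levels of about `m / g` words each, and
it is built word by word with table lookups, in linear time as `b ≤ 8 * g` (`runs_buildWave`).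

*The machine.* The algorithm is written in a structured language `Cmd` with a semantics on natural
numbers. Its programs terminate always, so a statement `Runs` about final state and running time is
a weakest precondition, and it excludes overflow. The compilation to the word RAM is correct and
takes exactly the running time of the semantics (`Cmd.reach`). All arrays of the language have one
common length, which the first instructions of the program compute from the input.
-/

set_option linter.constructorNameAsVariable false

namespace RangeSuccessor

open WordRAM Finset

/-! ### A structured language for word RAM programs -/

/-- The variables of the structured language. Each of them is kept in a register.
* `n`, `sg`, `q`: the length of the string, the size of the alphabet, the number of queries;
* `m`, `b`, `gm`, `g`, `tw`, `nw`, `st`, `n1`: the parameters of the algorithm, see `Par`;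
* `i`, `j`, `k`, `x`, `y`, `t`, `u`, `acc`: counters and temporary values;
* `lv`, `s1`, `s2`: a level, and the shifts that give the prefix above its digit and the prefix that
  ends with it;
* `qi`, `l`, `r`, `d`: a query, its range in the sorted sequence of items, and its digit;
* `mo`, `a1`, `c1`, `a2`, `c2`: the result of a range maximum query, and its ranges of full words;
* `pw`: the length of the ranges in a row of a sparse table;
* `off`, `base`, `nb`: the beginnings of a table or table row, of a level of a wavelet matrix, and
  of the next level;
* `buf`, `fill`, `outk`, `e`, `cnt`, `cum`: the buffer for the output of packed digits, the number
  of digits in it, the number of full words written, the next packed digits and their number, and a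
  count of digits; `e` is also the exponent of a power of two in sparse tables;
* `cl`, `cr`, `cy`: the candidate range and the candidate value in the search of a wavelet matrix;
* `l0`, `r0`, `cl0`, `cr0`, `z`: the numbers of zero bits before `l`, `r`, `cl`, `cr` and in all. -/
inductive Var where
  | n | sg | q | m | b | gm | g | tw | nw | st | n1
  | i | j | k | x | y | t | u | acc
  | lv | s1 | s2 | l | r | d | mo | a1 | c1 | a2 | c2 | pw
  | off | base | nb | buf | fill | outk | cum | cnt | e
  | cl | cr | cy | l0 | r0 | cl0 | cr0 | z | qi
  deriving DecidableEq

/-- The arrays of the structured language. All arrays have the same length.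
* `inp`: the first cells of the memory, which hold the input and receive the output;
* `key`, `pos`, `count`: the keys, the resulting positions and the counters of a counting sort;
* `ch`, `re`: the characters of the items, and `1` for string positions, `0` for ends of queries;
* `el`, `eh`: the items that are the left and the right ends of the queries;
* `tt`, `ww`: a sequence of digits, and packed digits;
* `cc`: the counts of zero bits in a wavelet matrix;
* `mx`, `on`, `zt`, `ot`: the tables for packed words, see `Tabs`;
* `t2`, `w1`, `sp`: the maxima of packed words, the same packed, and a sparse table;
* `lg`: the logarithms;
* `res`: for resolved queries, the number of the digit in which the answer first differs from the
  query character, counted from `1` at the top; `0` for unresolved queries. -/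
inductive Arr where
  | inp | key | pos | count | ch | re | el | eh | tt | ww | cc | on | zt | ot | mx | t2 | w1 | sp
  | lg | res
  deriving DecidableEq

/-- The number of a variable. -/
def Var.idx (x : Var) : ℕ := x.ctorIdx

/-- The number of an array. -/
def Arr.idx (a : Arr) : ℕ := a.ctorIdx

/-- The number of arrays. -/
def numArr : ℕ := 20

lemma Var.idx_inj {x y : Var} : x.idx = y.idx ↔ x = y := by
  refine ⟨fun h => ?_, fun h => h ▸ rfl⟩
  cases x <;> cases y <;> first | rfl | cases h

lemma Arr.idx_inj {x y : Arr} : x.idx = y.idx ↔ x = y := by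
  refine ⟨fun h => ?_, fun h => h ▸ rfl⟩
  cases x <;> cases y <;> first | rfl | cases h

lemma Arr.idx_lt (x : Arr) : x.idx < numArr := by
  cases x <;> decide

/-- A state of a structured program: the values of the variables and the contents of the arrays,
as natural numbers. -/
structure St where
  v : Var → ℕ
  a : Arr → ℕ → ℕ

/-- Change the value of a variable. -/
def St.setv (s : St) (x : Var) (k : ℕ) : St := { s with v := Function.update s.v x k }

/-- Change an array element. -/
def St.seta (s : St) (a : Arr) (i k : ℕ) : St :=
  { s with a := Function.update s.a a (Function.update (s.a a) i k) }

@[simp] lemma St.setv_v (s : St) (x y : Var) (k : ℕ) :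
    (s.setv x k).v y = if y = x then k else s.v y := by
  simp [St.setv, Function.update_apply]

@[simp] lemma St.setv_a (s : St) (x : Var) (k : ℕ) : (s.setv x k).a = s.a := rfl

@[simp] lemma St.seta_v (s : St) (a : Arr) (i k : ℕ) : (s.seta a i k).v = s.v := rfl

@[simp] lemma St.seta_a (s : St) (a b : Arr) (i k : ℕ) :
    (s.seta a i k).a b = if b = a then Function.update (s.a a) i k else s.a b := by
  by_cases h : b = a
  · subst h; simp [St.seta]
  · simp [St.seta, h]

/-- The machine operations on natural numbers, without reduction modulo `2 ^ w`. -/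
def natOp : BinOp → ℕ → ℕ → ℕ
  | .add, x, y => x + y
  | .sub, x, y => x - y
  | .mul, x, y => x * y
  | .and, x, y => x &&& y
  | .or, x, y => x ||| y
  | .xor, x, y => x ^^^ y
  | .shl, x, y => x * 2 ^ y
  | .shr, x, y => x / 2 ^ y

/-- The machine operation on words below `M` agrees with the operation on natural numbers. -/
def OpOk (M : ℕ) : BinOp → ℕ → ℕ → Prop
  | .add, x, y => x + y < M
  | .sub, x, y => y ≤ x
  | .mul, x, y => x * y < M
  | .shl, x, y => x * 2 ^ y < M
  | _, _, _ => True

/-- Expressions: variables, constants, machine operations, and array elements. -/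
inductive Ex where
  | var (x : Var)
  | lit (k : ℕ)
  | bin (o : BinOp) (e f : Ex)
  | get (a : Arr) (e : Ex)

instance : Coe Var Ex := ⟨.var⟩
instance (k : ℕ) : OfNat Ex k := ⟨.lit k⟩
instance : Add Ex := ⟨.bin .add⟩
instance : Sub Ex := ⟨.bin .sub⟩
instance : Mul Ex := ⟨.bin .mul⟩

/-- The shift of `e` to the left by `f` bits. -/
def Ex.shl (e f : Ex) : Ex := .bin .shl e f

/-- The shift of `e` to the right by `f` bits. -/
def Ex.shr (e f : Ex) : Ex := .bin .shr e f

infixl:75 " <<: " => Ex.shl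
infixl:75 " >>: " => Ex.shr

/-- The expression for `e % 2 ^ f`: the low `f` bits of `e`. -/
def Ex.low (e f : Ex) : Ex := .bin .and e (.bin .sub (.bin .shl (.lit 1) f) (.lit 1))

/-- The value of an expression. -/
def Ex.eval (s : St) : Ex → ℕ
  | var x => s.v x
  | lit k => k
  | bin o e f => natOp o (e.eval s) (f.eval s)
  | get a e => s.a a (e.eval s)

/-- The evaluation of an expression involves no overflow and no array index beyond the common
length `L` of the arrays. -/
def Ex.Ok (M L : ℕ) (s : St) : Ex → Prop
  | var _ => True
  | lit k => k < M
  | bin o e f => e.Ok M L s ∧ f.Ok M L s ∧ OpOk M o (e.eval s) (f.eval s)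
  | get _ e => e.Ok M L s ∧ e.eval s < L

/-- The number of instructions for an expression. -/
def Ex.len : Ex → ℕ
  | var _ => 1
  | lit _ => 1
  | bin _ e f => e.len + f.len + 1
  | get _ e => e.len + 4

section simp_lemmas
variable (M L : ℕ) (s : St) (e f : Ex) (x : Var) (k : ℕ) (a : Arr)

@[simp] lemma Ex.eval_var : (Ex.var x).eval s = s.v x := rfl
@[simp] lemma Ex.eval_ofNat : (ofNat(k) : Ex).eval s = OfNat.ofNat k := rfl
@[simp] lemma Ex.eval_add : (e + f).eval s = e.eval s + f.eval s := rfl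
@[simp] lemma Ex.eval_sub : (e - f).eval s = e.eval s - f.eval s := rfl
@[simp] lemma Ex.eval_mul : (e * f).eval s = e.eval s * f.eval s := rfl
@[simp] lemma Ex.eval_shl : (e <<: f).eval s = e.eval s * 2 ^ f.eval s := rfl
@[simp] lemma Ex.eval_shr : (e >>: f).eval s = e.eval s / 2 ^ f.eval s := rfl
@[simp] lemma Ex.eval_get : (Ex.get a e).eval s = s.a a (e.eval s) := rfl
@[simp] lemma Ex.eval_low : (e.low f).eval s = e.eval s % 2 ^ f.eval s := by
  simp [Ex.low, Ex.eval, natOp, Nat.and_two_pow_sub_one_eq_mod]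

@[simp] lemma Ex.ok_var : (Ex.var x).Ok M L s := trivial
@[simp] lemma Ex.ok_ofNat : (ofNat(k) : Ex).Ok M L s ↔ OfNat.ofNat k < M := Iff.rfl
@[simp] lemma Ex.ok_add :
    (e + f).Ok M L s ↔ e.Ok M L s ∧ f.Ok M L s ∧ e.eval s + f.eval s < M := Iff.rfl
@[simp] lemma Ex.ok_sub :
    (e - f).Ok M L s ↔ e.Ok M L s ∧ f.Ok M L s ∧ f.eval s ≤ e.eval s := Iff.rfl
@[simp] lemma Ex.ok_mul :
    (e * f).Ok M L s ↔ e.Ok M L s ∧ f.Ok M L s ∧ e.eval s * f.eval s < M := Iff.rfl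
@[simp] lemma Ex.ok_shl :
    (e <<: f).Ok M L s ↔ e.Ok M L s ∧ f.Ok M L s ∧ e.eval s * 2 ^ f.eval s < M := Iff.rfl
@[simp] lemma Ex.ok_shr : (e >>: f).Ok M L s ↔ e.Ok M L s ∧ f.Ok M L s := by
  change _ ∧ _ ∧ True ↔ _
  simp
@[simp] lemma Ex.ok_get : (Ex.get a e).Ok M L s ↔ e.Ok M L s ∧ e.eval s < L := Iff.rfl
@[simp] lemma Ex.ok_low :
    (e.low f).Ok M L s ↔ e.Ok M L s ∧ f.Ok M L s ∧ 2 ^ f.eval s < M := by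
  have : 1 ≤ 2 ^ f.eval s := Nat.one_le_two_pow
  simp only [Ex.low, Ex.Ok, Ex.eval, natOp, OpOk, one_mul, and_true]
  constructor
  · rintro ⟨h1, ⟨_, h2, h3⟩, _⟩
    exact ⟨h1, h2, h3⟩
  · rintro ⟨h1, h2, h3⟩
    exact ⟨h1, ⟨⟨by omega, h2, h3⟩, by omega, this⟩⟩

@[simp] lemma Ex.len_var : (Ex.var x).len = 1 := rfl
@[simp] lemma Ex.len_ofNat : (ofNat(k) : Ex).len = 1 := rfl
@[simp] lemma Ex.len_add : (e + f).len = e.len + f.len + 1 := rfl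
@[simp] lemma Ex.len_sub : (e - f).len = e.len + f.len + 1 := rfl
@[simp] lemma Ex.len_mul : (e * f).len = e.len + f.len + 1 := rfl
@[simp] lemma Ex.len_shl : (e <<: f).len = e.len + f.len + 1 := rfl
@[simp] lemma Ex.len_shr : (e >>: f).len = e.len + f.len + 1 := rfl
@[simp] lemma Ex.len_get : (Ex.get a e).len = e.len + 4 := rfl
@[simp] lemma Ex.len_low : (e.low f).len = e.len + f.len + 5 := by
  simp only [Ex.low, Ex.len]; omega

end simp_lemmas

/-- Commands of the structured language.
* `skip`: do nothing;
* `set x e`: put the value of `e` into the variable `x`;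
* `put a e f`: put the value of `f` into the element of `a` with index `e`;
* `seq c c'`: execute `c`, then `c'`;
* `iflt e f c c'`: execute `c` if the value of `e` is smaller than that of `f`, otherwise `c'`;
* `for_ x e c`: execute `c` with `x = 0, 1, …` below the value that `e` has at the beginning. -/
inductive Cmd where
  | skip
  | set (x : Var) (e : Ex)
  | put (a : Arr) (e f : Ex)
  | seq (c c' : Cmd)
  | iflt (e f : Ex) (c c' : Cmd)
  | for_ (x : Var) (e : Ex) (c : Cmd)

infixr:60 " ;; " => Cmd.seq
infix:62 " ::= " => Cmd.set

/-- The state after the first `k` rounds of a loop over `x`, for the effect `f` of the body. -/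
def loopSt (f : St → St) (x : Var) (s : St) : ℕ → St
  | 0 => s
  | k + 1 => f ((loopSt f x s k).setv x k)

/-- The state after a command. -/
def Cmd.den : Cmd → St → St
  | skip, s => s
  | set x e, s => s.setv x (e.eval s)
  | put a e f, s => s.seta a (e.eval s) (f.eval s)
  | seq c c', s => c'.den (c.den s)
  | iflt e f c c', s => if e.eval s < f.eval s then c.den s else c'.den s
  | for_ x e c, s => loopSt c.den x s (e.eval s)

/-- The execution of a command involves no overflow and no array index out of bounds. -/
def Cmd.Ok (M L : ℕ) : Cmd → St → Prop
  | skip, _ => True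
  | set _ e, s => e.Ok M L s
  | put _ e f, s => e.Ok M L s ∧ f.Ok M L s ∧ e.eval s < L
  | seq c c', s => c.Ok M L s ∧ c'.Ok M L (c.den s)
  | iflt e f c c', s => e.Ok M L s ∧ f.Ok M L s ∧
      (e.eval s < f.eval s → c.Ok M L s) ∧ (¬ e.eval s < f.eval s → c'.Ok M L s)
  | for_ x e c, s => e.Ok M L s ∧
      ∀ k < e.eval s, c.Ok M L ((loopSt c.den x s k).setv x k)

/-- The number of instructions for a command. -/
def Cmd.len : Cmd → ℕ
  | skip => 0
  | set _ e => e.len + 1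
  | put _ e f => e.len + 3 + f.len + 1
  | seq c c' => c.len + c'.len
  | iflt e f c c' => e.len + f.len + 1 + c'.len + 1 + c.len
  | for_ _ e c => e.len + 1 + 3 + c.len + 3

/-- The running time of a command. -/
def Cmd.cost : Cmd → St → ℕ
  | skip, _ => 0
  | set _ e, _ => e.len + 1
  | put _ e f, _ => e.len + 3 + f.len + 1
  | seq c c', s => c.cost s + c'.cost (c.den s)
  | iflt e f c c', s => e.len + f.len + 1 +
      if e.eval s < f.eval s then c.cost s else c'.cost s + 1
  | for_ x e c, s => e.len + 3 +
      ∑ k ∈ Finset.range (e.eval s), (c.cost ((loopSt c.den x s k).setv x k) + 5)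

/-! ### Compilation to the word RAM -/

/-- The register of a temporary value. Register `tmp 0` holds the common length of the arrays. -/
def tmp (d : ℕ) : ℕ := 2 * d + 1

/-- The register of a variable. -/
def Var.reg (x : Var) : ℕ := 2 * x.idx

/-- The code for an expression. It puts the value into `tmp d` and does not change `tmp d'` for
`d' < d`. The array with number `k` begins at the address `k * L`. -/
def Ex.code (d : ℕ) : Ex → Program
  | var x => [.bin .or (tmp d) x.reg x.reg]
  | lit k => [.const (tmp d) k]
  | bin o e f => e.code d ++ (f.code (d + 1) ++ [.bin o (tmp d) (tmp d) (tmp (d + 1))])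
  | get a e => e.code d ++ [.const (tmp (d + 1)) a.idx,
      .bin .mul (tmp (d + 1)) (tmp (d + 1)) (tmp 0),
      .bin .add (tmp d) (tmp (d + 1)) (tmp d), .load (tmp d) (tmp d)]

/-- The code for a command that is to stand at line `p`. -/
def Cmd.code (p d : ℕ) : Cmd → Program
  | skip => []
  | set x e => e.code d ++ [.bin .or x.reg (tmp d) (tmp d)]
  | put a e f => e.code d ++ ([.const (tmp (d + 1)) a.idx,
      .bin .mul (tmp (d + 1)) (tmp (d + 1)) (tmp 0),
      .bin .add (tmp d) (tmp (d + 1)) (tmp d)] ++ (f.code (d + 1) ++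
      [.store (tmp d) (tmp (d + 1))]))
  | seq c c' => c.code p d ++ c'.code (p + c.len) d
  | iflt e f c c' => e.code d ++ (f.code (d + 1) ++
      ([.jumpLt (tmp d) (tmp (d + 1)) (p + e.len + f.len + 1 + c'.len + 1)] ++
      (c'.code (p + e.len + f.len + 1) d ++
      ([.jumpEq 0 0 (p + e.len + f.len + 1 + c'.len + 1 + c.len)] ++
      c.code (p + e.len + f.len + 1 + c'.len + 1) d))))
  | for_ x e c => e.code d ++ ([.const (tmp (d + 1)) 0] ++
      ([.jumpLt (tmp (d + 1)) (tmp d) (p + e.len + 1 + 2),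
        .jumpEq 0 0 (p + e.len + 1 + 3 + c.len + 3),
        .bin .or x.reg (tmp (d + 1)) (tmp (d + 1))] ++
      (c.code (p + e.len + 1 + 3) (d + 2) ++
      [.const (tmp (d + 2)) 1, .bin .add (tmp (d + 1)) (tmp (d + 1)) (tmp (d + 2)),
        .jumpEq 0 0 (p + e.len + 1)])))

@[simp] lemma Ex.length_code (e : Ex) (d : ℕ) : (e.code d).length = e.len := by
  induction e generalizing d <;> simp_all [Ex.code, Ex.len]; omega

@[simp] lemma Cmd.length_code (c : Cmd) (p d : ℕ) : (c.code p d).length = c.len := by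
  induction c generalizing p d <;> simp_all [Cmd.code, Cmd.len] <;> omega

/-- The lines of `P` from line `p` on begin with `c`. -/
def CodeAt (P : Program) (p : ℕ) (c : Program) : Prop :=
  ∃ pre post, P = pre ++ (c ++ post) ∧ pre.length = p

lemma CodeAt.left {P : Program} {p : ℕ} {c c' : Program} (h : CodeAt P p (c ++ c')) :
    CodeAt P p c := by
  obtain ⟨pre, post, h1, h2⟩ := h
  exact ⟨pre, c' ++ post, by simp [h1], h2⟩

lemma CodeAt.right {P : Program} {p : ℕ} {c c' : Program} (h : CodeAt P p (c ++ c')) :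
    CodeAt P (p + c.length) c' := by
  obtain ⟨pre, post, h1, h2⟩ := h
  exact ⟨pre ++ c, post, by simp [h1], by simp [h2]⟩

lemma CodeAt.tail {P : Program} {p : ℕ} {i : Instr} {c : Program} (h : CodeAt P p (i :: c)) :
    CodeAt P (p + 1) c := by
  obtain ⟨pre, post, h1, h2⟩ := h
  exact ⟨pre ++ [i], post, by simp [h1], by simp [h2]⟩

lemma CodeAt.step_eq {P : Program} {w : ℕ} {x : Config w} {i : Instr} {c : Program}
    (h : CodeAt P x.pc (i :: c)) : step P x = i.exec x := by
  obtain ⟨pre, post, h1, h2⟩ := h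
  have : P[x.pc]? = some i := by
    rw [h1, ← h2]; simp
  simp [step, this]

/-- The machine reaches the configuration `y` from `x` in exactly `t` steps. -/
def Reach {w : ℕ} (P : Program) (x : Config w) (t : ℕ) (y : Config w) : Prop :=
  (step P)^[t] x = y

lemma Reach.refl {w : ℕ} (P : Program) (x : Config w) : Reach P x 0 x := rfl

lemma Reach.trans {w : ℕ} {P : Program} {x y z : Config w} {t t' : ℕ} (h : Reach P x t y)
    (h' : Reach P y t' z) : Reach P x (t + t') z := by
  unfold Reach at *
  rw [add_comm, Function.iterate_add_apply, h, h']

lemma CodeAt.reach {P : Program} {w : ℕ} {x : Config w} {i : Instr} {c : Program} {p : ℕ}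
    (h : CodeAt P p (i :: c)) (hp : x.pc = p) : Reach P x 1 (i.exec x) := by
  subst hp
  exact h.step_eq

/-- The configuration `x` of the machine represents the state `s` of the structured program, where
the arrays have length `L`. The registers of temporary values other than `tmp 0` and the memory
cells beyond the arrays are arbitrary. -/
structure Rel {w : ℕ} (L : ℕ) (x : Config w) (s : St) : Prop where
  reg : ∀ y : Var, (x.reg y.reg).toNat = s.v y
  len : (x.reg (tmp 0)).toNat = L
  mem : ∀ (a : Arr) (i : ℕ), i < L → (x.mem (BitVec.ofNat w (a.idx * L + i))).toNat = s.a a i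

lemma eval_toNat {w : ℕ} (o : BinOp) (x y : BitVec w) (h : OpOk (2 ^ w) o x.toNat y.toNat) :
    (o.eval x y).toNat = natOp o x.toNat y.toNat := by
  have hx := x.isLt
  have hy := y.isLt
  cases o <;> simp only [BinOp.eval, natOp, OpOk] at *
  · rw [BitVec.toNat_add, Nat.mod_eq_of_lt h]
  · rw [BitVec.toNat_sub]
    rw [show 2 ^ w - y.toNat + x.toNat = (x.toNat - y.toNat) + 2 ^ w by omega,
      Nat.add_mod_right, Nat.mod_eq_of_lt (by omega)]
  · rw [BitVec.toNat_mul, Nat.mod_eq_of_lt h]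
  · simp
  · simp
  · simp
  · rw [BitVec.shiftLeft_eq', BitVec.toNat_shiftLeft, Nat.shiftLeft_eq, Nat.mod_eq_of_lt h]
  · rw [BitVec.ushiftRight_eq', BitVec.toNat_ushiftRight, Nat.shiftRight_eq_div_pow]

lemma Rel.congr {w L : ℕ} {x y : Config w} {s : St} (h : Rel L x s) (hm : y.mem = x.mem)
    (hr : ∀ r, r % 2 = 0 ∨ r < 3 → y.reg r = x.reg r) : Rel L y s where
  reg z := by rw [hr _ (Or.inl (by simp [Var.reg]))]; exact h.reg z
  len := by rw [hr _ (Or.inr (by simp [tmp]))]; exact h.len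
  mem a i hi := by rw [hm]; exact h.mem a i hi

lemma addr_lt {w L i : ℕ} (hL : numArr * L ≤ 2 ^ w) (a : Arr) (hi : i < L) :
    a.idx * L + i < 2 ^ w := by
  have : (a.idx + 1) * L ≤ numArr * L := Nat.mul_le_mul_right _ a.idx_lt
  rw [add_mul] at this
  omega

lemma idx_lt_pow {w L : ℕ} (hL : numArr * L ≤ 2 ^ w) (h0 : 0 < L) (a : Arr) : a.idx < 2 ^ w := by
  have := addr_lt hL a h0
  have : a.idx * 1 ≤ a.idx * L := Nat.mul_le_mul_left _ h0
  omega

/-- The effect of the code for an expression: it puts `k` into `tmp d` and changes neither the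
variables, nor `tmp d'` for `d' < d`, nor the memory. -/
structure Eff {w : ℕ} (d k len : ℕ) (x y : Config w) : Prop where
  pc : y.pc = x.pc + len
  mem : y.mem = x.mem
  val : (y.reg (tmp d)).toNat = k
  reg : ∀ r, r % 2 = 0 ∨ r < tmp d → y.reg r = x.reg r

lemma Eff.rel {w L d k len : ℕ} {x y : Config w} {s : St} (h : Eff d k len x y) (hd : 1 ≤ d)
    (hx : Rel L x s) : Rel L y s :=
  hx.congr h.mem fun r hr => h.reg r (by unfold tmp; omega)

/-- The three instructions that turn an index into an address. -/
lemma addr_reach {w L : ℕ} {P : Program} {x : Config w} {s : St} {c : Program} (a : Arr) {i d : ℕ}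
    (hL : numArr * L ≤ 2 ^ w) (hi : i < L) (hd : 1 ≤ d) (hx : Rel L x s)
    (hv : (x.reg (tmp d)).toNat = i)
    (hc : CodeAt P x.pc ([.const (tmp (d + 1)) a.idx,
      .bin .mul (tmp (d + 1)) (tmp (d + 1)) (tmp 0),
      .bin .add (tmp d) (tmp (d + 1)) (tmp d)] ++ c)) :
    ∃ y, Reach P x 3 y ∧ Eff d (a.idx * L + i) 3 x y := by
  have ha := idx_lt_pow hL (by omega) a
  have hlt := addr_lt hL a hi
  refine ⟨_, ((hc.reach rfl).trans ((hc.tail.reach rfl).trans (hc.tail.tail.reach rfl))), rfl, rfl,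
    ?_, ?_⟩
  · have h0 : tmp 0 ≠ tmp (d + 1) := by unfold tmp; omega
    have h1 : tmp d ≠ tmp (d + 1) := by unfold tmp; omega
    have hm : OpOk (2 ^ w) .mul (BitVec.ofNat w a.idx).toNat (x.reg (tmp 0)).toNat := by
      simp only [OpOk, hx.len, BitVec.toNat_ofNat, Nat.mod_eq_of_lt ha]; omega
    have := eval_toNat .mul _ _ hm
    simp only [natOp, hx.len, BitVec.toNat_ofNat, Nat.mod_eq_of_lt ha] at this
    simp only [Instr.exec, Function.update_self, Function.update_of_ne h0, Function.update_of_ne h1]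
    rw [eval_toNat]
    · simp only [natOp, this, hv]
    · simp only [OpOk, this, hv]; exact hlt
  · intro r hr
    have h1 : r ≠ tmp (d + 1) := by unfold tmp at *; omega
    have h2 : r ≠ tmp d := by unfold tmp at *; omega
    simp [Instr.exec, h1, h2]

/-- Correctness of the code for expressions. -/
lemma Ex.reach {w L : ℕ} {P : Program} (hL : numArr * L ≤ 2 ^ w) (e : Ex) {x : Config w} {s : St}
    {d : ℕ} (hd : 1 ≤ d) (hx : Rel L x s) (ho : e.Ok (2 ^ w) L s)
    (hc : CodeAt P x.pc (e.code d)) :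
    ∃ y, Reach P x e.len y ∧ Eff d (e.eval s) e.len x y := by
  induction e generalizing x d with
  | var z =>
    refine ⟨_, hc.reach rfl, rfl, rfl, ?_, ?_⟩
    · simp [Instr.exec, eval_toNat .or _ _ (show OpOk (2 ^ w) .or _ _ from trivial), natOp,
         hx.reg z,
        Ex.eval]
    · intro r hr
      have h2 : r ≠ tmp d := by unfold tmp at *; omega
      simp [Instr.exec, h2]
  | lit k =>
    refine ⟨_, hc.reach rfl, rfl, rfl, ?_, ?_⟩
    · simp [Instr.exec, Ex.eval, Nat.mod_eq_of_lt (show k < 2 ^ w from ho)]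
    · intro r hr
      have h2 : r ≠ tmp d := by unfold tmp at *; omega
      simp [Instr.exec, h2]
  | bin o e f ihe ihf =>
    obtain ⟨ho1, ho2, ho3⟩ := ho
    obtain ⟨y, hy, hy'⟩ := ihe hd hx ho1 hc.left
    have hc2 := hc.right
    rw [Ex.length_code, ← hy'.pc] at hc2
    obtain ⟨z, hz, hz'⟩ := ihf (by omega) (hy'.rel hd hx) ho2 hc2.left
    have hc3 := hc2.right
    rw [Ex.length_code, ← hz'.pc] at hc3
    have hv : (z.reg (tmp d)).toNat = e.eval s := by
      rw [hz'.reg _ (Or.inr (by unfold tmp; omega)), hy'.val]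
    refine ⟨_, by simpa only [Ex.len, add_assoc] using hy.trans (hz.trans (hc3.reach rfl)), ?_, ?_,
      ?_, ?_⟩
    · simp only [Instr.exec, hz'.pc, hy'.pc, Ex.len]; omega
    · simp only [Instr.exec, hz'.mem, hy'.mem]
    · simp only [Instr.exec, Function.update_self]
      rw [eval_toNat _ _ _ (by rw [hv, hz'.val]; exact ho3), hv, hz'.val]; rfl
    · intro r hr
      have h2 : r ≠ tmp d := by unfold tmp at *; omega
      simp only [Instr.exec, Function.update_of_ne h2]
      rw [hz'.reg r (by unfold tmp at *; omega), hy'.reg r hr]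
  | get a e ih =>
    obtain ⟨ho1, ho2⟩ := ho
    obtain ⟨y, hy, hy'⟩ := ih hd hx ho1 hc.left
    have hc2 := hc.right
    rw [Ex.length_code, ← hy'.pc] at hc2
    obtain ⟨z, hz, hz'⟩ := addr_reach (c := [.load (tmp d) (tmp d)]) a hL ho2 hd (hy'.rel hd hx)
      hy'.val hc2
    have hc3 := hc2.tail.tail.tail
    refine ⟨_, by simpa only [Ex.len, add_assoc] using hy.trans (hz.trans (hc3.reach hz'.pc)), ?_,
      ?_, ?_, ?_⟩
    · simp only [Instr.exec, hz'.pc, hy'.pc, Ex.len]; omega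
    · simp only [Instr.exec, hz'.mem, hy'.mem]
    · simp only [Instr.exec, Function.update_self]
      have : z.reg (tmp d) = BitVec.ofNat w (a.idx * L + e.eval s) := by
        rw [← hz'.val]; simp
      rw [this, (hz'.rel hd (hy'.rel hd hx)).mem a _ ho2]; rfl
    · intro r hr
      have h2 : r ≠ tmp d := by unfold tmp at *; omega
      simp only [Instr.exec, Function.update_of_ne h2]
      rw [hz'.reg r hr, hy'.reg r hr]

/-- Execution of a command whose code uses the temporary registers from `tmp d` on: the new
configuration `y` represents the new state `s`. -/
structure Res {w : ℕ} (L d len : ℕ) (s : St) (x y : Config w) : Prop where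
  pc : y.pc = x.pc + len
  rel : Rel L y s
  reg : ∀ d' < d, y.reg (tmp d') = x.reg (tmp d')

lemma Eff.res {w L d d' k len : ℕ} {x y : Config w} {s : St} (h : Eff d k len x y) (hd : 1 ≤ d)
    (hx : Rel L x s) (hd' : d' ≤ d) : Res L d' len s x y :=
  ⟨h.pc, h.rel hd hx, fun e he => h.reg _ (Or.inr (by unfold tmp; omega))⟩

lemma Res.trans {w L d l1 l2 : ℕ} {s s' : St} {x y z : Config w} (h : Res L d l1 s x y)
    (h' : Res L d l2 s' y z) : Res L d (l1 + l2) s' x z :=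
  ⟨by rw [h'.pc, h.pc, add_assoc], h'.rel, fun e he => by rw [h'.reg e he, h.reg e he]⟩

lemma reg_ne_tmp (x : Var) (d : ℕ) : tmp d ≠ x.reg := by
  unfold tmp Var.reg; omega

/-- Copying a temporary register into the register of a variable. -/
lemma Rel.setv {w L d : ℕ} {x : Config w} {s : St} (h : Rel L x s) (z : Var) :
    Res L d 1 (s.setv z (x.reg (tmp d)).toNat) x
      ((Instr.bin .or z.reg (tmp d) (tmp d)).exec x) := by
  refine ⟨rfl, ⟨fun y => ?_, ?_, h.mem⟩, fun e _ => ?_⟩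
  · by_cases hy : y = z
    · subst hy; simp [Instr.exec, BinOp.eval]
    · have : y.reg ≠ z.reg := fun h => hy (Var.idx_inj.1 (by unfold Var.reg at h; omega))
      simp [Instr.exec, hy, this, h.reg y]
  · simp [Instr.exec, reg_ne_tmp, h.len]
  · simp [Instr.exec, reg_ne_tmp]

lemma Rel.jump {w L d len : ℕ} {x : Config w} {s : St} (h : Rel L x s) :
    Res L d len s x { x with pc := x.pc + len } :=
  ⟨rfl, ⟨h.reg, h.len, h.mem⟩, fun _ _ => rfl⟩

lemma Rel.seta {w L : ℕ} {x : Config w} {s : St} (hL : numArr * L ≤ 2 ^ w) (h : Rel L x s)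
    {d d' : ℕ} {a : Arr} {i : ℕ} (hi : i < L)
    (hv : x.reg (tmp d) = BitVec.ofNat w (a.idx * L + i)) :
    Res L d 1 (s.seta a i (x.reg (tmp d')).toNat) x ((Instr.store (tmp d) (tmp d')).exec x) := by
  refine ⟨rfl, ⟨h.reg, h.len, fun b j hj => ?_⟩, fun _ _ => rfl⟩
  have e : BitVec.ofNat w (b.idx * L + j) = BitVec.ofNat w (a.idx * L + i) ↔ b = a ∧ j = i := by
    refine ⟨fun he => ?_, by rintro ⟨rfl, rfl⟩; rfl⟩
    have := congrArg BitVec.toNat he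
    rw [BitVec.toNat_ofNat, BitVec.toNat_ofNat, Nat.mod_eq_of_lt (addr_lt hL b hj),
      Nat.mod_eq_of_lt (addr_lt hL a hi)] at this
    have h1 : (b.idx * L + j) / L = (a.idx * L + i) / L := by rw [this]
    rw [mul_comm, Nat.mul_add_div (by omega), mul_comm, Nat.mul_add_div (by omega),
      Nat.div_eq_of_lt hi, Nat.div_eq_of_lt hj] at h1
    have h2 : b.idx = a.idx := by simpa using h1
    rw [h2] at this
    exact ⟨Arr.idx_inj.1 h2, by omega⟩
  simp only [Instr.exec, hv, St.seta_a, Function.update_apply, e]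
  by_cases hb : b = a
  · subst hb
    by_cases hj' : j = i
    · simp [hj']
    · simp [hj', h.mem b j hj]
  · simp [hb, h.mem b j hj]

lemma lt_iff {w : ℕ} (a b : BitVec w) : a < b ↔ a.toNat < b.toNat := Iff.rfl

/-- Correctness of the compilation: the code of a command turns a configuration that represents the
state `s` into one that represents the state after the command, in as many steps as `Cmd.cost`
says. -/
theorem Cmd.reach {w L : ℕ} {P : Program} (hL : numArr * L ≤ 2 ^ w) (c : Cmd) {x : Config w}
    {s : St} {d : ℕ} (hd : 1 ≤ d) (hx : Rel L x s) (ho : c.Ok (2 ^ w) L s)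
    (hc : CodeAt P x.pc (c.code x.pc d)) :
    ∃ y, Reach P x (c.cost s) y ∧ Res L d c.len (c.den s) x y := by
  induction c generalizing x s d with
  | skip => exact ⟨x, Reach.refl _ _, rfl, hx, fun _ _ => rfl⟩
  | set z e =>
    obtain ⟨y, hy, hy'⟩ := e.reach hL hd hx ho hc.left
    have hc2 := hc.right
    rw [Ex.length_code, ← hy'.pc] at hc2
    have := (hy'.rel hd hx).setv z (d := d)
    rw [hy'.val] at this
    exact ⟨_, hy.trans (hc2.reach rfl), (hy'.res hd hx le_rfl).trans this⟩
  | put a e f =>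
    obtain ⟨ho1, ho2, ho3⟩ := ho
    obtain ⟨y, hy, hy'⟩ := e.reach hL hd hx ho1 hc.left
    have hc2 := hc.right
    rw [Ex.length_code, ← hy'.pc] at hc2
    obtain ⟨z, hz, hz'⟩ := addr_reach a hL ho3 hd (hy'.rel hd hx) hy'.val hc2
    have hc3 := hc2.right
    rw [List.length_cons, List.length_cons, List.length_cons, List.length_nil, ← hz'.pc] at hc3
    have hzr := hz'.rel hd (hy'.rel hd hx)
    obtain ⟨u, hu, hu'⟩ := f.reach hL (by omega) hzr ho2 hc3.left
    have hc4 := hc3.right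
    rw [Ex.length_code, ← hu'.pc] at hc4
    have hur := hu'.rel (by omega) hzr
    have := hur.seta hL (d := d) (d' := d + 1) (a := a) ho3 (by
      rw [hu'.reg _ (Or.inr (by unfold tmp; omega)), ← hz'.val]; simp)
    rw [hu'.val] at this
    exact ⟨_, ((hy.trans hz).trans hu).trans (hc4.reach rfl),
      (((hy'.res hd hx le_rfl).trans (hz'.res hd (hy'.rel hd hx) le_rfl)).trans
        (hu'.res (by omega) hzr (by omega))).trans this⟩
  | seq c c' ih ih' =>
    obtain ⟨ho1, ho2⟩ := ho
    obtain ⟨y, hy, hy'⟩ := ih hd hx ho1 hc.left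
    have hc2 := hc.right
    rw [Cmd.length_code, ← hy'.pc] at hc2
    obtain ⟨z, hz, hz'⟩ := ih' hd hy'.rel ho2 hc2
    exact ⟨z, hy.trans hz, hy'.trans hz'⟩
  | iflt e f c c' ih ih' =>
    obtain ⟨ho1, ho2, ho3, ho4⟩ := ho
    obtain ⟨y, hy, hy'⟩ := e.reach hL hd hx ho1 hc.left
    have hc2 := hc.right
    rw [Ex.length_code, ← hy'.pc] at hc2
    have hyr := hy'.rel hd hx
    obtain ⟨z, hz, hz'⟩ := f.reach hL (by omega) hyr ho2 hc2.left
    have hc3 := hc2.right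
    rw [Ex.length_code, ← hz'.pc] at hc3
    have hzr := hz'.rel (by omega) hyr
    have hxz := (hy'.res hd hx le_rfl).trans (hz'.res (by omega) hyr (Nat.le_succ d))
    have hv : z.reg (tmp d) < z.reg (tmp (d + 1)) ↔ e.eval s < f.eval s := by
      rw [lt_iff, hz'.val, hz'.reg _ (Or.inr (by unfold tmp; omega)), hy'.val]
    have hc4 := hc3.right
    rw [List.length_cons, List.length_nil] at hc4
    have hc5 := hc4.right
    rw [Cmd.length_code] at hc5
    have hc6 := hc5.right
    rw [List.length_cons, List.length_nil] at hc6
    have hj := hc3.left.reach rfl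
    by_cases hlt : e.eval s < f.eval s
    · have e1 : (Instr.jumpLt (tmp d) (tmp (d + 1))
          (z.pc + 1 + c'.len + 1)).exec z
          = { z with pc := z.pc + (1 + c'.len + 1) } := by
        simp only [Instr.exec, hv.2 hlt, if_true, Config.mk.injEq, and_true]; omega
      rw [e1] at hj
      have hj' : Res L d (1 + c'.len + 1) s z _ := hzr.jump
      obtain ⟨u, hu, hu'⟩ := ih (x := { z with pc := z.pc + (1 + c'.len + 1) }) hd hj'.rel (ho3 hlt)
        (by simp only [zero_add, ← add_assoc] at hc6 ⊢; exact hc6)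
      refine ⟨u, ?_, ?_⟩
      · simp only [Cmd.cost, hlt, if_true]
        exact ((hy.trans hz).trans hj).trans hu
      · have := hxz.trans (hj'.trans hu')
        simp only [Cmd.den, hlt, if_true, Cmd.len]
        simpa only [add_assoc] using this
    · have e1 : (Instr.jumpLt (tmp d) (tmp (d + 1))
          (z.pc + 1 + c'.len + 1)).exec z
          = { z with pc := z.pc + 1 } := by
        simp only [Instr.exec, hv, hlt, if_false]
      rw [e1] at hj
      have hj' : Res L d 1 s z _ := hzr.jump
      obtain ⟨u, hu, hu'⟩ := ih' (x := { z with pc := z.pc + 1 }) hd hj'.rel (ho4 hlt)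
        hc4.left
      have hupc : u.pc = z.pc + 1 + c'.len := by rw [hu'.pc]
      have hj2 := hc5.left.reach (x := u) hupc
      have e2 : (Instr.jumpEq 0 0
          (z.pc + 1 + c'.len + 1 + c.len)).exec u
          = { u with pc := u.pc + (1 + c.len) } := by
        simp only [Instr.exec, if_true, hupc, Config.mk.injEq, and_true]; omega
      rw [e2] at hj2
      have hj2' : Res L d (1 + c.len) _ u _ := hu'.rel.jump
      refine ⟨{ u with pc := u.pc + (1 + c.len) }, ?_, ?_⟩
      · have := (((hy.trans hz).trans hj).trans hu).trans hj2
        simp only [Cmd.cost, hlt, if_false]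
        convert this using 1
        ring
      · have := hxz.trans (hj'.trans (hu'.trans hj2'))
        simp only [Cmd.den, hlt, if_false, Cmd.len]
        simpa only [add_assoc] using this
  | for_ z e c ih =>
    obtain ⟨ho1, ho2⟩ := ho
    obtain ⟨y, hy, hy'⟩ := e.reach hL hd hx ho1 hc.left
    have hc2 := hc.right
    rw [Ex.length_code, ← hy'.pc] at hc2
    have hyr := hy'.rel hd hx
    have hi := hc2.left.reach rfl
    have hir : Res L (d + 1) 1 s y ((Instr.const (tmp (d + 1)) 0).exec y) := by
      refine ⟨rfl, hyr.congr rfl fun r hr => ?_, fun d' hd' => ?_⟩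
      · have : r ≠ tmp (d + 1) := by unfold tmp; omega
        simp [Instr.exec, this]
      · have : tmp d' ≠ tmp (d + 1) := by unfold tmp; omega
        simp [Instr.exec, this]
    have hc3 := hc2.right
    rw [List.length_cons, List.length_nil] at hc3
    have hc4 := hc3.right.left
    rw [List.length_cons, List.length_cons, List.length_cons, List.length_nil] at hc4
    have hc5 := hc3.right.right
    rw [List.length_cons, List.length_cons, List.length_cons, List.length_nil, Cmd.length_code]
      at hc5
    rw [hy'.pc] at hc3 hc4 hc5
    set N := e.eval s with hN
    set base := x.pc + e.len + 1 with hbase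
    -- Before round `k` the configuration is at the test of the loop condition. The bound `N` and
    -- the counter `k` are in the registers `tmp d` and `tmp (d + 1)`, which the body leaves
    -- unchanged.
    have key : ∀ k ≤ N, ∃ u, Reach P x
        (e.len + 1 + ∑ j ∈ Finset.range k, (c.cost ((loopSt c.den z s j).setv z j) + 5)) u ∧
        u.pc = base ∧ Rel L u (loopSt c.den z s k) ∧ (∀ d' < d, u.reg (tmp d') = x.reg (tmp d')) ∧
        (u.reg (tmp d)).toNat = N ∧ (u.reg (tmp (d + 1))).toNat = k := by
      intro k
      induction k with
      | zero =>
        intro _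
        refine ⟨_, hy.trans hi, ?_, hir.rel, fun d' hd' => ?_, ?_, ?_⟩
        · simp only [Instr.exec, hy'.pc, hbase]
        · rw [hir.reg d' (by omega), hy'.reg _ (Or.inr (by unfold tmp; omega))]
        · rw [hir.reg d (by omega), hy'.val]
        · simp [Instr.exec]
      | succ k ihk =>
        intro hk
        obtain ⟨u, hu, hupc, hur, hureg, huN, huk⟩ := ihk (by omega)
        have hNlt : N < 2 ^ w := huN ▸ (u.reg (tmp d)).isLt
        have j1 := hc3.left.reach hupc
        have e1 : (Instr.jumpLt (tmp (d + 1)) (tmp d) (base + 2)).exec u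
            = { u with pc := u.pc + 2 } := by
          have : u.reg (tmp (d + 1)) < u.reg (tmp d) := by rw [lt_iff, huN, huk]; omega
          simp only [Instr.exec, this, if_true, hupc]
        rw [e1] at j1
        have j1' : Res L (d + 2) 2 _ u _ := hur.jump
        have j2 := hc3.left.tail.tail.reach (x := { u with pc := u.pc + 2 }) (by simp [hupc])
        have j2' := j1'.rel.setv z (d := d + 1)
        set u2 := (Instr.bin .or z.reg (tmp (d + 1)) (tmp (d + 1))).exec { u with pc := u.pc + 2 }
          with hu2
        have hu2k : (u2.reg (tmp (d + 1))).toNat = k := by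
          simp [hu2, Instr.exec, reg_ne_tmp, huk]
        have hu2reg : ∀ d', u2.reg (tmp d') = u.reg (tmp d') := fun d' => by
          simp [hu2, Instr.exec, reg_ne_tmp]
        have hr : Rel L u2 ((loopSt c.den z s k).setv z k) := by
          have := j2'.rel
          simp only [huk] at this
          exact this
        have hpc2 : u2.pc = base + 3 := by simp [hu2, Instr.exec, hupc]
        obtain ⟨u3, j3, j3'⟩ := ih (x := u2) (d := d + 2) (by omega) hr (ho2 k (by omega))
          (by rw [hpc2]; exact hc4)
        have hpc3 : u3.pc = base + 3 + c.len := by rw [j3'.pc, hpc2]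
        have j4 := hc5.reach hpc3
        have j5 := hc5.tail.reach (x := (Instr.const (tmp (d + 2)) 1).exec u3)
          (by simp [Instr.exec, hpc3])
        set u4 := (Instr.bin .add (tmp (d + 1)) (tmp (d + 1)) (tmp (d + 2))).exec
          ((Instr.const (tmp (d + 2)) 1).exec u3) with hu4
        have hpc4 : u4.pc = base + 3 + c.len + 1 + 1 := by simp [hu4, Instr.exec, hpc3]
        have j6 := hc5.tail.tail.reach hpc4
        have hu3k : (u3.reg (tmp (d + 1))).toNat = k := by rw [j3'.reg _ (by omega), hu2k]
        have n1 : tmp (d + 1) ≠ tmp (d + 2) := by unfold tmp; omega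
        have hu4' : ∀ r, r % 2 = 0 ∨ r < tmp (d + 1) → u4.reg r = u3.reg r := by
          intro r hr
          have h1 : r ≠ tmp (d + 1) := by unfold tmp at *; omega
          have h2 : r ≠ tmp (d + 2) := by unfold tmp at *; omega
          simp [hu4, Instr.exec, h1, h2]
        refine ⟨(Instr.jumpEq 0 0 base).exec u4, ?_, ?_, ?_, fun d' hd' => ?_, ?_, ?_⟩
        · have := ((((hu.trans j1).trans j2).trans j3).trans (j4.trans j5)).trans j6
          rw [Finset.sum_range_succ]
          convert this using 1
          ring
        · simp [Instr.exec]
        · exact j3'.rel.congr rfl fun r hr => hu4' r (by unfold tmp; omega)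
        · simp only [Instr.exec]
          rw [hu4' _ (Or.inr (by unfold tmp; omega)), j3'.reg _ (by omega), hu2reg, hureg _ hd']
        · simp only [Instr.exec]
          rw [hu4' _ (Or.inr (by unfold tmp; omega)), j3'.reg _ (by omega), hu2reg, huN]
        · have h1 : 1 < 2 ^ w := by omega
          simp only [Instr.exec, hu4, Function.update_self, Function.update_of_ne n1]
          rw [eval_toNat]
          · simp [natOp, hu3k, Nat.mod_eq_of_lt h1]
          · simp only [OpOk, hu3k, BitVec.toNat_ofNat, Nat.mod_eq_of_lt h1]; omega
    obtain ⟨u, hu, hupc, hur, hureg, huN, huk⟩ := key N le_rfl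
    have j1 := hc3.left.reach hupc
    have e1 : (Instr.jumpLt (tmp (d + 1)) (tmp d) (base + 2)).exec u
        = { u with pc := u.pc + 1 } := by
      have : ¬ u.reg (tmp (d + 1)) < u.reg (tmp d) := by rw [lt_iff, huN, huk]; omega
      simp only [Instr.exec, this, if_false]
    rw [e1] at j1
    have j2 := hc3.left.tail.reach (x := { u with pc := u.pc + 1 }) (by simp [hupc])
    refine ⟨(Instr.jumpEq 0 0 (base + 3 + c.len + 3)).exec { u with pc := u.pc + 1 }, ?_, ?_, ?_,
      fun d' hd' => ?_⟩
    · have := (hu.trans j1).trans j2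
      simp only [Cmd.cost]
      convert this using 1
      rw [← hN]
      ring
    · simp [Instr.exec, Cmd.len, hbase]; omega
    · exact ⟨hur.reg, hur.len, hur.mem⟩
    · exact hureg d' hd'

/-! ### Reasoning about structured programs -/

/-- The command `c` runs from the state `s` without overflow and without array indices out of
bounds, and `Q` holds for the final state and the running time. As `c` always terminates, this is
the weakest precondition of `Q`. -/
def Runs (M L : ℕ) (c : Cmd) (s : St) (Q : St → ℕ → Prop) : Prop :=
  c.Ok M L s ∧ Q (c.den s) (c.cost s)

section
variable {M L : ℕ} {s : St} {Q Q' : St → ℕ → Prop}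

lemma Runs.mono {c : Cmd} (h : Runs M L c s Q) (hQ : ∀ s' t, Q s' t → Q' s' t) :
    Runs M L c s Q' :=
  ⟨h.1, hQ _ _ h.2⟩

@[simp] lemma runs_skip : Runs M L .skip s Q ↔ Q s 0 := by
  simp [Runs, Cmd.Ok, Cmd.den, Cmd.cost]

@[simp] lemma runs_set {x : Var} {e : Ex} :
    Runs M L (x ::= e) s Q ↔ e.Ok M L s ∧ Q (s.setv x (e.eval s)) (e.len + 1) := Iff.rfl

@[simp] lemma runs_put {a : Arr} {e f : Ex} :
    Runs M L (.put a e f) s Q ↔ (e.Ok M L s ∧ f.Ok M L s ∧ e.eval s < L) ∧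
      Q (s.seta a (e.eval s) (f.eval s)) (e.len + 3 + f.len + 1) := Iff.rfl

@[simp] lemma runs_seq {c c' : Cmd} : Runs M L (c ;; c') s Q ↔
    Runs M L c s fun s' t => Runs M L c' s' fun s'' t' => Q s'' (t + t') := by
  simp [Runs, Cmd.Ok, Cmd.den, Cmd.cost, and_assoc]

lemma runs_iflt {e f : Ex} {c c' : Cmd} : Runs M L (.iflt e f c c') s Q ↔
    e.Ok M L s ∧ f.Ok M L s ∧
    (e.eval s < f.eval s → Runs M L c s fun s' t => Q s' (e.len + f.len + 1 + t)) ∧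
    (f.eval s ≤ e.eval s → Runs M L c' s fun s' t => Q s' (e.len + f.len + 1 + (t + 1))) := by
  by_cases h : e.eval s < f.eval s
  · simp [Runs, Cmd.Ok, Cmd.den, Cmd.cost, h, and_assoc]
  · simp [Runs, Cmd.Ok, Cmd.den, Cmd.cost, h, not_lt.1 h, and_assoc]

/-- The variables that a command may change. -/
def Cmd.vars : Cmd → List Var
  | .skip => []
  | .set x _ => [x]
  | .put _ _ _ => []
  | .seq c c' => c.vars ++ c'.vars
  | .iflt _ _ c c' => c.vars ++ c'.vars
  | .for_ x _ c => x :: c.vars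

/-- The arrays that a command may change. -/
def Cmd.arrs : Cmd → List Arr
  | .skip => []
  | .set _ _ => []
  | .put a _ _ => [a]
  | .seq c c' => c.arrs ++ c'.arrs
  | .iflt _ _ c c' => c.arrs ++ c'.arrs
  | .for_ _ _ c => c.arrs

/-- The states `s` and `s'` agree except for the variables `vs` and the arrays `as`. -/
structure Frame (vs : List Var) (as : List Arr) (s s' : St) : Prop where
  v : ∀ x, x ∉ vs → s'.v x = s.v x
  a : ∀ b, b ∉ as → s'.a b = s.a b

lemma Frame.trans {vs : List Var} {as : List Arr} {s s' s'' : St} (h : Frame vs as s s')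
    (h' : Frame vs as s' s'') : Frame vs as s s'' :=
  ⟨fun x hx => by rw [h'.v x hx, h.v x hx], fun x hx => by rw [h'.a x hx, h.a x hx]⟩

lemma Frame.mono {vs vs' : List Var} {as as' : List Arr} {s s' : St} (h : Frame vs as s s')
    (hv : vs ⊆ vs') (ha : as ⊆ as') : Frame vs' as' s s' :=
  ⟨fun x hx => h.v x fun hx' => hx (hv hx'), fun x hx => h.a x fun hx' => hx (ha hx')⟩

lemma Frame.rfl' {vs : List Var} {as : List Arr} {s : St} : Frame vs as s s :=
  ⟨fun _ _ => rfl, fun _ _ => rfl⟩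

lemma frame_loopSt {f : St → St} {x : Var} {vs : List Var} {as : List Arr}
    (h : ∀ s, Frame vs as s (f s)) (s : St) (k : ℕ) :
    Frame (x :: vs) as s (loopSt f x s k) := by
  induction k with
  | zero => exact Frame.rfl'
  | succ k ih =>
    refine ih.trans (Frame.trans (s' := (loopSt f x s k).setv x k) ⟨fun y hy => ?_, fun _ _ => rfl⟩
      ((h _).mono (List.subset_cons_self _ _) (fun _ h => h)))
    simp only [List.mem_cons, not_or] at hy
    simp [hy.1]

lemma Cmd.frame (c : Cmd) (s : St) : Frame c.vars c.arrs s (c.den s) := by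
  induction c generalizing s with
  | skip => exact Frame.rfl'
  | set x e => exact ⟨fun y hy => by simp_all [Cmd.vars, Cmd.den], fun _ _ => rfl⟩
  | put a e f => exact ⟨fun _ _ => rfl, fun y hy => by simp_all [Cmd.arrs, Cmd.den]⟩
  | seq c c' ih ih' =>
    exact ((ih s).mono (List.subset_append_left _ _) (List.subset_append_left _ _)).trans
      ((ih' _).mono (List.subset_append_right _ _) (List.subset_append_right _ _))
  | iflt e f c c' ih ih' =>
    simp only [Cmd.den]
    split
    · exact (ih s).mono (List.subset_append_left _ _) (List.subset_append_left _ _)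
    · exact (ih' s).mono (List.subset_append_right _ _) (List.subset_append_right _ _)
  | for_ x e c ih => exact frame_loopSt ih s _

/-- What a command does not mention on the left of an assignment is unchanged. Postconditions
need not list these facts. -/
lemma Runs.frame {c : Cmd} (h : Runs M L c s Q) :
    Runs M L c s fun s' t => Frame c.vars c.arrs s s' ∧ Q s' t :=
  ⟨h.1, c.frame s, h.2⟩

/-- The rule for loops: `I k s' T` says that `s'` is a possible state before round `k`, reached
in time `T`. Variables and arrays that the loop does not change keep their values without being
mentioned in `I`. -/
lemma runs_for {x : Var} {e : Ex} {c : Cmd} (I : ℕ → St → ℕ → Prop)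
    (he : e.Ok M L s) (h0 : I 0 s 0)
    (hs : ∀ k s' T, k < e.eval s → Frame (x :: c.vars) c.arrs s s' → I k s' T →
      Runs M L c (s'.setv x k) fun s'' t => I (k + 1) s'' (T + (t + 5)))
    (hQ : ∀ s' T, Frame (x :: c.vars) c.arrs s s' → I (e.eval s) s' T → Q s' (e.len + 3 + T)) :
    Runs M L (.for_ x e c) s Q := by
  have key : ∀ k ≤ e.eval s, (∀ j < k, c.Ok M L ((loopSt c.den x s j).setv x j)) ∧
      I k (loopSt c.den x s k)
        (∑ j ∈ Finset.range k, (c.cost ((loopSt c.den x s j).setv x j) + 5)) := by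
    intro k
    induction k with
    | zero => exact fun _ => ⟨fun j hj => absurd hj (Nat.not_lt_zero _), by simpa [loopSt] using h0⟩
    | succ k ih =>
      intro hk
      obtain ⟨h1, h2⟩ := ih (by omega)
      obtain ⟨h3, h4⟩ := hs k _ _ (by omega) (frame_loopSt c.frame s k) h2
      refine ⟨fun j hj => ?_, ?_⟩
      · rcases Nat.lt_succ_iff_lt_or_eq.1 hj with h | rfl
        · exact h1 j h
        · exact h3
      · rw [Finset.sum_range_succ]; exact h4
  obtain ⟨h1, h2⟩ := key _ le_rfl
  exact ⟨⟨he, h1⟩, hQ _ _ (frame_loopSt c.frame s _) h2⟩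

end

/-! ### Stable counting sort -/

/-- The number of indices `i < k` with `key i = x`. -/
def cntEq (key : ℕ → ℕ) (k x : ℕ) : ℕ := #{i ∈ range k | key i = x}

/-- The number of indices `i < m` with `key i < x`. -/
def cntLt (key : ℕ → ℕ) (m x : ℕ) : ℕ := #{i ∈ range m | key i < x}

/-- The position of `i` when the indices below `m` are sorted by their keys, indices with the same
key by size. -/
def lexRank (key : ℕ → ℕ) (m i : ℕ) : ℕ := cntLt key m (key i) + cntEq key i (key i)

lemma cntEq_zero (key : ℕ → ℕ) (x : ℕ) : cntEq key 0 x = 0 := by simp [cntEq]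

lemma cntEq_succ (key : ℕ → ℕ) (k x : ℕ) :
    cntEq key (k + 1) x = cntEq key k x + if key k = x then 1 else 0 := by
  unfold cntEq
  rw [range_add_one, filter_insert]
  split <;> simp

lemma cntLt_zero (key : ℕ → ℕ) (m : ℕ) : cntLt key m 0 = 0 := by simp [cntLt]

lemma cntLt_succ (key : ℕ → ℕ) (m x : ℕ) :
    cntLt key m (x + 1) = cntLt key m x + cntEq key m x := by
  unfold cntLt cntEq
  rw [← card_union_of_disjoint]
  · congr 1; ext i; simp only [mem_filter, mem_union]; grind
  · rw [disjoint_filter]; grind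

lemma cntLt_le (key : ℕ → ℕ) (m x : ℕ) : cntLt key m x ≤ m :=
  (card_filter_le _ _).trans_eq (card_range m)

lemma cntEq_le (key : ℕ → ℕ) (m x : ℕ) : cntEq key m x ≤ m :=
  (card_filter_le _ _).trans_eq (card_range m)

lemma lexRank_eq_card {key : ℕ → ℕ} {m i : ℕ} (hi : i < m) :
    lexRank key m i = #{j ∈ range m | key j < key i ∨ key j = key i ∧ j < i} := by
  unfold lexRank cntLt cntEq
  rw [filter_or, card_union_of_disjoint]
  · congr 2; ext j; simp only [mem_filter, mem_range]; grind
  · rw [disjoint_filter]; grind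

/-- The rank orders the indices lexicographically by key and index. -/
lemma lexRank_lt_iff {key : ℕ → ℕ} {m i j : ℕ} (hi : i < m) (hj : j < m) :
    lexRank key m i < lexRank key m j ↔ key i < key j ∨ key i = key j ∧ i < j := by
  rw [lexRank_eq_card hi, lexRank_eq_card hj]
  have h1 : ∀ {i j : ℕ}, i < m → (key i < key j ∨ key i = key j ∧ i < j) →
      #{k ∈ range m | key k < key i ∨ key k = key i ∧ k < i} <
      #{k ∈ range m | key k < key j ∨ key k = key j ∧ k < j} := by
    intro i j hi h
    apply card_lt_card
    rw [ssubset_iff_of_subset]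
    · exact ⟨i, by simp [hi, h], by simp⟩
    · intro k; simp only [mem_filter, mem_range]; grind
  constructor
  · intro h
    by_contra hc
    rcases eq_or_ne i j with rfl | hne
    · omega
    · have := h1 hj (show key j < key i ∨ key j = key i ∧ j < i by omega)
      omega
  · exact h1 hi

lemma lexRank_lt {key : ℕ → ℕ} {m i : ℕ} (hi : i < m) : lexRank key m i < m := by
  rw [lexRank_eq_card hi]
  refine (card_lt_card ?_).trans_eq (card_range m)
  rw [ssubset_iff_of_subset (filter_subset _ _)]
  exact ⟨i, by simp [hi]⟩

lemma lexRank_inj {key : ℕ → ℕ} {m i j : ℕ} (hi : i < m) (hj : j < m)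
    (h : lexRank key m i = lexRank key m j) : i = j := by
  have h1 := lexRank_lt_iff (key := key) hi hj
  have h2 := lexRank_lt_iff (key := key) hj hi
  omega

/-- Every position is taken, since `lexRank` is injective. -/
lemma exists_lexRank {key : ℕ → ℕ} {m p : ℕ} (hp : p < m) : ∃ i < m, lexRank key m i = p := by
  have h : Set.InjOn (lexRank key m) (range m) := fun i hi j hj h =>
    lexRank_inj (by simpa using hi) (by simpa using hj) h
  have h2 : Finset.image (lexRank key m) (range m) = range m := by
    apply eq_of_subset_of_card_le
    · intro x hx
      obtain ⟨i, hi, rfl⟩ := mem_image.1 hx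
      exact mem_range.2 (lexRank_lt (mem_range.1 hi))
    · rw [card_image_of_injOn h]
  have : p ∈ Finset.image (lexRank key m) (range m) := by rw [h2]; simpa using hp
  simpa using this

/-- Stable counting sort of the indices below `m` by their entries in `key`, which are smaller than
`2 * m + 2`. The position of every index is put into `pos`. -/
def rankSort : Cmd :=
  .for_ .k (2 * Var.m + 2) (.put .count Var.k 0) ;;
  .for_ .k Var.m (.put .count (.get .key Var.k) (.get .count (.get .key Var.k) + 1)) ;;
  .acc ::= 0 ;;
  .for_ .k (2 * Var.m + 2) (
    .t ::= .get .count Var.k ;;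
    .put .count Var.k Var.acc ;;
    .acc ::= Var.acc + Var.t) ;;
  .for_ .k Var.m (
    .t ::= .get .key Var.k ;;
    .put .pos Var.k (.get .count Var.t) ;;
    .put .count Var.t (.get .count Var.t + 1))

lemma runs_rankSort {M L m : ℕ} {s : St} (hm : s.v .m = m) (hL : 2 * m + 2 ≤ L) (hM : 4 * L ≤ M)
    (hk : ∀ i < m, s.a .key i < 2 * m + 2) :
    Runs M L rankSort s fun s' t => t ≤ 300 * m + 300 ∧
      ∀ i < m, s'.a .pos i = lexRank (s.a .key) m i := by
  unfold rankSort
  simp only [runs_seq]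
  refine runs_for (fun k s' T => T ≤ 20 * k ∧ ∀ x < k, s'.a .count x = 0) ?_ ?_ ?_ ?_
  · simp; omega
  · simp
  · rintro k s1 T hk1 hF ⟨hT, hI⟩
    simp at hk1 ⊢
    refine ⟨by omega, by omega, fun x hx => ?_⟩
    grind [Function.update_apply]
  rintro s1 T1 hF1 ⟨hT1, hI1⟩
  simp at hT1 hI1
  have hm1 : s1.v .m = m := by rw [hF1.v _ (by decide), hm]
  have hk1 : s1.a .key = s.a .key := hF1.a _ (by decide)
  refine runs_for (fun k s' T => T ≤ 50 * k ∧ ∀ x < 2 * m + 2, s'.a .count x = cntEq (s.a .key) k x)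
    ?_ ?_ ?_ ?_
  · simp
  · refine ⟨by simp, fun x hx => ?_⟩
    rw [cntEq_zero, hI1 _ (by omega)]
  · rintro k s2 T hk2 hF ⟨hT, hI⟩
    have hk' : s2.a .key = s.a .key := by rw [hF.a _ (by decide), hk1]
    simp [hm1] at hk2
    simp [hk', hI _ (hk _ hk2)]
    have := hk _ hk2
    have := cntEq_le (s.a .key) k (s.a .key k)
    refine ⟨by omega, by omega, fun x hx => ?_⟩
    rw [cntEq_succ]
    grind [Function.update_apply]
  rintro s2 T2 hF2 ⟨hT2, hI2⟩
  simp only [Ex.eval_var, hm1] at hT2 hI2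
  have hm2 : s2.v .m = m := by rw [hF2.v _ (by decide), hm1]
  have hk2 : s2.a .key = s.a .key := by rw [hF2.a _ (by decide), hk1]
  simp only [runs_set]
  refine ⟨by simp; omega, ?_⟩
  refine runs_for (fun k s' T => T ≤ 50 * k ∧ s'.v .acc = cntLt (s.a .key) m k ∧
    (∀ x < k, s'.a .count x = cntLt (s.a .key) m x) ∧
    (∀ x < 2 * m + 2, k ≤ x → s'.a .count x = cntEq (s.a .key) m x)) ?_ ?_ ?_ ?_
  · simp [hm2]; omega
  · refine ⟨by simp, by simp [cntLt_zero], by simp, fun x hx _ => by simp [hI2 x hx]⟩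
  · rintro k s3 T hk3 hF ⟨hT, hacc, hI, hI'⟩
    simp [hm2] at hk3
    simp [hacc, hI' k hk3 le_rfl, Function.update_apply]
    have := cntLt_le (s.a .key) m k
    have := cntEq_le (s.a .key) m k
    refine ⟨by omega, by omega, by omega, ?_, fun x hx => ?_, fun x hx hx' => ?_⟩
    · rw [cntLt_succ]
    · split
      · subst x; rfl
      · exact hI x (by omega)
    · rw [if_neg (by omega), hI' x hx (by omega)]
  rintro s3 T3 hF3 ⟨hT3, -, hI3, -⟩
  simp [hm2] at hT3 hI3
  have hm3 : s3.v .m = m := by rw [hF3.v _ (by decide)]; simp [hm2]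
  have hk3 : s3.a .key = s.a .key := by rw [hF3.a _ (by decide)]; simp [hk2]
  refine runs_for (fun k s' T => T ≤ 60 * k ∧
    (∀ x < 2 * m + 2, s'.a .count x = cntLt (s.a .key) m x + cntEq (s.a .key) k x) ∧
    (∀ i < k, s'.a .pos i = lexRank (s.a .key) m i)) ?_ ?_ ?_ ?_
  · simp
  · refine ⟨by simp, fun x hx => ?_, by simp⟩
    rw [cntEq_zero, add_zero, hI3 x (by omega)]
  · rintro k s4 T hk4 hF ⟨hT, hI, hI'⟩
    have hk' : s4.a .key = s.a .key := by rw [hF.a _ (by decide), hk3]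
    simp [hm3] at hk4
    have hkk := hk _ hk4
    simp [hk', hI _ hkk, Function.update_apply]
    have := cntLt_le (s.a .key) m (s.a .key k)
    have := cntEq_le (s.a .key) k (s.a .key k)
    refine ⟨by omega, by omega, by omega, by omega, fun x hx => ?_, fun i hi => ?_⟩
    · rw [cntEq_succ]
      split
      · subst x; simp; ring
      · rw [if_neg (by tauto), add_zero, hI x hx]
    · split
      · subst i; rfl
      · exact hI' i (by omega)
  rintro s4 T4 hF4 ⟨hT4, -, hI4⟩
  simp [hm3] at hT4 hI4
  exact ⟨by simp; omega, hI4⟩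

/-! ### Parameters of the algorithm -/

/-- The parameters: `m` is the length of the strings to be processed, a digit has `b` bits, and
`2 ^ gm` digits are packed into a word. -/
structure Par where
  m : ℕ
  b : ℕ
  gm : ℕ

namespace Par
variable (P : Par)

/-- The number of digits in a word. -/
def g : ℕ := 2 ^ P.gm
/-- The number of digit values. -/
def B : ℕ := 2 ^ P.b
/-- The number of values of a packed word. -/
def tw : ℕ := 2 ^ (P.b * P.g)
/-- The number of words that hold `m` digits and at least one more. -/
def nw : ℕ := P.m / P.g + 1
/-- The distance between the packed strings of successive levels of a wavelet matrix. -/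
def st : ℕ := P.nw + 1
/-- The number of words that hold `nw` digits and at least one more. -/
def n1 : ℕ := P.nw / P.g + 1

/-- The parameters fit together, arrays of length `L` are long enough and words below `M` are large
enough. The inequality `b_le` makes wavelet matrices linear in size, as they have `b` levels of
about `m / g` words. By `m_lt` the logarithm of `m` is at most proportional to `g ^ 2`, which makes
the sparse table for about `m / g ^ 2` values linear in size. The tables for packed words are linear
in size by `tw_le`. -/
structure Good (L M : ℕ) : Prop where
  two_le_m : 2 ≤ P.m
  one_le_b : 1 ≤ P.b
  b_le : P.b ≤ 8 * P.g
  gg_le : P.g * P.g ≤ P.m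
  m_lt : P.m < 2 ^ (64 * (P.g * P.g))
  tw_le : P.b * P.tw * P.tw ≤ 2 ^ 24 * P.m
  le_L : 2 ^ 26 * P.m ≤ L
  le_M : 64 * L ≤ M

lemma g_pos : 0 < P.g := Nat.two_pow_pos _
lemma B_pos : 0 < P.B := Nat.two_pow_pos _
lemma tw_pos : 0 < P.tw := Nat.two_pow_pos _

lemma tw_eq : P.tw = P.B ^ P.g := by simp [tw, B, pow_mul]

lemma m_lt_nw : P.m < P.nw * P.g := by
  have := Nat.div_add_mod P.m P.g
  have := Nat.mod_lt P.m P.g_pos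
  unfold nw; rw [add_mul, mul_comm]; omega

lemma nw_mul_le : P.nw * P.g ≤ P.m + P.g := by
  unfold nw; rw [add_mul, one_mul]; have := Nat.div_mul_le_self P.m P.g; omega

lemma nw_lt_n1 : P.nw < P.n1 * P.g := by
  have := Nat.div_add_mod P.nw P.g
  have := Nat.mod_lt P.nw P.g_pos
  unfold n1; rw [add_mul, mul_comm]; omega

lemma n1_mul_le : P.n1 * P.g ≤ P.nw + P.g := by
  unfold n1; rw [add_mul, one_mul]; have := Nat.div_mul_le_self P.nw P.g; omega

lemma n1_pos : 0 < P.n1 := Nat.succ_pos _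

lemma nw_le : P.nw ≤ P.m + 1 := by
  unfold nw; have := Nat.div_le_self P.m P.g; omega

lemma n1_le : P.n1 ≤ P.nw + 1 := by
  unfold n1; have := Nat.div_le_self P.nw P.g; omega

variable {P} {L M : ℕ}

lemma Good.B_le (_h : P.Good L M) : P.B ≤ P.tw :=
  Nat.pow_le_pow_right (by norm_num) (Nat.le_mul_of_pos_right _ P.g_pos)

lemma Good.two_le_B (h : P.Good L M) : 2 ≤ P.B :=
  (Nat.pow_le_pow_right (by norm_num) h.one_le_b : 2 ^ 1 ≤ 2 ^ P.b)

lemma Good.tw_tw (h : P.Good L M) : P.tw * P.tw ≤ L := by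
  have h1 := h.tw_le
  have h2 := h.le_L
  have : 1 * (P.tw * P.tw) ≤ P.b * (P.tw * P.tw) := Nat.mul_le_mul_right _ h.one_le_b
  rw [← mul_assoc P.b] at this
  omega

lemma Good.tw_le_L (h : P.Good L M) : P.tw ≤ L :=
  (Nat.le_mul_of_pos_left _ P.tw_pos).trans h.tw_tw

lemma Good.b_tw (h : P.Good L M) : P.b * P.tw ≤ 2 ^ 24 * P.m :=
  (Nat.le_mul_of_pos_right _ P.tw_pos).trans h.tw_le

lemma Good.g_le (h : P.Good L M) : P.g ≤ P.m :=
  (Nat.le_mul_of_pos_left _ P.g_pos).trans h.gg_le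

lemma Good.nwg (h : P.Good L M) : P.nw * P.g ≤ 2 * P.m := by
  have := P.nw_mul_le; have := h.g_le; omega

/-- The size of a wavelet matrix. -/
lemma Good.b_st (h : P.Good L M) : (P.b + 1) * P.st ≤ 40 * P.m := by
  have h1 : (P.b + 1) * P.st ≤ (9 * P.g) * P.st :=
    Nat.mul_le_mul_right _ (by have := h.b_le; have := P.g_pos; omega)
  have h2 : 9 * P.g * P.st = 9 * (P.nw * P.g) + 9 * P.g := by unfold st; ring
  have := h.nwg
  have := h.g_le
  omega

/-- The size of a sparse table. -/
lemma Good.log_n1 (h : P.Good L M) : (Nat.log 2 P.n1 + 1) * P.n1 ≤ 300 * P.m := by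
  have h1 : Nat.log 2 P.n1 ≤ 64 * (P.g * P.g) := by
    rw [← Nat.lt_succ_iff]
    apply Nat.log_lt_of_lt_pow P.n1_pos.ne'
    have := P.n1_le
    have := P.nw_le
    have := h.m_lt
    have := h.two_le_m
    rw [pow_succ]
    omega
  have h2 : P.n1 ≤ P.m / (P.g * P.g) + 2 := by
    have : P.nw ≤ P.m / P.g + P.g := by unfold nw; have := P.g_pos; omega
    have h3 := Nat.div_le_div_right (c := P.g) this
    rw [Nat.add_div_right _ P.g_pos, Nat.div_div_eq_div_mul] at h3
    unfold n1; omega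
  have h3 := Nat.mul_div_le P.m (P.g * P.g)
  have h4 : 1 ≤ P.g * P.g := Nat.mul_pos P.g_pos P.g_pos
  calc (Nat.log 2 P.n1 + 1) * P.n1 ≤ (65 * (P.g * P.g)) * (P.m / (P.g * P.g) + 2) :=
        Nat.mul_le_mul (by omega) h2
    _ = 65 * (P.g * P.g * (P.m / (P.g * P.g))) + 130 * (P.g * P.g) := by ring
    _ ≤ 300 * P.m := by have := h.gg_le; omega

end Par

/-- The variables that hold the parameters. -/
def parVars : List Var := [.m, .b, .gm, .g, .tw, .nw, .st, .n1]

/-- The variables `parVars` hold the parameters. -/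
structure Ctx (P : Par) (s : St) : Prop where
  m : s.v .m = P.m
  b : s.v .b = P.b
  gm : s.v .gm = P.gm
  g : s.v .g = P.g
  tw : s.v .tw = P.tw
  nw : s.v .nw = P.nw
  st : s.v .st = P.st
  n1 : s.v .n1 = P.n1

lemma Ctx.frame {P : Par} {s s' : St} {vs : List Var} {as : List Arr} (h : Ctx P s)
    (hF : Frame vs as s s') (hd : ∀ x ∈ parVars, x ∉ vs) : Ctx P s' := by
  have e : ∀ x ∈ parVars, s'.v x = s.v x := fun x hx => hF.v x (hd x hx)
  constructor <;> rw [e _ (by decide)]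
  exacts [h.m, h.b, h.gm, h.g, h.tw, h.nw, h.st, h.n1]

lemma Ctx.setv {P : Par} {s : St} (h : Ctx P s) {x : Var} (k : ℕ) (hx : x ∉ parVars) :
    Ctx P (s.setv x k) :=
  h.frame (vs := [x]) (as := []) ⟨fun y hy => by simp_all, fun _ _ => rfl⟩ fun y hy hy' => by
    rw [List.mem_singleton] at hy'; exact hx (hy' ▸ hy)

lemma Ctx.seta {P : Par} {s : St} (h : Ctx P s) (a : Arr) (i k : ℕ) : Ctx P (s.seta a i k) :=
  ⟨h.m, h.b, h.gm, h.g, h.tw, h.nw, h.st, h.n1⟩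

/-! ### Tables for packed words -/

/-- The recursion for the maximal digit of a packed word. -/
def MaxTab (B N : ℕ) (f : ℕ → ℕ) : Prop :=
  f 0 = 0 ∧ ∀ x < N, f x = max (x % B) (f (x / B))

/-- The recursion for the number of digits that have bit `j`. -/
def OneTab (B N j : ℕ) (f : ℕ → ℕ) : Prop :=
  f 0 = 0 ∧ ∀ x < N, f x = f (x / B) + x / 2 ^ j % 2

/-- The recursion for the packed word of the digits whose bit `j` is `v`. -/
def FilterTab (B N j v : ℕ) (f : ℕ → ℕ) : Prop :=
  f 0 = 0 ∧ ∀ x < N, f x = if x / 2 ^ j % 2 = v then x % B + f (x / B) * B else f (x / B)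

/-- The recursion is solved by the maximum of the digits. -/
lemma maxTab_ofDigits {B g : ℕ} {f : ℕ → ℕ} (h : MaxTab B (B ^ g) f) (hB : 2 ≤ B) {l : List ℕ}
    (hl : l.length ≤ g) (hd : ∀ a ∈ l, a < B) : f (Nat.ofDigits B l) = l.foldr max 0 := by
  induction l with
  | nil => simpa using h.1
  | cons a l ih =>
    have h1 : Nat.ofDigits B (a :: l) < B ^ g :=
      (Nat.ofDigits_lt_base_pow_length hB hd).trans_le (Nat.pow_le_pow_right (by omega) hl)
    have ha := hd a (by simp)
    rw [h.2 _ h1, Nat.ofDigits_cons, Nat.add_mul_mod_self_left, Nat.mod_eq_of_lt ha,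
      Nat.add_mul_div_left _ _ (by omega), Nat.div_eq_of_lt ha, zero_add,
      ih (by simp at hl; omega) fun c hc => hd c (by simp [hc])]
    rfl

lemma bit_add_mul {b j a x : ℕ} (hj : j < b) : (a + 2 ^ b * x) / 2 ^ j % 2 = a / 2 ^ j % 2 := by
  have : 2 ^ b * x = 2 ^ j * (2 * (2 ^ (b - j - 1) * x)) := by
    rw [← mul_assoc 2, ← pow_succ', ← mul_assoc, ← pow_add]; congr 2; omega
  rw [this, Nat.add_mul_div_left _ _ (by positivity), Nat.add_mul_mod_self_left]

/-- The recursion is solved by the number of digits with bit `j`. -/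
lemma oneTab_ofDigits {b g j : ℕ} {f : ℕ → ℕ} (h : OneTab (2 ^ b) ((2 ^ b) ^ g) j f) (hj : j < b)
    {l : List ℕ} (hl : l.length ≤ g) (hd : ∀ a ∈ l, a < 2 ^ b) :
    f (Nat.ofDigits (2 ^ b) l) = l.countP fun a => a / 2 ^ j % 2 = 1 := by
  have hB : 2 ≤ 2 ^ b := by
    calc 2 = 2 ^ 1 := rfl
      _ ≤ 2 ^ b := Nat.pow_le_pow_right (by norm_num) (by omega)
  induction l with
  | nil => simpa using h.1
  | cons a l ih =>
    have h1 : Nat.ofDigits (2 ^ b) (a :: l) < (2 ^ b) ^ g :=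
      (Nat.ofDigits_lt_base_pow_length hB hd).trans_le (Nat.pow_le_pow_right (by omega) hl)
    have ha := hd a (by simp)
    rw [h.2 _ h1, Nat.ofDigits_cons, bit_add_mul hj,
      Nat.add_mul_div_left _ _ (by omega), Nat.div_eq_of_lt ha, zero_add,
      ih (by simp at hl; omega) fun c hc => hd c (by simp [hc]), List.countP_cons]
    rcases Nat.mod_two_eq_zero_or_one (a / 2 ^ j) with h | h <;> simp [h]

/-- The recursion is solved by filtering the list of digits. -/
lemma filterTab_ofDigits {b g j v : ℕ} {f : ℕ → ℕ} (h : FilterTab (2 ^ b) ((2 ^ b) ^ g) j v f)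
    (hj : j < b) {l : List ℕ} (hl : l.length ≤ g) (hd : ∀ a ∈ l, a < 2 ^ b) :
    f (Nat.ofDigits (2 ^ b) l) =
      Nat.ofDigits (2 ^ b) (l.filter fun a => a / 2 ^ j % 2 = v) := by
  have hB : 2 ≤ 2 ^ b := by
    calc 2 = 2 ^ 1 := rfl
      _ ≤ 2 ^ b := Nat.pow_le_pow_right (by norm_num) (by omega)
  induction l with
  | nil => simpa using h.1
  | cons a l ih =>
    have h1 : Nat.ofDigits (2 ^ b) (a :: l) < (2 ^ b) ^ g :=
      (Nat.ofDigits_lt_base_pow_length hB hd).trans_le (Nat.pow_le_pow_right (by omega) hl)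
    have ha := hd a (by simp)
    rw [h.2 _ h1, Nat.ofDigits_cons, bit_add_mul hj,
      Nat.add_mul_div_left _ _ (by omega), Nat.div_eq_of_lt ha, zero_add,
      Nat.add_mul_mod_self_left, Nat.mod_eq_of_lt ha,
      ih (by simp at hl; omega) fun c hc => hd c (by simp [hc]), List.filter_cons]
    split <;> simp_all [Nat.ofDigits_cons, mul_comm]

lemma div_lt_or {B k : ℕ} (hB : 2 ≤ B) : k / B < k ∨ k = 0 := by
  rcases Nat.eq_zero_or_pos k with h | h
  · exact Or.inr h
  · exact Or.inl (Nat.div_lt_self h hB)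

lemma MaxTab.step {B k : ℕ} {f : ℕ → ℕ} (hB : 2 ≤ B) (h : MaxTab B k f) :
    MaxTab B (k + 1) (Function.update f k (max (k % B) (f (k / B)))) := by
  obtain ⟨h0, h1⟩ := h
  have e0 : Function.update f k (max (k % B) (f (k / B))) 0 = 0 := by
    rcases Nat.eq_zero_or_pos k with rfl | hk
    · simp [h0]
    · simp [hk.ne, h0]
  refine ⟨e0, fun x hx => ?_⟩
  rcases Nat.lt_succ_iff_lt_or_eq.1 hx with h | rfl
  · have : x / B ≤ x := Nat.div_le_self _ _
    simp [show x ≠ k by omega, show x / B ≠ k by omega, h1 x h]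
  · rcases div_lt_or (k := x) hB with h | rfl
    · simp [h.ne]
    · simp

lemma OneTab.step {B k j : ℕ} {f : ℕ → ℕ} (hB : 2 ≤ B) (h : OneTab B k j f) :
    OneTab B (k + 1) j (Function.update f k (f (k / B) + k / 2 ^ j % 2)) := by
  obtain ⟨h0, h1⟩ := h
  have e0 : Function.update f k (f (k / B) + k / 2 ^ j % 2) 0 = 0 := by
    rcases Nat.eq_zero_or_pos k with rfl | hk
    · simp [h0]
    · simp [hk.ne, h0]
  refine ⟨e0, fun x hx => ?_⟩
  rcases Nat.lt_succ_iff_lt_or_eq.1 hx with h | rfl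
  · have : x / B ≤ x := Nat.div_le_self _ _
    simp [show x ≠ k by omega, show x / B ≠ k by omega, h1 x h]
  · rcases div_lt_or (k := x) hB with h | rfl
    · simp [h.ne]
    · simp [h0]

lemma FilterTab.step {B k j v : ℕ} {f : ℕ → ℕ} (hB : 2 ≤ B) (h : FilterTab B k j v f) :
    FilterTab B (k + 1) j v (Function.update f k
      (if k / 2 ^ j % 2 = v then k % B + f (k / B) * B else f (k / B))) := by
  obtain ⟨h0, h1⟩ := h
  have e0 : Function.update f k
      (if k / 2 ^ j % 2 = v then k % B + f (k / B) * B else f (k / B)) 0 = 0 := by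
    rcases Nat.eq_zero_or_pos k with rfl | hk
    · simp [h0]
    · simp [hk.ne, h0]
  refine ⟨e0, fun x hx => ?_⟩
  rcases Nat.lt_succ_iff_lt_or_eq.1 hx with h | rfl
  · have : x / B ≤ x := Nat.div_le_self _ _
    simp [show x ≠ k by omega, show x / B ≠ k by omega, h1 x h]
  · rcases div_lt_or (k := x) hB with h | rfl
    · simp [h.ne]
    · simp [h0]

lemma FilterTab.le {B N j v : ℕ} {f : ℕ → ℕ} (hB : 2 ≤ B) (h : FilterTab B N j v f) {x : ℕ}
    (hx : x < N ∨ x = 0) : f x ≤ x := by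
  induction x using Nat.strong_induction_on with
  | _ x ih =>
    rcases hx with hx | rfl
    · have h2 := h.2 x hx
      rcases div_lt_or (k := x) hB with hlt | rfl
      · have := ih _ hlt (Or.inl (by omega))
        have h3 : f (x / B) * B ≤ x / B * B := Nat.mul_le_mul_right _ this
        have h4 := Nat.mod_add_div x B
        rw [mul_comm B] at h4
        rw [h2]; split <;> omega
      · exact h.1.le
    · exact h.1.le

lemma OneTab.le {B N j : ℕ} {f : ℕ → ℕ} (hB : 2 ≤ B) (h : OneTab B N j f) {x : ℕ}
    (hx : x < N ∨ x = 0) : f x ≤ x := by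
  induction x using Nat.strong_induction_on with
  | _ x ih =>
    rcases hx with hx | rfl
    · have h2 := h.2 x hx
      rcases div_lt_or (k := x) hB with hlt | rfl
      · have := ih _ hlt (Or.inl (by omega))
        have := Nat.mod_lt (x / 2 ^ j) two_pos
        omega
      · exact h.1.le
    · exact h.1.le

lemma OneTab.congr {B N j : ℕ} {f f' : ℕ → ℕ} (h : OneTab B N j f) (h0 : 0 < N)
    (hf : ∀ x < N, f' x = f x) : OneTab B N j f' :=
  ⟨by rw [hf 0 h0, h.1], fun x hx => by
    rw [hf x hx, h.2 x hx, hf _ ((Nat.div_le_self _ _).trans_lt hx)]⟩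

lemma FilterTab.congr {B N j v : ℕ} {f f' : ℕ → ℕ} (h : FilterTab B N j v f) (h0 : 0 < N)
    (hf : ∀ x < N, f' x = f x) : FilterTab B N j v f' :=
  ⟨by rw [hf 0 h0, h.1], fun x hx => by
    rw [hf x hx, h.2 x hx, hf _ ((Nat.div_le_self _ _).trans_lt hx)]⟩

lemma update_add {f : ℕ → ℕ} {o k v : ℕ} :
    (fun x => Function.update f (o + k) v (o + x)) = Function.update (fun x => f (o + x)) k v := by
  ext x; simp [Function.update_apply]

lemma update_below {f f' : ℕ → ℕ} {o k v : ℕ} (h : ∀ i < o, f i = f' i) :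
    ∀ i < o, Function.update f (o + k) v i = f' i := by
  intro i hi; rw [Function.update_of_ne (by omega), h i hi]

/-- Building the tables. The entry for a packed word is computed from the entry for the word without
its lowest digit, which has been computed before. -/
def buildTabs : Cmd :=
  .put .mx 0 0 ;;
  .for_ .x Var.tw (
    .t ::= Ex.low Var.x Var.b ;;
    .u ::= .get .mx (Var.x >>: Var.b) ;;
    .iflt Var.t Var.u (.put .mx Var.x Var.u) (.put .mx Var.x Var.t)) ;;
  .for_ .j Var.b (
    .off ::= Var.j * Var.tw ;;
    .put .on Var.off 0 ;; .put .zt Var.off 0 ;; .put .ot Var.off 0 ;;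
    .for_ .x Var.tw (
      .y ::= Var.off + (Var.x >>: Var.b) ;;
      .t ::= Ex.low (Var.x >>: Var.j) 1 ;;
      .put .on (Var.off + Var.x) (.get .on Var.y + Var.t) ;;
      .iflt Var.t 1
        (.put .zt (Var.off + Var.x) (Ex.low Var.x Var.b + (.get .zt Var.y <<: Var.b)) ;;
          .put .ot (Var.off + Var.x) (.get .ot Var.y))
        (.put .ot (Var.off + Var.x) (Ex.low Var.x Var.b + (.get .ot Var.y <<: Var.b)) ;;
          .put .zt (Var.off + Var.x) (.get .zt Var.y))))

/-- The tables for packed words are built: the maximal digit (`mx`), and for every bit number `j`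
the number of digits with bit `j` (`on`) and the packed digits without (`zt`) and with bit `j`
(`ot`). -/
structure Tabs (P : Par) (s : St) : Prop where
  mx : MaxTab P.B P.tw (s.a .mx)
  on : ∀ j < P.b, OneTab P.B P.tw j fun x => s.a .on (j * P.tw + x)
  zt : ∀ j < P.b, FilterTab P.B P.tw j 0 fun x => s.a .zt (j * P.tw + x)
  ot : ∀ j < P.b, FilterTab P.B P.tw j 1 fun x => s.a .ot (j * P.tw + x)

lemma Tabs.congr {P : Par} {s s' : St} (h : Tabs P s) (h1 : s'.a .mx = s.a .mx)
    (h2 : s'.a .on = s.a .on) (h3 : s'.a .zt = s.a .zt) (h4 : s'.a .ot = s.a .ot) : Tabs P s' :=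
  ⟨h1 ▸ h.mx, h2 ▸ h.on, h3 ▸ h.zt, h4 ▸ h.ot⟩

lemma Tabs.frame {P : Par} {s s' : St} {vs : List Var} {as : List Arr} (h : Tabs P s)
    (hF : Frame vs as s s') (hd : ∀ a ∈ [Arr.mx, Arr.on, Arr.zt, Arr.ot], a ∉ as) : Tabs P s' :=
  h.congr (hF.a _ (hd _ (by decide))) (hF.a _ (hd _ (by decide))) (hF.a _ (hd _ (by decide)))
    (hF.a _ (hd _ (by decide)))

lemma runs_buildTabs {M L : ℕ} {P : Par} (h : P.Good L M) {s : St} (hs : Ctx P s) :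
    Runs M L buildTabs s fun s' t => t ≤ 300 * (2 ^ 24 * P.m) ∧ Tabs P s' := by
  have hB := h.two_le_B
  have hBt := h.B_le
  have htL := h.tw_le_L
  have hM := h.le_M
  have hL0 : 0 < P.tw := P.tw_pos
  have hm2 := h.two_le_m
  have hbt := h.b_tw
  have hlL := h.le_L
  have eB : 2 ^ P.b = P.B := rfl
  have hb1 := h.one_le_b
  have hbtw : P.tw ≤ P.b * P.tw := Nat.le_mul_of_pos_left _ (by omega)
  have hbb : P.b ≤ P.b * P.tw := Nat.le_mul_of_pos_right _ hL0
  have htt := h.tw_tw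
  unfold buildTabs
  simp only [runs_seq, runs_put]
  refine ⟨by simp; omega, ?_⟩
  refine runs_for (fun k s' T => T ≤ 60 * k ∧ MaxTab P.B k (s'.a .mx)) ?_ ?_ ?_ ?_
  · simp
  · simp [MaxTab]
  · rintro k s1 T hk hF ⟨hT, hI⟩
    simp [hs.tw] at hk
    have c1 := (hs.seta _ _ _).frame hF (by decide)
    have hkB : k / P.B ≤ k := Nat.div_le_self _ _
    simp [runs_iflt, c1.b, eB]
    have hst := hI.step hB
    refine ⟨by omega, by omega, fun hlt => ⟨by omega, by omega, ?_⟩,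
      fun hlt => ⟨by omega, by omega, ?_⟩⟩
    · rw [max_eq_right hlt.le] at hst; exact hst
    · rw [max_eq_left hlt] at hst; exact hst
  rintro s1 T1 hF1 ⟨hT1, hI1⟩
  have c1 := (hs.seta _ _ _).frame hF1 (by decide)
  simp [hs.tw] at hT1 hI1
  refine runs_for (fun j s' T => T ≤ (30 + 200 * P.tw) * j ∧
    (∀ i < j, OneTab P.B P.tw i fun x => s'.a .on (i * P.tw + x)) ∧
    (∀ i < j, FilterTab P.B P.tw i 0 fun x => s'.a .zt (i * P.tw + x)) ∧
    (∀ i < j, FilterTab P.B P.tw i 1 fun x => s'.a .ot (i * P.tw + x))) ?_ ?_ ?_ ?_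
  · simp
  · simp
  · rintro j s2 T hj hF2 ⟨hT, hI, hI', hI''⟩
    simp [c1.b] at hj
    have c2 := (c1.frame hF2 (by decide)).setv j (x := .j) (by decide)
    have hjt : (j + 1) * P.tw ≤ P.b * P.tw := Nat.mul_le_mul_right _ hj
    rw [add_mul] at hjt
    simp only [runs_seq, runs_set, runs_put]
    have c2t := c2.tw
    simp at c2t
    simp [c2t, and_assoc]
    repeat refine ⟨by omega, ?_⟩
    set s3 := ((((s2.setv .j j).setv .off (j * P.tw)).seta .on (j * P.tw) 0).seta .zt (j * P.tw)
      0).seta .ot (j * P.tw) 0 with hs3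
    have c3 : Ctx P s3 := (((c2.setv _ (by decide)).seta _ _ _).seta _ _ _).seta _ _ _
    refine runs_for (fun k s' T => T ≤ 150 * k ∧ (∀ i < j * P.tw, s'.a .on i = s2.a .on i) ∧
      (∀ i < j * P.tw, s'.a .zt i = s2.a .zt i) ∧ (∀ i < j * P.tw, s'.a .ot i = s2.a .ot i) ∧
      (OneTab P.B k j fun x => s'.a .on (j * P.tw + x)) ∧
      (FilterTab P.B k j 0 fun x => s'.a .zt (j * P.tw + x)) ∧
      (FilterTab P.B k j 1 fun x => s'.a .ot (j * P.tw + x))) ?_ ?_ ?_ ?_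
    · simp
    · simp [hs3, OneTab, FilterTab]
      refine ⟨fun i hi => ?_, fun i hi => ?_, fun i hi => ?_⟩ <;>
      rw [Function.update_of_ne (by omega)]
    · rintro k s4 T4 hk hF4 ⟨hT4, o4, z4, t4, on4, zt4, ot4⟩
      have c4 := (c3.frame hF4 (by decide)).setv k (x := .x) (by decide)
      simp [c3.tw] at hk
      have c4b := c4.b
      simp at c4b
      have hoff : s4.v .off = j * P.tw := by rw [hF4.v _ (by decide)]; simp [hs3]
      have hjv : s4.v .j = j := by rw [hF4.v _ (by decide)]; simp [hs3]
      have hkB : k / P.B ≤ k := Nat.div_le_self _ _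
      have hor : k / P.B < k ∨ k / P.B = 0 := by
        rcases div_lt_or (k := k) hB with h | rfl
        · exact Or.inl h
        · simp
      have e1 := on4.le hB hor
      have e2 := zt4.le hB hor
      have e3 := ot4.le hB hor
      have f2 : s4.a .zt (j * P.tw + k / P.B) * P.B ≤ k := by
        have := Nat.div_mul_le_self k P.B
        have := Nat.mul_le_mul_right P.B e2
        omega
      have f3 : s4.a .ot (j * P.tw + k / P.B) * P.B ≤ k := by
        have := Nat.div_mul_le_self k P.B
        have := Nat.mul_le_mul_right P.B e3
        omega
      have hmod : k % P.B ≤ k := Nat.mod_le _ _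
      have hbit := Nat.mod_lt (k / 2 ^ j) two_pos
      have on5 := on4.step hB
      have zt5 := zt4.step hB
      have ot5 := ot4.step hB
      simp [runs_iflt, c4b, hoff, hjv, eB, and_assoc]
      repeat refine ⟨by omega, ?_⟩
      refine ⟨fun h0 => ?_, fun h1 => ?_⟩
      · simp [h0] at on5 zt5 ot5 ⊢
        repeat refine ⟨by omega, ?_⟩
        exact ⟨update_below o4, update_below z4, update_below t4, update_add ▸ on5,
          update_add ▸ zt5, update_add ▸ ot5⟩
      · simp [show k / 2 ^ j % 2 = 1 by omega] at on5 zt5 ot5 ⊢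
        repeat refine ⟨by omega, ?_⟩
        exact ⟨update_below o4, update_below z4, update_below t4, update_add ▸ on5,
          update_add ▸ zt5, update_add ▸ ot5⟩
    · rintro s4 T4 hF4 ⟨hT4, o4, z4, t4, on4, zt4, ot4⟩
      simp [c3.tw] at hT4 on4 zt4 ot4 ⊢
      refine ⟨by rw [mul_add]; omega, fun i hi => ?_, fun i hi => ?_, fun i hi => ?_⟩
      all_goals
        rcases hi.lt_or_eq with hij | rfl
        · have hi2 : (i + 1) * P.tw ≤ j * P.tw := Nat.mul_le_mul_right _ hij
          rw [add_mul, one_mul] at hi2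
          first
          | exact (hI i hij).congr hL0 fun x hx => o4 _ (by omega)
          | exact (hI' i hij).congr hL0 fun x hx => z4 _ (by omega)
          | exact (hI'' i hij).congr hL0 fun x hx => t4 _ (by omega)
        · assumption
  · rintro s2 T2 hF2 ⟨hT2, hI2, hI2', hI2''⟩
    simp [c1.b] at hT2 hI2 hI2' hI2''
    refine ⟨?_, ?_, hI2, hI2', hI2''⟩
    · simp
      rw [add_mul, mul_assoc, mul_comm P.tw] at hT2
      omega
    · rw [hF2.a _ (by decide)]; exact hI1

/-! ### Packing digits into words -/

/-- The number whose digits in base `B` are `f s, …, f (s + n - 1)`, the lowest digit first. -/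
def word (B : ℕ) (f : ℕ → ℕ) (s n : ℕ) : ℕ := Nat.ofDigits B ((List.range' s n).map f)

section word
variable {B : ℕ} {f : ℕ → ℕ}

lemma word_zero (s : ℕ) : word B f s 0 = 0 := by simp [word]

lemma word_succ (s n : ℕ) : word B f s (n + 1) = f s + B * word B f (s + 1) n := by
  simp [word, List.range'_succ, Nat.ofDigits_cons]

lemma word_lt (hB : 2 ≤ B) {s n : ℕ} (hf : ∀ i < n, f (s + i) < B) : word B f s n < B ^ n := by
  have := Nat.ofDigits_lt_base_pow_length (b := B) (l := (List.range' s n).map f) (by omega) (by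
    intro x hx
    obtain ⟨i, hi, rfl⟩ := List.mem_map.1 hx
    rw [List.mem_range'_1] at hi
    have := hf (i - s) (by omega)
    rwa [show s + (i - s) = i by omega] at this)
  simpa [word] using this

lemma word_div (hf : ∀ i, f i < B) (s n a : ℕ) :
    word B f s n / B ^ a = word B f (s + a) (n - a) := by
  unfold word
  rw [Nat.ofDigits_div_pow_eq_ofDigits_drop _ ((Nat.zero_le _).trans_lt (hf 0)) _
    (by intro x hx; obtain ⟨i, _, rfl⟩ := List.mem_map.1 hx; exact hf i),
    ← List.map_drop, List.drop_range', mul_one]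

lemma word_mod (hf : ∀ i, f i < B) (s n a : ℕ) : word B f s n % B ^ a = word B f s (min a n) := by
  unfold word
  rw [Nat.ofDigits_mod_pow_eq_ofDigits_take _ ((Nat.zero_le _).trans_lt (hf 0)) _
    (by intro x hx; obtain ⟨i, _, rfl⟩ := List.mem_map.1 hx; exact hf i),
    ← List.map_take]
  congr 2
  rcases le_total a n with h | h
  · rw [List.take_range'_of_length_ge h, min_eq_left h]
  · rw [List.take_range'_of_length_le h, min_eq_right h]

lemma foldr_max_map (s n : ℕ) : ((List.range' s n).map f).foldr max 0 = (Ico s (s + n)).sup f := by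
  induction n generalizing s with
  | zero => simp
  | succ n ih =>
    rw [List.range'_succ, List.map_cons, List.foldr_cons, ih,
      show Ico s (s + (n + 1)) = insert s (Ico (s + 1) (s + 1 + n)) by
        ext i; simp only [mem_Ico, mem_insert]; omega,
      sup_insert]

end word

lemma Tabs.mx_word {P : Par} {s : St} {L M : ℕ} (h : Tabs P s) (hP : P.Good L M) {f : ℕ → ℕ}
    (hf : ∀ i, f i < P.B) {i n : ℕ} (hn : n ≤ P.g) :
    s.a .mx (word P.B f i n) = (Ico i (i + n)).sup f := by
  have h1 := h.mx
  rw [P.tw_eq] at h1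
  unfold word
  rw [maxTab_ofDigits h1 hP.two_le_B (by simpa using hn), foldr_max_map]
  intro x hx; obtain ⟨i, _, rfl⟩ := List.mem_map.1 hx; exact hf i

/-- Packing the digits in `src` into the first `cnt` words of `dst`. -/
def pack (src dst : Arr) (cnt : Var) : Cmd :=
  .for_ .k cnt (
    .acc ::= 0 ;;
    .for_ .i Var.g (
      .acc ::= (Var.acc <<: Var.b) + .get src (Var.k * Var.g + (Var.g - (Var.i + 1)))) ;;
    .put dst Var.k Var.acc)

lemma runs_pack {M L : ℕ} {P : Par} (h : P.Good L M) {s : St} (hs : Ctx P s) {src dst : Arr}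
    {cnt : Var} {c : ℕ} (hc : s.v cnt = c) (hcL : c * P.g ≤ L) (hne : src ≠ dst) (f : ℕ → ℕ)
    (hsf : ∀ i < c * P.g, s.a src i = f i) (hf : ∀ i, f i < P.B) :
    Runs M L (pack src dst cnt) s fun s' t => t ≤ 100 * (c * P.g) + 10 ∧
      ∀ k < c, s'.a dst k = word P.B f (k * P.g) P.g := by
  have hB := h.two_le_B
  have hBt := h.B_le
  have htL := h.tw_le_L
  have hM := h.le_M
  have hm2 := h.two_le_m
  have hgm := h.g_le
  have hlL := h.le_L
  have hg0 := P.g_pos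
  have eB : 2 ^ P.b = P.B := rfl
  have hcc : c ≤ c * P.g := Nat.le_mul_of_pos_right _ hg0
  unfold pack
  refine runs_for (fun k s' T => T ≤ (20 + 60 * P.g) * k ∧
    ∀ j < k, s'.a dst j = word P.B f (j * P.g) P.g) ?_ ?_ ?_ ?_
  · simp
  · simp
  · rintro k s1 T hk hF ⟨hT, hI⟩
    have c1 := (hs.frame hF (by simp [parVars, Cmd.vars])).setv k (x := .k) (by simp [parVars])
    have hsrc : s1.a src = s.a src := hF.a _ (by simpa [Cmd.arrs] using hne)
    rw [Ex.eval_var, hc] at hk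
    have hkg : (k + 1) * P.g ≤ c * P.g := Nat.mul_le_mul_right _ hk
    rw [add_mul, one_mul] at hkg
    simp only [runs_seq, runs_set, Ex.eval_ofNat]
    refine ⟨by simp; omega, ?_⟩
    have c2 := c1.setv 0 (x := .acc) (by simp [parVars])
    refine runs_for (fun i s' T => T ≤ 30 * i ∧
      s'.v .acc = word P.B f (k * P.g + (P.g - i)) i) ?_ ?_ ?_ ?_
    · simp
    · simp [word_zero]
    · rintro i s2 T2 hi hF2 ⟨hT2, hI2⟩
      have c3 := (c2.frame hF2 (by simp [parVars, Cmd.vars])).setv i (x := .i) (by simp [parVars])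
      have hsrc2 : s2.a src = s.a src := by rw [hF2.a _ (by simp [Cmd.arrs])]; exact hsrc
      rw [Ex.eval_var, c2.g] at hi
      have hk2 : s2.v .k = k := by rw [hF2.v _ (by simp [Cmd.vars])]; simp
      have eb := c3.b
      have eg := c3.g
      simp at eb eg
      have hw := word_lt hB (s := k * P.g + (P.g - i)) (n := i) (fun j _ => hf _)
      have hw2 := word_lt hB (s := k * P.g + (P.g - (i + 1))) (n := i + 1) (fun j _ => hf _)
      have hw3 : P.B ^ (i + 1) ≤ P.tw := by
        rw [P.tw_eq]; exact Nat.pow_le_pow_right P.B_pos hi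
      rw [word_succ, show k * P.g + (P.g - (i + 1)) + 1 = k * P.g + (P.g - i) by omega] at hw2
      have hs2 := hsf (k * P.g + (P.g - (i + 1))) (by omega)
      have hcomm := mul_comm P.B (word P.B f (k * P.g + (P.g - i)) i)
      simp [eb, eg, hI2, hk2, hsrc2, hs2, eB, and_assoc]
      repeat refine ⟨by omega, ?_⟩
      rw [word_succ, show k * P.g + (P.g - (i + 1)) + 1 = k * P.g + (P.g - i) by omega]
      omega
    · rintro s2 T2 hF2 ⟨hT2, hI2⟩
      have hk2 : s2.v .k = k := by rw [hF2.v _ (by simp [Cmd.vars])]; simp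
      have hdst : s2.a dst = s1.a dst := by rw [hF2.a _ (by simp [Cmd.arrs])]; simp
      rw [Ex.eval_var, c2.g] at hT2 hI2
      simp [hk2, hI2, hdst]
      refine ⟨by omega, ?_, fun j hj => ?_⟩
      · rw [mul_add]; omega
      · simp only [Function.update_apply]
        split
        · subst j; rfl
        · exact hI j (by omega)
  · rintro s1 T1 hF1 ⟨hT1, hI1⟩
    rw [Ex.eval_var, hc] at hT1 hI1
    refine ⟨?_, hI1⟩
    rw [add_mul, mul_assoc, mul_comm P.g] at hT1
    simp
    omega

/-! ### Range maximum queries on strings of digits -/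

/-- The maxima of `f` on successive blocks of length `g`. -/
def blockMax (g : ℕ) (f : ℕ → ℕ) (k : ℕ) : ℕ := (Ico (k * g) (k * g + g)).sup f

lemma blockMax_lt {g B : ℕ} {f : ℕ → ℕ} (hB : 0 < B) (hf : ∀ i, f i < B) (k : ℕ) :
    blockMax g f k < B :=
  (Finset.sup_lt_iff (by simpa using hB)).2 fun i _ => hf i

lemma blockMax_eq_zero {g N N' : ℕ} {f : ℕ → ℕ} (hf : ∀ i, N ≤ i → f i = 0) (hN : N ≤ N' * g)
    (k : ℕ) (hk : N' ≤ k) : blockMax g f k = 0 := by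
  unfold blockMax
  rw [← Nat.bot_eq_zero, Finset.sup_eq_bot_iff]
  intro i hi
  have := Nat.mul_le_mul_right g hk
  exact hf i (by rw [mem_Ico] at hi; omega)

/-- A maximum over a range that is not contained in one block is the maximum over the parts of the
range in the outer blocks and over the maxima of the blocks between them. -/
lemma sup_split {g : ℕ} (hg : 0 < g) (f : ℕ → ℕ) {l r : ℕ} (h : l / g < r / g) :
    (Ico l r).sup f = max (max ((Ico l (l / g * g + g)).sup f) ((Ico (r / g * g) r).sup f))
      ((Ico (l / g + 1) (r / g)).sup (blockMax g f)) := by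
  have h1 := Nat.div_add_mod l g
  have h2 := Nat.div_add_mod r g
  have h3 := Nat.mod_lt l hg
  have h4 : (l / g + 1) * g ≤ r / g * g := Nat.mul_le_mul_right _ h
  rw [mul_comm g] at h1 h2
  rw [add_mul, one_mul] at h4
  apply eq_of_forall_ge_iff
  intro c
  simp only [max_le_iff, Finset.sup_le_iff, mem_Ico, blockMax]
  constructor
  · intro H
    refine ⟨⟨fun i hi => H i (by omega), fun i hi => H i (by omega)⟩, fun k hk i hi => H i ?_⟩
    have := Nat.mul_le_mul_right g hk.1
    have h6 := Nat.mul_le_mul_right g (Nat.succ_le_of_lt hk.2)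
    rw [add_mul] at this
    rw [Nat.succ_mul] at h6
    omega
  · rintro ⟨⟨H1, H2⟩, H3⟩ i hi
    by_cases hi1 : i < l / g * g + g
    · exact H1 i (by omega)
    by_cases hi2 : r / g * g ≤ i
    · exact H2 i (by omega)
    have h5 := Nat.div_add_mod i g
    have h6 := Nat.mod_lt i hg
    rw [mul_comm g] at h5
    refine H3 (i / g) ⟨?_, ?_⟩ i (by omega)
    · rw [Nat.le_div_iff_mul_le hg, add_mul]; omega
    · rw [Nat.div_lt_iff_lt_mul hg]; omega

/-- Filling the array `a` with zeros at the `g` indices from the value of `x` on. -/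
def padZero (a : Arr) (x : Var) : Cmd :=
  .for_ .i Var.g (.put a ((x : Ex) + Var.i) 0)

lemma runs_padZero {M L : ℕ} {P : Par} (h : P.Good L M) {s : St} (hs : Ctx P s) {a : Arr} {x : Var}
    {c : ℕ} (hx : s.v x = c) (hxi : x ≠ .i) (hc : c + P.g ≤ L) :
    Runs M L (padZero a x) s fun s' t => t ≤ 20 * P.g + 10 ∧
      (∀ j < c, s'.a a j = s.a a j) ∧ ∀ j < P.g, s'.a a (c + j) = 0 := by
  have hM := h.le_M
  have hm2 := h.two_le_m
  have hlL := h.le_L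
  unfold padZero
  refine runs_for (fun k s' T => T ≤ 20 * k ∧ (∀ j < c, s'.a a j = s.a a j) ∧
    ∀ j < k, s'.a a (c + j) = 0) ?_ ?_ ?_ ?_
  · simp
  · simp
  · rintro k s1 T hk hF ⟨hT, hI, hI'⟩
    rw [Ex.eval_var, hs.g] at hk
    have hx1 : s1.v x = c := by rw [hF.v _ (by simpa [Cmd.vars] using hxi), hx]
    simp [hx1, hxi, and_assoc]
    repeat refine ⟨by omega, ?_⟩
    refine ⟨fun j hj => ?_, fun j hj => ?_⟩
    · rw [Function.update_of_ne (by omega), hI j hj]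
    · rw [Function.update_apply]
      split
      · rfl
      · exact hI' j (by omega)
  · rintro s1 T1 hF1 ⟨hT1, hI1⟩
    rw [Ex.eval_var, hs.g] at hT1 hI1
    exact ⟨by simp; omega, hI1⟩

/-- The maximal digits of the first `cnt` words of `src` are put into `dst`. -/
def wordMax (src dst : Arr) (cnt : Var) : Cmd :=
  .for_ .k cnt (.put dst Var.k (.get .mx (.get src Var.k)))

lemma runs_wordMax {M L : ℕ} {P : Par} (h : P.Good L M) {s : St} (ht : Tabs P s)
    {src dst : Arr} {cnt : Var} {c : ℕ} (hx : s.v cnt = c) (hc : c ≤ L) (hne : src ≠ dst)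
    (hmx : dst ≠ .mx) {f : ℕ → ℕ} (hf : ∀ i, f i < P.B)
    (hsrc : ∀ k < c, s.a src k = word P.B f (k * P.g) P.g) :
    Runs M L (wordMax src dst cnt) s fun s' t => t ≤ 30 * c + 10 ∧
      ∀ k < c, s'.a dst k = blockMax P.g f k := by
  have htL := h.tw_le_L
  unfold wordMax
  refine runs_for (fun k s' T => T ≤ 30 * k ∧ ∀ j < k, s'.a dst j = blockMax P.g f j) ?_ ?_ ?_ ?_
  · simp
  · simp
  · rintro k s1 T hk hF ⟨hT, hI⟩
    rw [Ex.eval_var, hx] at hk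
    have e1 : s1.a src = s.a src := hF.a _ (by simpa [Cmd.arrs] using hne)
    have e2 : s1.a .mx = s.a .mx := hF.a _ (by simpa [Cmd.arrs] using hmx.symm)
    have hw := word_lt h.two_le_B (s := k * P.g) (n := P.g) (fun j _ => hf _)
    rw [← P.tw_eq] at hw
    simp [e1, e2, hsrc k hk, ht.mx_word h hf, and_assoc]
    repeat refine ⟨by omega, ?_⟩
    intro j hj
    rw [Function.update_apply]
    split
    · subst j; rfl
    · exact hI j (by omega)
  · rintro s1 T1 hF1 ⟨hT1, hI1⟩
    rw [Ex.eval_var, hx] at hT1 hI1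
    exact ⟨by simp; omega, hI1⟩

/-- Building the sparse table. The row `e` holds the maxima on ranges of length `2 ^ e`. -/
def buildSparse : Cmd :=
  .pw ::= 1 ;;
  .for_ .j (.get .lg Var.n1) (
    .off ::= Var.j * Var.n1 ;;
    .for_ .x Var.n1 (
      .t ::= .get .sp (Var.off + Var.x) ;;
      .y ::= Var.x + Var.pw ;;
      .iflt Var.y Var.n1 (
        .u ::= .get .sp (Var.off + Var.y) ;;
        .iflt Var.t Var.u (.t ::= Var.u) .skip) .skip ;;
      .put .sp (Var.off + Var.n1 + Var.x) Var.t) ;;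
    .pw ::= Var.pw * 2)

/-- The recursion between the rows of a sparse table. -/
lemma sup_double (f : ℕ → ℕ) (x p : ℕ) :
    (Ico x (x + p * 2)).sup f = max ((Ico x (x + p)).sup f) ((Ico (x + p) (x + p + p)).sup f) := by
  rw [← Finset.sup_union, Ico_union_Ico_eq_Ico (by omega) (by omega)]
  congr 2; ring

/-- The logarithm table is built. -/
def LogTab (P : Par) (s : St) : Prop := ∀ i ≤ P.m + 2, s.a .lg i = Nat.log 2 i

lemma runs_buildSparse {M L : ℕ} {P : Par} (h : P.Good L M) {s : St} (hs : Ctx P s)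
    (hl : LogTab P s) {f : ℕ → ℕ} (hf0 : ∀ i, P.n1 ≤ i → f i = 0)
    (hf : ∀ k < P.n1, s.a .sp k = f k) :
    Runs M L buildSparse s fun s' t => t ≤ 30000 * P.m + 100 ∧
      ∀ e ≤ Nat.log 2 P.n1, ∀ x < P.n1, s'.a .sp (e * P.n1 + x) = (Ico x (x + 2 ^ e)).sup f := by
  have hM := h.le_M
  have hm2 := h.two_le_m
  have hlL := h.le_L
  have hlog := h.log_n1
  have hn1 := P.n1_le
  have hnw := P.nw_le
  have hn0 := P.n1_pos
  have hlg : s.a .lg P.n1 = Nat.log 2 P.n1 := hl _ (by omega)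
  unfold buildSparse
  simp only [runs_seq, runs_set, Ex.eval_ofNat]
  refine ⟨by simp; omega, ?_⟩
  have c1 := hs.setv 1 (x := .pw) (by decide)
  refine runs_for (fun j s' T => T ≤ (30 + 60 * P.n1) * j ∧ s'.v .pw = 2 ^ j ∧
      ∀ e ≤ j, ∀ x < P.n1, s'.a .sp (e * P.n1 + x) = (Ico x (x + 2 ^ e)).sup f) ?_ ?_ ?_ ?_
  · simp [hs.n1]; omega
  · simp; exact hf
  · rintro j s2 T2 hj hF2 ⟨hT2, hpw, hI2⟩
    have hj' : j < Nat.log 2 P.n1 := by simpa [hs.n1, hlg] using hj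
    have c2 := (c1.frame hF2 (by decide)).setv j (x := .j) (by decide)
    have hjn : (j + 2) * P.n1 ≤ (Nat.log 2 P.n1 + 1) * P.n1 := Nat.mul_le_mul_right _ (by omega)
    rw [add_mul] at hjn
    have hpn : 2 ^ (j + 1) ≤ P.n1 :=
      (Nat.pow_le_pow_right (by norm_num) hj').trans (Nat.pow_log_le_self 2 hn0.ne')
    rw [pow_succ] at hpn
    have e1 := c2.n1
    simp at e1
    simp only [runs_seq, runs_set]
    refine ⟨by simp [e1]; omega, ?_⟩
    have c3 := c2.setv (j * P.n1) (x := .off) (by decide)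
    simp only [Ex.eval_mul, Ex.eval_var, c2.n1, St.setv_v, if_true]
    refine runs_for (fun k s' T => T ≤ 55 * k ∧
      (∀ x < k, s'.a .sp (j * P.n1 + P.n1 + x) = (Ico x (x + 2 ^ (j + 1))).sup f) ∧
      ∀ e ≤ j, ∀ x < P.n1, s'.a .sp (e * P.n1 + x) = (Ico x (x + 2 ^ e)).sup f) ?_ ?_ ?_ ?_
    · simp
    · simpa using hI2
    · rintro k s4 T4 hk hF4 ⟨hT4, hI4, hI4'⟩
      rw [Ex.eval_var, c3.n1] at hk
      have c4 := (c3.frame hF4 (by decide)).setv k (x := .x) (by decide)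
      have e4 := c4.n1
      simp at e4
      have hoff : s4.v .off = j * P.n1 := by rw [hF4.v _ (by decide)]; simp
      have hpw4 : s4.v .pw = 2 ^ j := by rw [hF4.v _ (by decide)]; simp [hpw]
      have hk0 := hI4' j le_rfl k hk
      have hpres : ∀ z, ∀ e ≤ j, ∀ x < P.n1,
          Function.update (s4.a .sp) (j * P.n1 + P.n1 + k) z (e * P.n1 + x) =
          (Ico x (x + 2 ^ e)).sup f := by
        intro z e he x hx
        have := Nat.mul_le_mul_right P.n1 he
        rw [Function.update_of_ne (by omega), hI4' e he x hx]
      have hnew : ∀ z, z = (Ico k (k + 2 ^ (j + 1))).sup f → ∀ x < k + 1,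
          Function.update (s4.a .sp) (j * P.n1 + P.n1 + k) z (j * P.n1 + P.n1 + x) =
          (Ico x (x + 2 ^ (j + 1))).sup f := by
        rintro z rfl x hx
        rw [Function.update_apply]
        split
        · congr 2 <;> omega
        · exact hI4 x (by omega)
      simp only [pow_succ, sup_double, Nat.lt_succ_iff] at hnew
      simp [runs_iflt, e4, hoff, hpw4, hk0, and_assoc]
      repeat refine ⟨by omega, ?_⟩
      refine ⟨fun h1 => ?_, fun h1 => ?_⟩
      · have hk1 := hI4' j le_rfl _ h1
        simp [hk1, -Finset.lt_sup_iff, -Finset.sup_le_iff]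
        repeat refine ⟨by omega, ?_⟩
        refine ⟨fun h2 => ?_, fun h2 => ?_⟩
        · repeat refine ⟨by omega, ?_⟩
          exact ⟨by simpa [pow_succ, sup_double] using hnew _ (max_eq_right h2.le).symm, hpres _⟩
        · repeat refine ⟨by omega, ?_⟩
          exact ⟨by simpa [pow_succ, sup_double] using hnew _ (max_eq_left h2).symm, hpres _⟩
      · have : (Ico (k + 2 ^ j) (k + 2 ^ j + 2 ^ j)).sup f = 0 := by
          rw [← Nat.bot_eq_zero, Finset.sup_eq_bot_iff]
          intro i hi
          exact hf0 i (by rw [mem_Ico] at hi; omega)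
        repeat refine ⟨by omega, ?_⟩
        refine ⟨by simpa [pow_succ, sup_double] using hnew _ (by rw [this]; simp), hpres _⟩
    · rintro s4 T4 hF4 ⟨hT4, hI4, hI4'⟩
      have hpw4 : s4.v .pw = 2 ^ j := by rw [hF4.v _ (by decide)]; simp [hpw]
      rw [Ex.eval_var, c3.n1] at hT4 hI4
      simp [hpw4]
      refine ⟨by omega, by rw [mul_add]; omega, by rw [pow_succ], fun e he x hx => ?_⟩
      rcases he.lt_or_eq with he' | rfl
      · exact hI4' e (by omega) x hx
      · rw [add_mul, one_mul]; exact hI4 x hx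
  · rintro s2 T2 hF2 ⟨hT2, _, hI2⟩
    have e0 : (Ex.get Arr.lg Var.n1).eval (s.setv .pw 1) = Nat.log 2 P.n1 := by
      simp [hs.n1, hlg]
    rw [e0] at hT2 hI2
    refine ⟨?_, hI2⟩
    rw [add_mul] at hT2 hlog
    rw [mul_comm (Nat.log 2 P.n1)] at hlog
    rw [mul_assoc] at hT2
    have : Nat.log 2 P.n1 ≤ P.n1 * Nat.log 2 P.n1 := Nat.le_mul_of_pos_left _ hn0
    simp
    omega

/-- The data structure for range maximum queries on the string `f` of digits: the packed string, the
packed maxima of its words, and the sparse table for the maxima of the words of the latter. -/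
structure MaxStruct (P : Par) (f : ℕ → ℕ) (s : St) : Prop where
  ww : ∀ k < P.nw, s.a .ww k = word P.B f (k * P.g) P.g
  w1 : ∀ k < P.n1, s.a .w1 k = word P.B (blockMax P.g f) (k * P.g) P.g
  sp : ∀ e ≤ Nat.log 2 P.n1, ∀ x < P.n1, s.a .sp (e * P.n1 + x) =
    (Ico x (x + 2 ^ e)).sup (blockMax P.g (blockMax P.g f))

/-- Building the data structure for range maximum queries on the string in `tt`. -/
def buildMax : Cmd :=
  padZero .tt .m ;; pack .tt .ww .nw ;; wordMax .ww .t2 .nw ;;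
  padZero .t2 .nw ;; pack .t2 .w1 .n1 ;; wordMax .w1 .sp .n1 ;; buildSparse

lemma runs_buildMax {M L : ℕ} {P : Par} (h : P.Good L M) {s : St} (hs : Ctx P s)
    (ht : Tabs P s) (hl : LogTab P s) {f : ℕ → ℕ} (hf0 : ∀ i, P.m ≤ i → f i = 0)
    (hfB : ∀ i, f i < P.B) (hf : ∀ k < P.m, s.a .tt k = f k) :
    Runs M L buildMax s fun s' t => t ≤ 40000 * P.m ∧ MaxStruct P f s' := by
  have hm2 := h.two_le_m
  have hlL := h.le_L
  have hn1 := P.n1_le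
  have hnw := P.nw_le
  have hgm := h.g_le
  have hnwg := P.nw_mul_le
  have hn1g := P.n1_mul_le
  have hmnw := P.m_lt_nw
  have hnwn1 := P.nw_lt_n1
  have hB := P.B_pos
  unfold buildMax
  simp only [runs_seq]
  refine (runs_padZero h hs hs.m (by decide) (by omega)).frame.mono ?_
  intro s1 t1 ⟨F1, ht1, hI1, hI1'⟩
  have c1 := hs.frame F1 (by decide)
  have hs1 : ∀ i < P.nw * P.g, s1.a .tt i = f i := by
    intro i hi
    by_cases him : i < P.m
    · rw [hI1 i him, hf i him]
    · have := hI1' (i - P.m) (by omega)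
      rw [show P.m + (i - P.m) = i by omega] at this
      rw [this, hf0 i (by omega)]
  refine (runs_pack h c1 c1.nw (by omega) (by decide) f hs1 hfB).frame.mono
    fun s2 t2 ⟨F2, ht2, hI2⟩ => ?_
  have c2 := c1.frame F2 (by decide)
  refine (runs_wordMax h ((ht.frame F1 (by decide)).frame F2 (by decide)) c2.nw (by omega)
    (by decide) (by decide) hfB hI2).frame.mono fun s3 t3 ⟨F3, ht3, hI3⟩ => ?_
  have c3 := c2.frame F3 (by decide)
  refine (runs_padZero h c3 c3.nw (by decide) (by omega)).frame.mono
    fun s4 t4 ⟨F4, ht4, hI4, hI4'⟩ => ?_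
  have c4 := c3.frame F4 (by decide)
  have hs4 : ∀ i < P.n1 * P.g, s4.a .t2 i = blockMax P.g f i := by
    intro i hi
    by_cases him : i < P.nw
    · rw [hI4 i him, hI3 i him]
    · have := hI4' (i - P.nw) (by omega)
      rw [show P.nw + (i - P.nw) = i by omega] at this
      rw [this, blockMax_eq_zero hf0 hmnw.le i (by omega)]
  have hb1 : ∀ i, blockMax P.g f i < P.B := blockMax_lt hB hfB
  refine (runs_pack h c4 c4.n1 (by omega) (by decide) (blockMax P.g f) hs4 hb1).frame.mono
    fun s5 t5 ⟨F5, ht5, hI5⟩ => ?_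
  have c5 := c4.frame F5 (by decide)
  have tb5 : Tabs P s5 := ((((ht.frame F1 (by decide)).frame F2 (by decide)).frame F3
    (by decide)).frame F4 (by decide)).frame F5 (by decide)
  refine (runs_wordMax h tb5 c5.n1 (by omega)
    (by decide) (by decide) hb1 hI5).frame.mono fun s6 t6 ⟨F6, ht6, hI6⟩ => ?_
  have c6 := c5.frame F6 (by decide)
  have hl6 : LogTab P s6 := by
    intro i hi
    rw [F6.a _ (by decide), F5.a _ (by decide), F4.a _ (by decide), F3.a _ (by decide),
      F2.a _ (by decide), F1.a _ (by decide), hl i hi]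
  refine (runs_buildSparse h c6 hl6 (blockMax_eq_zero
    (blockMax_eq_zero hf0 hmnw.le) hnwn1.le) hI6).frame.mono fun s7 t7 ⟨F7, ht7, hI7⟩ => ?_
  refine ⟨by omega, ⟨fun k hk => ?_, fun k hk => ?_, hI7⟩⟩
  · rw [F7.a _ (by decide), F6.a _ (by decide), F5.a _ (by decide), F4.a _ (by decide),
      F3.a _ (by decide), hI2 k hk]
  · rw [F7.a _ (by decide), F6.a _ (by decide), hI5 k hk]

/-- Increasing `mo` to the value of `e`, if that is larger. -/
def upd (e : Ex) : Cmd := .t ::= e ;; .iflt Var.mo Var.t (.mo ::= Var.t) .skip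

lemma runs_upd {M L : ℕ} {s : St} {e : Ex} {k : ℕ} (he : e.Ok M L s) (hk : e.eval s = k) :
    Runs M L (upd e) s fun s' t => t ≤ e.len + 10 ∧ s'.v .mo = max (s.v .mo) k := by
  unfold upd
  simp [runs_iflt, he, hk]
  omega

lemma upd_vars (e : Ex) : (upd e).vars = [.t, .mo] := rfl

lemma upd_arrs (e : Ex) : (upd e).arrs = [] := rfl

/-- A query in the sparse table: the range from `l` to `r - 1` is covered by two ranges whose length
is a power of two. -/
def sparseMax (l r : Var) : Cmd :=
  .iflt l r (
    .e ::= .get .lg ((r : Ex) - l) ;;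
    upd (.get .sp (Var.e * Var.n1 + l)) ;;
    upd (.get .sp (Var.e * Var.n1 + (r - (1 <<: Var.e))))) .skip

/-- The maximum of a range of digits that are packed in `wa`, where `inner` finds the maximum for a
range of full words. The parts of the range in its first and last words are cut out by shifts and
masks and looked up in the table `mx`. -/
def packedMax (wa : Arr) (l r a c : Var) (inner : Cmd) : Cmd :=
  .iflt l r (
    a ::= l >>: Var.gm ;; c ::= r >>: Var.gm ;;
    .iflt a c (
      upd (.get .mx (.get wa a >>: (Var.b * Ex.low l Var.gm))) ;;
      upd (.get .mx (Ex.low (.get wa c) (Var.b * Ex.low r Var.gm))) ;;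
      a ::= a + 1 ;; inner)
    (upd (.get .mx (Ex.low (.get wa a >>: (Var.b * Ex.low l Var.gm)) (Var.b * (r - l)))))) .skip

/-- The variable `mo` becomes the maximal digit in the range from `l` to `r - 1`. -/
def rangeMax : Cmd :=
  .mo ::= 0 ;; packedMax .ww .l .r .a1 .c1 (packedMax .w1 .a1 .c1 .a2 .c2 (sparseMax .a2 .c2))

lemma runs_sparseMax {M L : ℕ} {P : Par} (h : P.Good L M) {s : St} (hs : Ctx P s)
    (hl : LogTab P s) {f : ℕ → ℕ}
    (hsp : ∀ e ≤ Nat.log 2 P.n1, ∀ x < P.n1, s.a .sp (e * P.n1 + x) = (Ico x (x + 2 ^ e)).sup f)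
    {x y : Var} {l r : ℕ} (hx : s.v x = l) (hy : s.v y = r) (hr : r < P.n1)
    (hxt : x ≠ .t ∧ x ≠ .mo ∧ x ≠ .e) (hyt : y ≠ .t ∧ y ≠ .mo ∧ y ≠ .e) :
    Runs M L (sparseMax x y) s fun s' t => t ≤ 100 ∧
      s'.v .mo = max (s.v .mo) ((Ico l r).sup f) := by
  have hm2 := h.two_le_m
  have hlL := h.le_L
  have hM := h.le_M
  have hn1 := P.n1_le
  have hnw := P.nw_le
  have hlog := h.log_n1
  unfold sparseMax
  rw [runs_iflt]
  refine ⟨by simp, by simp, fun hlt => ?_, fun hle => ?_⟩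
  · simp only [Ex.eval_var, hx, hy] at hlt
    have hlg := hl (r - l) (by omega)
    set e := Nat.log 2 (r - l) with he
    have hle : e ≤ Nat.log 2 P.n1 := Nat.log_mono_right (by omega)
    have h1 : 2 ^ e ≤ r - l := Nat.pow_log_le_self 2 (by omega)
    have h2 : r - l < 2 ^ (e + 1) := Nat.lt_pow_succ_log_self (by norm_num) _
    rw [pow_succ] at h2
    have h3 : (e + 1) * P.n1 ≤ (Nat.log 2 P.n1 + 1) * P.n1 := Nat.mul_le_mul_right _ (by omega)
    rw [add_mul, one_mul] at h3
    simp only [runs_seq, runs_set]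
    refine ⟨by simp [hx, hy]; omega, ?_⟩
    have e1 : (Ex.get Arr.lg ((x : Ex) - y)).len = 7 := rfl
    refine (runs_upd (k := (Ico l (l + 2 ^ e)).sup f) ?_ ?_).frame.mono
      fun s1 t1 ⟨F1, ht1, hI1⟩ => ?_
    · simp [hs.n1, hx, hy, hxt, hlg]; omega
    · simp [hs.n1, hx, hy, hxt, hlg]; exact hsp e hle l (by omega)
    rw [upd_vars, upd_arrs] at F1
    have v1 : s1.v .e = e := by rw [F1.v _ (by decide)]; simp [hx, hy, hlg]
    have v2 : s1.v .n1 = P.n1 := by rw [F1.v _ (by decide)]; simp [hs.n1]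
    have v3 : s1.v y = r := by
      rw [F1.v _ (by simp [hyt])]; simp [hyt, hy]
    have v4 : s1.a .sp = s.a .sp := by rw [F1.a _ (by decide)]; simp
    refine (runs_upd (k := (Ico (r - 2 ^ e) r).sup f) ?_ ?_).mono fun s2 t2 ⟨ht2, hI2⟩ => ?_
    · simp [v1, v2, v3]; omega
    · simp [v1, v2, v3, v4]
      have := hsp e hle (r - 2 ^ e) (by omega)
      rwa [show r - 2 ^ e + 2 ^ e = r by omega] at this
    simp at ht1 ht2 hI1
    refine ⟨by simp; omega, ?_⟩
    rw [hI2, hI1, max_assoc]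
    congr 1
    rw [← Finset.sup_union]
    congr 1
    ext i; simp only [mem_union, mem_Ico]; omega
  · simp only [Ex.eval_var, hx, hy] at hle
    simp [Ico_eq_empty_of_le hle]

/-- One round of packing reduces range maxima of `f` to range maxima of the maxima of words, which
`inner` is to find by the hypothesis `hin`. This is used twice, with the sparse table inside. -/
lemma runs_packedMax {M L : ℕ} {P : Par} (h : P.Good L M) {s : St} (hs : Ctx P s) (ht : Tabs P s)
    {wa : Arr} {x y a c : Var} {inner : Cmd} {f : ℕ → ℕ} {N T l r : ℕ}
    (hf : ∀ i, f i < P.B) (hN : N ≤ L)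
    (hw : ∀ k < N, s.a wa k = word P.B f (k * P.g) P.g)
    (hx : s.v x = l) (hy : s.v y = r) (hr : r < N * P.g)
    (hv : a ∉ parVars ∧ c ∉ parVars ∧ x ≠ a ∧ x ≠ c ∧ x ≠ .t ∧ x ≠ .mo ∧ y ≠ a ∧ y ≠ c ∧ y ≠ .t ∧
      y ≠ .mo ∧
      a ≠ c ∧ a ≠ .t ∧ a ≠ .mo ∧ c ≠ .t ∧ c ≠ .mo)
    (hin : ∀ s', Frame [a, c, .t, .mo] [] s s' → s'.v a = l / P.g + 1 → s'.v c = r / P.g →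
      Runs M L inner s' fun s'' t => t ≤ T ∧ s''.v .mo =
        max (s'.v .mo) ((Ico (l / P.g + 1) (r / P.g)).sup (blockMax P.g f))) :
    Runs M L (packedMax wa x y a c inner) s fun s' t => t ≤ T + 150 ∧
      s'.v .mo = max (s.v .mo) ((Ico l r).sup f) := by
  obtain ⟨v1, v2, v3, v3', v4, v5, v6, v7, v8, v9, v10, v11, v12, v13, v14⟩ := hv
  have hm2 := h.two_le_m
  have hlL := h.le_L
  have hM := h.le_M
  have hB := h.two_le_B
  have htL := h.tw_le_L
  have hg0 := P.g_pos
  have hgp : 2 ^ P.gm = P.g := rfl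
  have hBp : 2 ^ P.b = P.B := rfl
  have hbm : ∀ i, 2 ^ (P.b * i) = P.B ^ i := fun i => by rw [Par.B, ← pow_mul]
  have hbg := h.b_le
  have hbgm : ∀ i ≤ P.g, P.b * i < M ∧ P.B ^ i < M := by
    intro i hi
    rw [← hbm]
    have h1 : 2 ^ (P.b * i) ≤ P.tw :=
      Nat.pow_le_pow_right (by norm_num) (Nat.mul_le_mul_left _ hi)
    have := (Nat.lt_two_pow_self : P.b * i < 2 ^ (P.b * i))
    omega
  have hrN : r / P.g < N := (Nat.div_lt_iff_lt_mul hg0).2 hr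
  have hl0 := Nat.div_add_mod l P.g
  have hr0 := Nat.div_add_mod r P.g
  have hl1 := Nat.mod_lt l hg0
  have hr1 := Nat.mod_lt r hg0
  rw [mul_comm P.g] at hl0 hr0
  have hwlt : ∀ k j n, n ≤ P.g → word P.B f (k * P.g + j) n < L := by
    intro k j n hn
    have h1 := word_lt hB (s := k * P.g + j) (n := n) (fun j _ => hf _)
    have h2 : P.B ^ n ≤ P.tw := by rw [P.tw_eq]; exact Nat.pow_le_pow_right P.B_pos hn
    omega
  have hgL : 2 ^ P.gm < M := by rw [hgp]; have := h.g_le; omega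
  have nm : ∀ {z}, z ∈ parVars → z ≠ a ∧ z ≠ c := fun {z} hz =>
    ⟨fun e => v1 (e ▸ hz), fun e => v2 (e ▸ hz)⟩
  have n1 := nm (z := .gm) (by decide)
  have n2 := nm (z := .b) (by decide)
  unfold packedMax
  rw [runs_iflt]
  refine ⟨by simp, by simp, fun hlt => ?_, fun hle => ?_⟩
  · simp only [Ex.eval_var, hx, hy] at hlt
    simp only [runs_seq, runs_set]
    simp [hx, hy, hs.gm, hgp, v6, n1.1, runs_iflt, v10]
    set s1 := (s.setv a (l / P.g)).setv c (r / P.g) with hs1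
    have b1 : s1.v a = l / P.g := by simp [hs1, v10]
    have b2 : s1.v c = r / P.g := by simp [hs1]
    have b4 : s1.v y = r := by simp [hs1, v6, v7, hy]
    have b5 : s1.v .b = P.b := by simp [hs1, n2, hs.b]
    have b6 : s1.v .gm = P.gm := by simp [hs1, n1, hs.gm]
    have b7 : s1.a = s.a := rfl
    have b3 : s1.v x = l := by simp [hs1, v3, v3', hx]
    have hfr : Frame [a, c, .t, .mo] [] s s1 := ⟨fun z hz => by
      simp only [List.mem_cons, not_or] at hz; simp [hs1, hz.1, hz.2.1], fun _ _ => rfl⟩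
    have hmo : s1.v .mo = s.v .mo := by simp [hs1, v12.symm, v14.symm]
    refine ⟨fun hlt2 => ?_, fun hge => ?_⟩
    · refine (runs_upd (k := (Ico l (l / P.g * P.g + P.g)).sup f) ?_ ?_).frame.mono
        fun s2 t2 ⟨F2, ht2, hI2⟩ => ?_
      · simp [b1, b3, b5, b6, b7, hgp, hw _ (hlt2.trans hrN), hbm, word_div hf, hbgm _ hl1.le,
          hwlt _ _ _ (Nat.sub_le _ _)]
        omega
      · simp [b1, b3, b5, b6, b7, hgp, hw _ (hlt2.trans hrN), hbm, word_div hf,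
          ht.mx_word h hf (Nat.sub_le _ _)]
        congr 2
        omega
      rw [upd_vars, upd_arrs] at F2
      have d1 : s2.v a = l / P.g := by rw [F2.v _ (by simp [v11, v12]), b1]
      have d2 : s2.v c = r / P.g := by rw [F2.v _ (by simp [v13, v14]), b2]
      have d4 : s2.v y = r := by rw [F2.v _ (by simp [v8, v9]), b4]
      have d5 : s2.v .b = P.b := by rw [F2.v _ (by decide), b5]
      have d6 : s2.v .gm = P.gm := by rw [F2.v _ (by decide), b6]
      have d7 : s2.a = s.a := by ext z; rw [F2.a z (by simp), b7]
      refine (runs_upd (k := (Ico (r / P.g * P.g) r).sup f) ?_ ?_).frame.mono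
        fun s3 t3 ⟨F3, ht3, hI3⟩ => ?_
      · have := hwlt (r / P.g) 0 (min (r % P.g) P.g) (min_le_right _ _)
        rw [add_zero] at this
        simp [d2, d4, d5, d6, d7, hgp, hw _ hrN, hbm, word_mod hf, hbgm _ hr1.le, this]
        omega
      · simp [d2, d4, d5, d6, d7, hgp, hw _ hrN, hbm, word_mod hf,
          ht.mx_word h hf (min_le_right _ _)]
        congr 2; rw [min_eq_left hr1.le]; omega
      rw [upd_vars, upd_arrs] at F3
      have g1 : s3.v a = l / P.g := by rw [F3.v _ (by simp [v11, v12]), d1]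
      have g2 : s3.v c = r / P.g := by rw [F3.v _ (by simp [v13, v14]), d2]
      have hF3 : Frame [a, c, .t, .mo] [] s (s3.setv a (l / P.g + 1)) := by
        refine (hfr.trans ((F2.trans F3).mono (by simp) (by simp))).trans
          ⟨fun z hz => ?_, fun _ _ => rfl⟩
        simp only [List.mem_cons, not_or] at hz
        simp [hz.1]
      simp [g1]
      have : l / P.g ≤ l := Nat.div_le_self _ _
      have hl64 : l / P.g + 1 < M := by omega
      refine ⟨⟨by omega, by omega⟩, ?_⟩
      refine (hin _ hF3 (by simp) (by simp [v10.symm, g2])).mono fun s4 t4 ⟨ht4, hI4⟩ => ?_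
      simp at ht2 ht3
      refine ⟨by omega, ?_⟩
      rw [hI4]
      simp [v12.symm, hI3, hI2, hmo]
      rw [sup_split hg0 f hlt2]
      simp only [max_assoc]
    · have hdiv : r / P.g = l / P.g := le_antisymm hge (Nat.div_le_div_right hlt.le)
      rw [hdiv] at hr0
      refine (runs_upd (k := (Ico l r).sup f) ?_ ?_).mono fun s2 t2 ⟨ht2, hI2⟩ => ?_
      · simp [b1, b3, b4, b5, b6, b7, hgp, hw _ (hdiv ▸ hrN), hbm, word_div hf, word_mod hf,
          hbgm _ hl1.le,
          hwlt _ _ _ ((min_le_right (r - l) _).trans (Nat.sub_le P.g (l % P.g))),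
          hbgm (r - l) (by omega)]
        have := hdiv ▸ hrN
        omega
      · simp [b1, b3, b4, b5, b6, b7, hgp, hw _ (hdiv ▸ hrN), hbm, word_div hf, word_mod hf,
          ht.mx_word h hf ((min_le_right (r - l) _).trans (Nat.sub_le P.g (l % P.g)))]
        congr 2
        omega
      simp at ht2
      refine ⟨by omega, ?_⟩
      rw [hI2, hmo]
  · simp only [Ex.eval_var, hx, hy] at hle
    simp [Ico_eq_empty_of_le hle]

lemma runs_rangeMax {M L : ℕ} {P : Par} (h : P.Good L M) {s : St} (hs : Ctx P s) (ht : Tabs P s)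
    (hlg : LogTab P s) {f : ℕ → ℕ} (hf : ∀ i, f i < P.B) (hst : MaxStruct P f s) {l r : ℕ}
    (hl : s.v .l = l) (hr : s.v .r = r) (hrm : r ≤ P.m) :
    Runs M L rangeMax s fun s' t => t ≤ 410 ∧ s'.v .mo = (Ico l r).sup f := by
  have hm2 := h.two_le_m
  have hlL := h.le_L
  have hM := h.le_M
  have hn1 := P.n1_le
  have hnw := P.nw_le
  have hmnw := P.m_lt_nw
  have hnwn1 := P.nw_lt_n1
  have hrN : r / P.g < P.nw := (Nat.div_lt_iff_lt_mul P.g_pos).2 (by omega)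
  have hrN2 : r / P.g / P.g < P.n1 := (Nat.div_lt_iff_lt_mul P.g_pos).2 (by omega)
  unfold rangeMax
  simp only [runs_seq, runs_set, Ex.eval_ofNat]
  refine ⟨by simp; omega, ?_⟩
  have key := runs_packedMax h (s := s.setv .mo 0) (hs.setv 0 (by decide))
    (ht.congr rfl rfl rfl rfl)
    (x := .l) (y := .r) (a := .a1) (c := .c1) (T := 250)
    (inner := packedMax .w1 .a1 .c1 .a2 .c2 (sparseMax .a2 .c2)) hf (N := P.nw) (by omega)
    hst.ww (by simpa using hl) (by simpa using hr) (by omega) (by decide)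
    (fun s1 F1 ha1 hc1 => ?_)
  · refine key.mono fun s' t ⟨h1, h2⟩ => ⟨by simp; omega, by simp [h2]⟩
  · have c1 : Ctx P s1 := (hs.setv (x := .mo) 0 (by decide)).frame F1 (by decide)
    have hfa : ∀ a, s1.a a = s.a a := fun a => F1.a a (by simp)
    have t1 : Tabs P s1 := ht.congr (hfa _) (hfa _) (hfa _) (hfa _)
    refine runs_packedMax h c1 t1
      (f := blockMax P.g f) (T := 100) (blockMax_lt P.B_pos hf) (N := P.n1) (by omega)
      (by intro k hk; rw [hfa, hst.w1 k hk]) ha1 hc1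
      (by omega) (by decide) (fun s2 F2 ha2 hc2 => ?_)
    have hfa2 : ∀ a, s2.a a = s.a a := fun a => by rw [F2.a a (by simp), hfa]
    refine (runs_sparseMax h (c1.frame F2 (by decide)) (fun i hi => by rw [hfa2, hlg i hi])
      (f := blockMax P.g (blockMax P.g f)) ?_ ha2 hc2 hrN2 (by decide) (by decide))
    intro e he x hx
    rw [hfa2, hst.sp e he x hx]

/-! ### Wavelet matrices -/

lemma Tabs.on_ofDigits {P : Par} {s : St} (h : Tabs P s) {j : ℕ} (hj : j < P.b) {l : List ℕ}
    (hl : l.length ≤ P.g) (hd : ∀ a ∈ l, a < P.B) :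
    s.a .on (j * P.tw + Nat.ofDigits P.B l) = l.countP fun a => a / 2 ^ j % 2 = 1 := by
  have h1 := h.on j hj
  rw [P.tw_eq] at h1
  have := oneTab_ofDigits h1 hj hl hd
  rw [← P.tw_eq] at this
  exact this

lemma Tabs.zt_ofDigits {P : Par} {s : St} (h : Tabs P s) {j : ℕ} (hj : j < P.b) {l : List ℕ}
    (hl : l.length ≤ P.g) (hd : ∀ a ∈ l, a < P.B) :
    s.a .zt (j * P.tw + Nat.ofDigits P.B l) =
      Nat.ofDigits P.B (l.filter fun a => a / 2 ^ j % 2 = 0) := by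
  have h1 := h.zt j hj
  rw [P.tw_eq] at h1
  have := filterTab_ofDigits h1 hj hl hd
  rw [← P.tw_eq] at this
  exact this

lemma Tabs.ot_ofDigits {P : Par} {s : St} (h : Tabs P s) {j : ℕ} (hj : j < P.b) {l : List ℕ}
    (hl : l.length ≤ P.g) (hd : ∀ a ∈ l, a < P.B) :
    s.a .ot (j * P.tw + Nat.ofDigits P.B l) =
      Nat.ofDigits P.B (l.filter fun a => a / 2 ^ j % 2 = 1) := by
  have h1 := h.ot j hj
  rw [P.tw_eq] at h1
  have := filterTab_ofDigits h1 hj hl hd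
  rw [← P.tw_eq] at this
  exact this

/-- The list `E` of digits has been written into the words of `ww` from index `nb` on, except for
less than `g` last digits, which are packed in the variable `buf`. -/
structure Stream (P : Par) (nb : ℕ) (E : List ℕ) (s : St) : Prop where
  len : E.length = s.v .outk * P.g + s.v .fill
  fill : s.v .fill < P.g
  buf : s.v .buf = Nat.ofDigits P.B (E.drop (s.v .outk * P.g))
  ww : ∀ i < s.v .outk, s.a .ww (nb + i) = Nat.ofDigits P.B ((E.drop (i * P.g)).take P.g)

/-- Appending the `cnt` digits that are packed in `e` to the output of packed words. -/
def emit : Cmd :=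
  .buf ::= Var.buf + (Var.e <<: (Var.b * Var.fill)) ;;
  .fill ::= Var.fill + Var.cnt ;;
  .iflt Var.fill Var.g .skip (
    .put .ww (Var.nb + Var.outk) (Ex.low Var.buf (Var.b * Var.g)) ;;
    .buf ::= Var.buf >>: (Var.b * Var.g) ;;
    .fill ::= Var.fill - Var.g ;;
    .outk ::= Var.outk + 1)

/-- The buffer has less than `g` digits before, and at most `g` digits are appended, so that at most
one word becomes full. -/
lemma runs_emit {M L : ℕ} {P : Par} (h : P.Good L M) {s : St} (hs : Ctx P s) {nb : ℕ}
    {E X : List ℕ} (hE : Stream P nb E s) (hnb : s.v .nb = nb) (he : s.v .e = Nat.ofDigits P.B X)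
    (hc : s.v .cnt = X.length) (hX : X.length ≤ P.g) (hd : ∀ a ∈ E ++ X, a < P.B)
    (hlen : (E ++ X).length ≤ P.nw * P.g) (hL : nb + P.nw ≤ L) :
    Runs M L emit s fun s' t => t ≤ 60 ∧ Stream P nb (E ++ X) s' ∧
      ∀ i < nb, s'.a .ww i = s.a .ww i := by
  obtain ⟨h1, h2, h3, h4⟩ := hE
  have hM := h.le_M
  have htt := h.tw_tw
  have hB := h.two_le_B
  have hm2 := h.two_le_m
  have hlL := h.le_L
  have hgm := h.g_le
  have hg0 := P.g_pos
  set q := s.v .outk with hq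
  set fl := s.v .fill with hfl
  set R := E.drop (q * P.g) with hR
  have hRl : R.length = fl := by rw [hR, List.length_drop]; omega
  have hdR : (E ++ X).drop (q * P.g) = R ++ X := by
    rw [List.drop_append_of_le_length (by omega)]
  have hRd : ∀ a ∈ R ++ X, a < P.B := fun a ha => hd a (by
    rw [← hdR] at ha; exact List.mem_of_mem_drop ha)
  have hbm : ∀ i, 2 ^ (P.b * i) = P.B ^ i := fun i => by rw [Par.B, ← pow_mul]
  have hbuf : Nat.ofDigits P.B R + Nat.ofDigits P.B X * P.B ^ fl = Nat.ofDigits P.B (R ++ X) := by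
    rw [Nat.ofDigits_append, hRl, mul_comm]
  have hlt : Nat.ofDigits P.B (R ++ X) < L := by
    have := Nat.ofDigits_lt_base_pow_length hB hRd
    refine this.trans_le (le_trans ?_ htt)
    rw [P.tw_eq, ← pow_add]
    exact Nat.pow_le_pow_right P.B_pos (by simp; omega)
  have hbf : P.b * fl < M ∧ P.b * P.g < M ∧ P.B ^ P.g < M := by
    have e1 : P.B ^ P.g = P.tw := P.tw_eq.symm
    have e2 := h.tw_le_L
    have e3 : P.b * fl ≤ P.b * P.g := Nat.mul_le_mul_left _ h2.le
    have e4 : P.b * P.g < P.tw := Nat.lt_two_pow_self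
    omega
  rw [List.length_append] at hlen
  have hqn : q * P.g + fl + X.length ≤ P.nw * P.g := by omega
  unfold emit
  simp [runs_iflt, hs.b, hs.g, he, hc, ← hq, ← hfl, h3, hbm, hbuf, hnb, and_assoc]
  repeat refine ⟨by omega, ?_⟩
  refine ⟨fun hlt2 => ⟨?_, ?_, ?_, ?_⟩, fun hge => ?_⟩
  · simp [← hq]; omega
  · simpa using hlt2
  · simp [← hq, hdR]
  · intro i hi
    simp [← hq] at hi
    have : (i + 1) * P.g ≤ q * P.g := Nat.mul_le_mul_right _ hi
    rw [add_mul] at this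
    simp only [St.setv_a, h4 i hi]
    rw [List.drop_append_of_le_length (by omega), List.take_append_of_le_length]
    rw [List.length_drop]; omega
  · have hq1 : q < P.nw := by
      by_contra hc
      have := Nat.mul_le_mul_right P.g (not_lt.1 hc)
      omega
    repeat refine ⟨by omega, ?_⟩
    refine ⟨⟨?_, ?_, ?_, ?_⟩, ?_⟩
    · simp; rw [add_mul]; omega
    · simp; omega
    · simp
      rw [Nat.ofDigits_div_pow_eq_ofDigits_drop _ (by omega) _ hRd, ← hdR, List.drop_drop]
      congr 2; ring
    · simp
      intro i hi
      rw [Function.update_apply]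
      split
      · have : i = q := by omega
        rw [Nat.ofDigits_mod_pow_eq_ofDigits_take _ (by omega) _ hRd, ← hdR, this]
      · have hi' : i < q := by omega
        have : (i + 1) * P.g ≤ q * P.g := Nat.mul_le_mul_right _ hi'
        rw [add_mul] at this
        rw [h4 i hi', List.drop_append_of_le_length (by omega), List.take_append_of_le_length]
        rw [List.length_drop]; omega
    · intro i hi
      rw [Function.update_of_ne (by omega)]

/-- The lists of a wavelet matrix: the list of level `j + 1` arises from that of level `j` by a
stable sort by the bit `b - 1 - j`. -/
def wmList (b : ℕ) (l : List ℕ) : ℕ → List ℕ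
  | 0 => l
  | j + 1 => (wmList b l j).filter (fun a => a / 2 ^ (b - (j + 1)) % 2 = 0) ++
      (wmList b l j).filter (fun a => a / 2 ^ (b - (j + 1)) % 2 = 1)

lemma filter_zero_length_add (l : List ℕ) (p : ℕ) :
    (l.filter fun a => a / 2 ^ p % 2 = 0).length + l.countP (fun a => a / 2 ^ p % 2 = 1) =
      l.length := by
  induction l with
  | nil => simp
  | cons a l ih =>
    rcases Nat.mod_two_eq_zero_or_one (a / 2 ^ p) with h | h <;>
    simp [h] <;> omega

lemma wmList_length (b : ℕ) (l : List ℕ) (j : ℕ) : (wmList b l j).length = l.length := by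
  induction j with
  | zero => rfl
  | succ j ih =>
    rw [wmList, List.length_append, ← List.countP_eq_length_filter, List.countP_eq_length_filter,
      ← List.countP_eq_length_filter (p := fun a => decide (a / 2 ^ (b - (j + 1)) % 2 = 1)),
      filter_zero_length_add, ih]

lemma mem_wmList {b : ℕ} {l : List ℕ} {j a : ℕ} : a ∈ wmList b l j ↔ a ∈ l := by
  induction j with
  | zero => rfl
  | succ j ih =>
    rw [wmList, List.mem_append, List.mem_filter, List.mem_filter, ih]
    rcases Nat.mod_two_eq_zero_or_one (a / 2 ^ (b - (j + 1))) with h | h <;> simp [h]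

/-- The wavelet matrix of the list `l` is built up to level `j`: `ww` holds the packed lists, `cc`
the numbers of digits before every word whose bit is zero. -/
structure Wave (P : Par) (l : List ℕ) (j : ℕ) (s : St) : Prop where
  ww : ∀ i ≤ j, ∀ k < P.nw, s.a .ww (i * P.st + k) =
    Nat.ofDigits P.B (((wmList P.b l i).drop (k * P.g)).take P.g)
  cc : ∀ i < j, ∀ k ≤ P.nw, s.a .cc (i * P.st + k) =
    (((wmList P.b l i).take (k * P.g)).filter fun a => a / 2 ^ (P.b - (i + 1)) % 2 = 0).length

/-- Counting the digits with bit zero in the words of a level of a wavelet matrix. -/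
def countLoop : Cmd :=
  .for_ .k Var.nw (
    .put .cc (Var.base + Var.k) Var.cum ;;
    .cum ::= Var.cum + (Var.g - .get .on (Var.off + .get .ww (Var.base + Var.k)))) ;;
  .put .cc (Var.base + Var.nw) Var.cum

/-- Appending, for all words of a level of a wavelet matrix, the digits that `tab` selects, the
number of which is `e`, to the next level. -/
def splitLoop (tab : Arr) (e : Ex) : Cmd :=
  .for_ .k Var.nw (
    .x ::= Var.off + .get .ww (Var.base + Var.k) ;;
    .cnt ::= e ;; .e ::= .get tab Var.x ;; emit)

/-- Building a wavelet matrix. Every level is split by one bit with a constant number of table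
lookups for every packed word. -/
def buildWave : Cmd :=
  .for_ .j Var.b (
    .off ::= (Var.b - (Var.j + 1)) * Var.tw ;;
    .base ::= Var.j * Var.st ;;
    .nb ::= Var.base + Var.st ;;
    .buf ::= 0 ;; .fill ::= 0 ;; .outk ::= 0 ;; .cum ::= 0 ;;
    countLoop ;;
    splitLoop .zt (Var.g - .get .on Var.x) ;;
    splitLoop .ot (.get .on Var.x))

/-- The chunk of a list that is packed in one word. -/
lemma take_succ_mul (l : List ℕ) (k g : ℕ) :
    l.take ((k + 1) * g) = l.take (k * g) ++ (l.drop (k * g)).take g := by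
  rw [add_mul, one_mul, List.take_add]

lemma chunk_length {P : Par} {l : List ℕ} (hl : l.length = P.nw * P.g) {k : ℕ} (hk : k < P.nw) :
    ((l.drop (k * P.g)).take P.g).length = P.g := by
  have : (k + 1) * P.g ≤ P.nw * P.g := Nat.mul_le_mul_right _ hk
  rw [add_mul] at this
  rw [List.length_take, List.length_drop]; omega

lemma runs_countLoop {M L : ℕ} {P : Par} (h : P.Good L M) {s : St} (hs : Ctx P s) (ht : Tabs P s)
    {l : List ℕ} {j : ℕ} (hl : l.length = P.nw * P.g) (hd : ∀ a ∈ l, a < P.B) (hj : j < P.b)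
    (hoff : s.v .off = (P.b - (j + 1)) * P.tw) (hbase : s.v .base = j * P.st)
    (hcum : s.v .cum = 0)
    (hw : ∀ k < P.nw, s.a .ww (j * P.st + k) = Nat.ofDigits P.B ((l.drop (k * P.g)).take P.g)) :
    Runs M L countLoop s fun s' t => t ≤ 50 * P.nw + 30 ∧
      (∀ i < j * P.st, s'.a .cc i = s.a .cc i) ∧ ∀ k ≤ P.nw, s'.a .cc (j * P.st + k) =
        ((l.take (k * P.g)).filter fun a => a / 2 ^ (P.b - (j + 1)) % 2 = 0).length := by
  have hM := h.le_M
  have hm2 := h.two_le_m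
  have hlL := h.le_L
  have hbt := h.b_tw
  have hbs := h.b_st
  have hnwg := h.nwg
  have hjs : (j + 1) * P.st ≤ (P.b + 1) * P.st := Nat.mul_le_mul_right _ (by omega)
  have hst : P.st = P.nw + 1 := rfl
  have hgm := h.g_le
  rw [add_mul, one_mul] at hjs
  have hoL : (P.b - (j + 1) + 1) * P.tw ≤ P.b * P.tw := Nat.mul_le_mul_right _ (by omega)
  rw [add_mul, one_mul] at hoL
  unfold countLoop
  simp only [runs_seq]
  refine runs_for (fun k s' T => T ≤ 50 * k ∧
      s'.v .cum = ((l.take (k * P.g)).filter fun a => a / 2 ^ (P.b - (j + 1)) % 2 = 0).length ∧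
      (∀ i < j * P.st, s'.a .cc i = s.a .cc i) ∧ ∀ i < k, s'.a .cc (j * P.st + i) =
        ((l.take (i * P.g)).filter fun a => a / 2 ^ (P.b - (j + 1)) % 2 = 0).length) ?_ ?_ ?_ ?_
  · simp
  · simp [hcum]
  · rintro k s1 T hk hF ⟨hT, hc, hI, hI'⟩
    rw [Ex.eval_var, hs.nw] at hk
    have c1 := (hs.frame hF (by decide))
    have t1 := (ht.frame hF (by decide))
    have e1 : s1.a .ww = s.a .ww := hF.a _ (by decide)
    have e2 : s1.v .off = s.v .off := hF.v _ (by decide)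
    have e3 : s1.v .base = s.v .base := hF.v _ (by decide)
    have hlen := chunk_length hl hk
    have hdc : ∀ a ∈ (l.drop (k * P.g)).take P.g, a < P.B := fun a ha =>
      hd a (List.mem_of_mem_drop (List.mem_of_mem_take ha))
    have hon := t1.on_ofDigits (j := P.b - (j + 1)) (by omega) hlen.le hdc
    have hlt := Nat.ofDigits_lt_base_pow_length h.two_le_B hdc
    rw [hlen, ← P.tw_eq] at hlt
    have hsum := filter_zero_length_add ((l.drop (k * P.g)).take P.g) (P.b - (j + 1))
    have hcl : ((l.take (k * P.g)).filter fun a => decide (a / 2 ^ (P.b - (j + 1)) % 2 = 0)).length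
        ≤ l.length := (List.length_filter_le _ _).trans (List.length_take_le' _ _)
    simp [e1, e2, e3, hoff, hbase, c1.g, hc, hw k hk, hon, and_assoc]
    simp only [List.countP_eq_length_filter] at hsum ⊢
    repeat refine ⟨by omega, ?_⟩
    refine ⟨?_, fun i hi => ?_, fun i hi => ?_⟩
    · rw [take_succ_mul, List.filter_append, List.length_append]; omega
    · rw [Function.update_of_ne (by omega), hI i hi]
    · rw [Function.update_apply]
      split
      · have : i = k := by omega
        rw [this]
      · exact hI' i (by omega)
  · rintro s1 T hF ⟨hT, hc, hI, hI'⟩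
    rw [Ex.eval_var, hs.nw] at hT hc hI'
    have e3 : s1.v .base = s.v .base := hF.v _ (by decide)
    have c1 := (hs.frame hF (by decide))
    simp [e3, hbase, c1.nw, hc, and_assoc]
    repeat refine ⟨by omega, ?_⟩
    refine ⟨fun i hi => ?_, fun i hi => ?_⟩
    · rw [Function.update_of_ne (by omega), hI i hi]
    · rw [Function.update_apply]
      split
      · have : i = P.nw := by omega
        rw [this]
      · exact hI' i (by omega)

/-- The hypothesis `hX` says that the table selects the digits whose bit `p` is `v` from a packed
word, and that `e` is their number. -/
lemma runs_splitLoop {M L : ℕ} {P : Par} (h : P.Good L M) {s : St} (hs : Ctx P s) (ht : Tabs P s)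
    {l E : List ℕ} {nb p v : ℕ} {tab : Arr} {e : Ex} (hl : l.length = P.nw * P.g)
    (hd : ∀ a ∈ l, a < P.B) (hdE : ∀ a ∈ E, a < P.B)
    (hEl : (E ++ l.filter fun a => a / 2 ^ p % 2 = v).length ≤ P.nw * P.g)
    (hoff : s.v .off + P.tw ≤ L) (hbase : s.v .base + P.nw ≤ nb) (hnb : s.v .nb = nb)
    (hL : nb + P.nw ≤ L) (hE : Stream P nb E s)
    (hw : ∀ k < P.nw, s.a .ww (s.v .base + k) = Nat.ofDigits P.B ((l.drop (k * P.g)).take P.g))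
    (he : e.len ≤ 20)
    (hX : ∀ X : List ℕ, X.length = P.g → (∀ a ∈ X, a < P.B) → ∀ s' : St, Ctx P s' → Tabs P s' →
      s'.v .off = s.v .off → s'.v .x = s.v .off + Nat.ofDigits P.B X → e.Ok M L s' ∧
      e.eval s' = (X.filter fun a => a / 2 ^ p % 2 = v).length ∧
      s'.a tab (s'.v .x) = Nat.ofDigits P.B (X.filter fun a => a / 2 ^ p % 2 = v)) :
    Runs M L (splitLoop tab e) s fun s' t => t ≤ 150 * P.nw + 30 ∧
      Stream P nb (E ++ l.filter fun a => a / 2 ^ p % 2 = v) s' ∧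
      ∀ i < nb, s'.a .ww i = s.a .ww i := by
  have hM := h.le_M
  have hm2 := h.two_le_m
  have hlL := h.le_L
  have hgm := h.g_le
  have hnwg := h.nwg
  unfold splitLoop
  refine runs_for (fun k s' T => T ≤ 150 * k ∧
      Stream P nb (E ++ (l.take (k * P.g)).filter fun a => a / 2 ^ p % 2 = v) s' ∧
      ∀ i < nb, s'.a .ww i = s.a .ww i) ?_ ?_ ?_ ?_
  · simp
  · simpa using hE
  · rintro k s1 T hk hF ⟨hT, hS, hI⟩
    rw [Ex.eval_var, hs.nw] at hk
    have c1 := (hs.frame hF (by simp [emit, Cmd.vars, parVars]))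
    have e1 : s1.v .nb = s.v .nb := hF.v _ (by simp [emit, Cmd.vars])
    have e2 : s1.v .off = s.v .off := hF.v _ (by simp [emit, Cmd.vars])
    have e3 : s1.v .base = s.v .base := hF.v _ (by simp [emit, Cmd.vars])
    have a1 : ∀ a, a ≠ .ww → s1.a a = s.a a := fun a ha => hF.a _ (by simp [emit, Cmd.arrs, ha])
    have t1 : Tabs P s1 := ht.congr (a1 _ (by decide)) (a1 _ (by decide)) (a1 _ (by decide))
      (a1 _ (by decide))
    have hlen := chunk_length hl hk
    set X := (l.drop (k * P.g)).take P.g with hXd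
    have hdc : ∀ a ∈ X, a < P.B := fun a ha =>
      hd a (List.mem_of_mem_drop (List.mem_of_mem_take ha))
    have hlt := Nat.ofDigits_lt_base_pow_length h.two_le_B hdc
    rw [hlen, ← P.tw_eq] at hlt
    have hwk : s1.a .ww (s.v .base + k) = Nat.ofDigits P.B X := by
      rw [hI _ (by omega), hw k hk]
    set s2 := (s1.setv .k k).setv .x (s.v .off + Nat.ofDigits P.B X) with hs2
    have c2 : Ctx P s2 := (c1.setv _ (by decide)).setv _ (by decide)
    obtain ⟨x1, x2, x3⟩ := hX X hlen hdc s2 c2 (t1.congr rfl rfl rfl rfl) (by simp [hs2, e2])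
      (by simp [hs2])
    have x4 : s2.a tab (s.v .off + Nat.ofDigits P.B X) =
      Nat.ofDigits P.B (X.filter fun a => a / 2 ^ p % 2 = v) := by rw [← x3]; simp [hs2]
    have x5 : s1.a tab = s2.a tab := by simp [hs2]
    have hXl := List.length_filter_le (fun a => decide (a / 2 ^ p % 2 = v)) X
    have key : (E ++ (l.take ((k + 1) * P.g)).filter fun a => a / 2 ^ p % 2 = v) =
        (E ++ (l.take (k * P.g)).filter fun a => a / 2 ^ p % 2 = v) ++
          X.filter fun a => a / 2 ^ p % 2 = v := by
      rw [take_succ_mul, List.filter_append, List.append_assoc]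
    have hsub : List.Sublist ((l.take ((k + 1) * P.g)).filter fun a => decide (a / 2 ^ p % 2 = v))
        (l.filter fun a => decide (a / 2 ^ p % 2 = v)) := (List.take_sublist _ _).filter _
    have hemit := runs_emit h
      (s := (s2.setv .cnt (X.filter fun a => a / 2 ^ p % 2 = v).length).setv .e
        (Nat.ofDigits P.B (X.filter fun a => a / 2 ^ p % 2 = v)))
      ((c2.setv _ (by decide)).setv _ (by decide)) (nb := nb)
      (E := E ++ (l.take (k * P.g)).filter fun a => a / 2 ^ p % 2 = v)
      (X := X.filter fun a => a / 2 ^ p % 2 = v)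
      ⟨by simpa [hs2] using hS.len, by simpa [hs2] using hS.fill, by simpa [hs2] using hS.buf,
        by simpa [hs2] using hS.ww⟩ (by simp [hs2, e1, hnb]) (by simp) (by simp)
      (by omega)
      (by
        rw [← key]
        intro a ha
        rcases List.mem_append.1 ha with ha | ha
        · exact hdE a ha
        · exact hd a (List.mem_of_mem_filter (hsub.subset ha)))
      (by
        rw [← key]
        have := hsub.length_le
        simp only [List.length_append] at hEl ⊢
        omega) hL
    have hpre : s.v .off + Nat.ofDigits P.B X < L := by omega
    simp only [runs_seq, runs_set]
    simp [e2, e3, hwk]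
    rw [← hs2]
    simp [x1, x2, x5, x4, and_assoc]
    repeat refine ⟨by omega, ?_⟩
    refine hemit.mono ?_
    rintro s3 t ⟨ht3, hS3, hI3⟩
    rw [← key] at hS3
    refine ⟨by omega, hS3, fun i hi => ?_⟩
    rw [hI3 i hi]
    simpa [hs2] using hI i hi
  · rintro s1 T hF ⟨hT, hS, hI⟩
    rw [Ex.eval_var, hs.nw] at hT hS
    rw [← hl, List.take_length] at hS
    refine ⟨by simp; omega, hS, hI⟩

lemma runs_buildWave {M L : ℕ} {P : Par} (h : P.Good L M) {s : St} (hs : Ctx P s) (ht : Tabs P s)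
    {l : List ℕ} (hl : l.length = P.nw * P.g) (hd : ∀ a ∈ l, a < P.B)
    (hw : ∀ k < P.nw, s.a .ww k = Nat.ofDigits P.B ((l.drop (k * P.g)).take P.g)) :
    Runs M L buildWave s fun s' t => t ≤ 40000 * P.m ∧ Wave P l P.b s' ∧
      ∀ i < P.st, s'.a .ww i = s.a .ww i := by
  have hM := h.le_M
  have hm2 := h.two_le_m
  have hlL := h.le_L
  have hgm := h.g_le
  have hnwg := h.nwg
  have hbs := h.b_st
  have hbt := h.b_tw
  have hst : P.st = P.nw + 1 := rfl
  rw [add_mul, one_mul] at hbs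
  have hnw : 1 ≤ P.nw := Nat.succ_pos _
  unfold buildWave
  refine runs_for (fun j s' T => T ≤ 500 * (j * P.st) ∧ Wave P l j s' ∧
      ∀ i < P.st, s'.a .ww i = s.a .ww i) ?_ ?_ ?_ ?_
  · simp
  · refine ⟨by simp, ⟨fun i hi k hk => ?_, fun i hi => by omega⟩, fun _ _ => rfl⟩
    obtain rfl : i = 0 := by omega
    simpa [wmList] using hw k hk
  · rintro j s1 T hj hF ⟨hT, hW, hI⟩
    rw [Ex.eval_var, hs.b] at hj
    have c1 := hs.frame hF (by decide)
    have t1 := ht.frame hF (by decide)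
    have hjs : (j + 1 + 1) * P.st ≤ (P.b + 1) * P.st := Nat.mul_le_mul_right _ (by omega)
    simp only [add_mul, one_mul] at hjs
    have hoL : (P.b - (j + 1) + 1) * P.tw ≤ P.b * P.tw := Nat.mul_le_mul_right _ (by omega)
    rw [add_mul, one_mul] at hoL
    have hbL : P.b * 1 ≤ P.b * P.tw := Nat.mul_le_mul_left _ P.tw_pos
    have hlj : (wmList P.b l j).length = P.nw * P.g := by rw [wmList_length, hl]
    have hdj : ∀ a ∈ wmList P.b l j, a < P.B := fun a ha => hd a (mem_wmList.1 ha)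
    set p := P.b - (j + 1) with hp
    set s2 := (((((((s1.setv .j j).setv .off (p * P.tw)).setv .base (j * P.st)).setv .nb
      (j * P.st + P.st)).setv .buf 0).setv .fill 0).setv .outk 0).setv .cum 0 with hs2
    have c2 : Ctx P s2 := ((((((((c1.setv _ (by decide)).setv _ (by decide)).setv _
      (by decide)).setv _ (by decide)).setv _ (by decide)).setv _ (by decide)).setv _
      (by decide)).setv _ (by decide))
    have t2 : Tabs P s2 := t1.congr rfl rfl rfl rfl
    simp only [runs_seq, runs_set]
    simp [c1.b, c1.tw, c1.st, ← hp, and_assoc]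
    repeat refine ⟨by omega, ?_⟩
    rw [← hs2]
    refine (runs_countLoop h c2 t2 hlj hdj hj (by simp [hs2, hp]) (by simp [hs2]) (by simp [hs2])
      (fun k hk => by simpa [hs2] using hW.ww j le_rfl k hk)).frame.mono ?_
    rintro s3 u3 ⟨hF3, ht3, hc3, hc3'⟩
    have c3 := c2.frame hF3 (by decide)
    have t3 := t2.frame hF3 (by decide)
    have w3 : s3.a .ww = s2.a .ww := hF3.a _ (by decide)
    have v3 : ∀ x ∈ [Var.off, .base, .nb, .buf, .fill, .outk], s3.v x = s2.v x := fun x hx =>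
      hF3.v _ (by revert x; decide)
    refine (runs_splitLoop h c3 t3 (E := []) (nb := j * P.st + P.st) (p := p) (v := 0) hlj hdj
      (by simp) (by
        rw [List.nil_append]
        exact (List.length_filter_le _ _).trans hlj.le) (by rw [v3 _ (by simp)]; simp [hs2]; omega)
      (by rw [v3 _ (by simp)]; simp [hs2]; omega) (by rw [v3 _ (by simp)]; simp [hs2])
      (by omega) ⟨by rw [v3 _ (by simp), v3 _ (by simp)]; simp [hs2],
        by rw [v3 _ (by simp)]; simpa [hs2] using P.g_pos,
        by rw [v3 _ (by simp)]; simp [hs2], by rw [v3 _ (by simp)]; simp [hs2]⟩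
      (fun k hk => by rw [v3 _ (by simp), w3]; simpa [hs2] using hW.ww j le_rfl k hk)
      (by simp) ?_).frame.mono ?_
    · intro X hXl hXd s' c' t' ho hx
      rw [v3 .off (by simp)] at hx ho
      have e1 := t'.on_ofDigits (j := p) (by omega) hXl.le hXd
      have e2 := t'.zt_ofDigits (j := p) (by omega) hXl.le hXd
      have e3 := filter_zero_length_add X p
      have hlt := Nat.ofDigits_lt_base_pow_length h.two_le_B hXd
      rw [hXl, ← P.tw_eq] at hlt
      have hx' : s'.v .x = p * P.tw + Nat.ofDigits P.B X := by rw [hx]; simp [hs2]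
      simp [hx', e1, e2, c'.g]
      omega
    rintro s4 u4 ⟨hF4, ht4, hS4, hI4⟩
    rw [List.nil_append] at hS4
    have c4 := c3.frame hF4 (by decide)
    have t4 := t3.frame hF4 (by decide)
    have v4 : ∀ x ∈ [Var.off, .base, .nb], s4.v x = s3.v x := fun x hx =>
      hF4.v _ (by revert x; decide)
    have v4' : ∀ x ∈ [Var.off, .base, .nb], s4.v x = s2.v x := fun x hx => by
      rw [v4 x hx, v3 x (by revert x; decide)]
    refine (runs_splitLoop h c4 t4 (nb := j * P.st + P.st) (p := p) (v := 1) hlj hdj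
      (fun a ha => hdj a (List.mem_of_mem_filter ha)) (by
        rw [hp]; exact (wmList_length P.b l (j + 1)).le.trans hl.le)
      (by rw [v4' _ (by simp)]; simp [hs2]; omega)
      (by rw [v4' _ (by simp)]; simp [hs2]; omega) (by rw [v4' _ (by simp)]; simp [hs2])
      (by omega) hS4
      (fun k hk => by
        rw [v4' _ (by simp), hI4 _ (by simp [hs2]; omega), w3]
        simpa [hs2] using hW.ww j le_rfl k hk)
      (by simp) ?_).frame.mono ?_
    · intro X hXl hXd s' c' t' ho hx
      rw [v4' .off (by simp)] at hx ho
      have e1 := t'.on_ofDigits (j := p) (by omega) hXl.le hXd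
      have e2 := t'.ot_ofDigits (j := p) (by omega) hXl.le hXd
      have hlt := Nat.ofDigits_lt_base_pow_length h.two_le_B hXd
      rw [hXl, ← P.tw_eq] at hlt
      have hx' : s'.v .x = p * P.tw + Nat.ofDigits P.B X := by rw [hx]; simp [hs2]
      simp [hx', e1, e2, List.countP_eq_length_filter]
      omega
    rintro s5 u5 ⟨hF5, ht5, hS5, hI5⟩
    have hww : ∀ i < j * P.st + P.st, s5.a .ww i = s1.a .ww i := fun i hi => by
      rw [hI5 i hi, hI4 i hi, w3]; simp [hs2]
    have hcc : s5.a .cc = s3.a .cc := by rw [hF5.a _ (by decide), hF4.a _ (by decide)]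
    have hij : ∀ i < j, (i + 1) * P.st ≤ j * P.st := fun i hi => Nat.mul_le_mul_right _ hi
    simp only [add_mul, one_mul] at hij
    refine ⟨by simp only [add_mul, one_mul]; omega, ⟨fun i hi k hk => ?_, fun i hi k hk => ?_⟩,
      fun i hi => by rw [hww i (by omega), hI i hi]⟩
    · rcases Nat.lt_or_eq_of_le hi with hi | rfl
      · rw [hww, hW.ww i (by omega) k hk]
        rcases Nat.lt_succ_iff_lt_or_eq.1 hi with hi | rfl
        · have := hij i hi; omega
        · omega
      · rw [add_mul, one_mul]
        have hE : wmList P.b l (j + 1) = (wmList P.b l j).filter (fun a => a / 2 ^ p % 2 = 0) ++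
          (wmList P.b l j).filter (fun a => a / 2 ^ p % 2 = 1) := rfl
        have hlen := hS5.len
        rw [← hE, wmList_length, hl] at hlen
        have hfl := hS5.fill
        have : s5.v .outk = P.nw := by
          have h1 : P.nw * P.g / P.g = P.nw := Nat.mul_div_cancel _ P.g_pos
          rw [hlen, mul_comm, Nat.mul_add_div P.g_pos, Nat.div_eq_of_lt hfl] at h1
          omega
        exact hS5.ww k (by omega)
    · rw [hcc]
      rcases Nat.lt_succ_iff_lt_or_eq.1 hi with hi | rfl
      · have := hij i hi
        rw [hc3 _ (by omega)]
        simpa [hs2] using hW.cc i hi k hk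
      · exact hc3' k hk
  · rintro s1 T hF ⟨hT, hW, hI⟩
    rw [Ex.eval_var, hs.b] at hT hW
    refine ⟨by simp; omega, hW, hI⟩

/-! ### Successor queries in wavelet matrices -/

/-- The part of a list from index `l` to before index `r`. -/
def slice (E : List ℕ) (l r : ℕ) : List ℕ := (E.take r).drop l

lemma slice_length {E : List ℕ} {l r : ℕ} (hr : r ≤ E.length) : (slice E l r).length = r - l := by
  rw [slice, List.length_drop, List.length_take, min_eq_left hr]

/-- The number of entries before index `i` whose bit `p` is zero. -/
def zeros (p : ℕ) (E : List ℕ) (i : ℕ) : ℕ :=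
  ((E.take i).filter fun a => a / 2 ^ p % 2 = 0).length

/-- The stable sort by bit `p`. -/
def bitSort (p : ℕ) (E : List ℕ) : List ℕ :=
  E.filter (fun a => a / 2 ^ p % 2 = 0) ++ E.filter fun a => a / 2 ^ p % 2 = 1

lemma take_filter (f : ℕ → Bool) (E : List ℕ) (r : ℕ) :
    (E.filter f).take ((E.take r).filter f).length = (E.take r).filter f := by
  conv_lhs => rw [← List.take_append_drop r E, List.filter_append]
  rw [List.take_append_drop, List.take_left']
  rfl

lemma slice_filter (f : ℕ → Bool) {E : List ℕ} {l r : ℕ} (hlr : l ≤ r) :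
    slice (E.filter f) ((E.take l).filter f).length ((E.take r).filter f).length =
      (slice E l r).filter f := by
  rw [slice, take_filter, slice]
  have : E.take r = E.take l ++ (E.take r).drop l := by
    conv_lhs => rw [← List.take_append_drop l (E.take r), List.take_take, min_eq_left hlr]
  conv_lhs => rw [this, List.filter_append]
  rw [List.drop_left']
  rfl

lemma zeros_le {p : ℕ} {E : List ℕ} {i : ℕ} : zeros p E i ≤ i :=
  (List.length_filter_le _ _).trans (List.length_take_le _ _)

lemma zeros_mono {p : ℕ} {E : List ℕ} {l r : ℕ} (h : l ≤ r) :
    zeros p E l ≤ zeros p E r ∧ zeros p E r + l ≤ zeros p E l + r := by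
  unfold zeros
  obtain ⟨k, rfl⟩ := Nat.exists_eq_add_of_le h
  rw [List.take_add, List.filter_append, List.length_append]
  have := (List.length_filter_le (fun a => decide (a / 2 ^ p % 2 = 0)) ((E.drop l).take k)).trans
    (List.length_take_le _ _)
  omega

lemma zeros_total {p : ℕ} {E : List ℕ} {i : ℕ} :
    zeros p E i ≤ (E.filter fun a => a / 2 ^ p % 2 = 0).length := by
  have h1 : List.Sublist ((E.take i).filter fun a => decide (a / 2 ^ p % 2 = 0))
    (E.filter fun a => decide (a / 2 ^ p % 2 = 0)) := (List.take_sublist _ _).filter _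
  exact h1.length_le

lemma ones_eq {p : ℕ} {E : List ℕ} {i : ℕ} (hi : i ≤ E.length) :
    ((E.take i).filter fun a => a / 2 ^ p % 2 = 1).length = i - zeros p E i := by
  have h1 := filter_zero_length_add (E.take i) p
  rw [List.countP_eq_length_filter, List.length_take, min_eq_left hi] at h1
  unfold zeros; omega

lemma bitSort_length {p : ℕ} {E : List ℕ} : (bitSort p E).length = E.length := by
  have h1 := filter_zero_length_add E p
  rw [List.countP_eq_length_filter] at h1
  rw [bitSort, List.length_append]; omega

/-- The entries of a slice with bit zero form a slice of the sorted list. -/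
lemma slice_zeros {p : ℕ} {E : List ℕ} {l r : ℕ} (hlr : l ≤ r) :
    slice (bitSort p E) (zeros p E l) (zeros p E r) =
      (slice E l r).filter fun a => a / 2 ^ p % 2 = 0 := by
  rw [← slice_filter _ hlr, bitSort, slice, List.take_append_of_le_length zeros_total]
  rfl

/-- The entries of a slice with bit one form a slice of the sorted list. -/
lemma slice_ones {p : ℕ} {E : List ℕ} {l r : ℕ} (hlr : l ≤ r) (hr : r ≤ E.length) :
    slice (bitSort p E) (zeros p E E.length + (l - zeros p E l))
      (zeros p E E.length + (r - zeros p E r)) =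
      (slice E l r).filter fun a => a / 2 ^ p % 2 = 1 := by
  rw [← slice_filter _ hlr, ones_eq hr, ones_eq (hlr.trans hr), bitSort, slice, slice]
  have : zeros p E E.length = (E.filter fun a => a / 2 ^ p % 2 = 0).length := by
    rw [zeros, List.take_length]
  rw [this, List.take_length_add_append, List.drop_length_add_append]

/-- The state of the search for the least entry of the list `O` that exceeds `d`. The current list
`E` of a wavelet matrix is sorted by all bits from `q` on; its slice from `l` to `r` holds the
entries of `O` that agree with `d` in these bits, and the slice from `cl` to `cr` those that have
there the least possible value `cy` above that of `d`. -/
structure Search (q N : ℕ) (E O : List ℕ) (d l r cl cr cy : ℕ) : Prop where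
  hlr : l ≤ r
  hr : r ≤ E.length
  main : slice E l r = O.filter fun a => a / 2 ^ q = d / 2 ^ q
  hcl : cl ≤ cr
  hcr : cr ≤ E.length
  cand : cl < cr → d / 2 ^ q < cy ∧ slice E cl cr = O.filter fun a => a / 2 ^ q = cy
  least : ∀ a ∈ O, d / 2 ^ q < a / 2 ^ q → cl < cr ∧ cy ≤ a / 2 ^ q
  cy_lt : cy < N

lemma div_pow_succ (a q : ℕ) : a / 2 ^ (q + 1) = a / 2 ^ q / 2 := by
  rw [Nat.div_div_eq_div_mul, pow_succ]

lemma slice_zeros_of {q y l r : ℕ} {E O : List ℕ} (hlr : l ≤ r)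
    (h : slice E l r = O.filter fun a => a / 2 ^ (q + 1) = y) :
    slice (bitSort q E) (zeros q E l) (zeros q E r) = O.filter fun a => a / 2 ^ q = 2 * y := by
  rw [slice_zeros hlr, h, List.filter_filter]
  refine List.filter_congr fun a _ => ?_
  rw [div_pow_succ, ← Bool.decide_and]
  congr 1
  simp only [eq_iff_iff]
  omega

lemma slice_ones_of {q y l r : ℕ} {E O : List ℕ} (hlr : l ≤ r) (hr : r ≤ E.length)
    (h : slice E l r = O.filter fun a => a / 2 ^ (q + 1) = y) :
    slice (bitSort q E) (zeros q E E.length + (l - zeros q E l))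
      (zeros q E E.length + (r - zeros q E r)) = O.filter fun a => a / 2 ^ q = 2 * y + 1 := by
  rw [slice_ones hlr hr, h, List.filter_filter]
  refine List.filter_congr fun a _ => ?_
  rw [div_pow_succ, ← Bool.decide_and]
  congr 1
  simp only [eq_iff_iff]
  omega

lemma ones_le {q : ℕ} {E : List ℕ} {r : ℕ} (hr : r ≤ E.length) :
    zeros q E E.length + (r - zeros q E r) ≤ E.length := by
  have h1 := zeros_mono (p := q) (E := E) hr
  have := zeros_le (p := q) (E := E) (i := r)
  have := zeros_le (p := q) (E := E) (i := E.length)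
  omega

/-- How the candidate range changes on the next level if no entry branches off the path to `d`. -/
lemma Search.descend {q N d l r cl cr cy : ℕ} {E O : List ℕ}
    (h : Search (q + 1) N E O d l r cl cr cy)
    (hO : ∀ a ∈ O, d / 2 ^ q < a / 2 ^ q → d / 2 ^ (q + 1) < a / 2 ^ (q + 1)) {l' r' : ℕ}
    (hlr : l' ≤ r') (hr : r' ≤ E.length)
    (hmain : slice (bitSort q E) l' r' = O.filter fun a => a / 2 ^ q = d / 2 ^ q) :
    (zeros q E cl < zeros q E cr → Search q (2 * N) (bitSort q E) O d l' r' (zeros q E cl)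
      (zeros q E cr) (2 * cy)) ∧
    (zeros q E cr ≤ zeros q E cl → Search q (2 * N) (bitSort q E) O d l' r'
      (zeros q E E.length + (cl - zeros q E cl)) (zeros q E E.length + (cr - zeros q E cr))
      (2 * cy + 1)) := by
  have hN := h.cy_lt
  have z1 := zeros_mono (p := q) (E := E) h.hcl
  have z2 := zeros_le (p := q) (E := E) (i := cl)
  have z3 := zeros_le (p := q) (E := E) (i := cr)
  have e1 : ∀ a : ℕ, a / 2 ^ (q + 1) = a / 2 ^ q / 2 := fun a => div_pow_succ a q
  refine ⟨fun hlt => ?_, fun hle => ?_⟩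
  · refine ⟨hlr, by rwa [bitSort_length], hmain, hlt.le, ?_, fun _ => ?_, fun a ha hda => ?_,
      by omega⟩
    · rw [bitSort_length]; exact z3.trans h.hcr
    · obtain ⟨h1, h2⟩ := h.cand (by omega)
      refine ⟨?_, slice_zeros_of h.hcl h2⟩
      rw [e1] at h1; omega
    · have := (h.least a ha (hO a ha hda)).2
      rw [e1] at this
      exact ⟨hlt, by omega⟩
  · refine ⟨hlr, by rwa [bitSort_length], hmain, by omega, ?_, fun hlt => ?_, fun a ha hda => ?_,
      by omega⟩
    · rw [bitSort_length]; exact ones_le h.hcr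
    · obtain ⟨h1, h2⟩ := h.cand (by omega)
      refine ⟨?_, slice_ones_of h.hcl h.hcr h2⟩
      rw [e1] at h1; omega
    · obtain ⟨h1, h2⟩ := h.least a ha (hO a ha hda)
      refine ⟨by omega, ?_⟩
      rw [e1] at h2
      have h3 := congrArg List.length (slice_zeros_of h.hcl (h.cand h1).2)
      rw [slice_length (by rw [bitSort_length]; exact z3.trans h.hcr), Nat.sub_eq_zero_of_le hle]
        at h3
      have h4 : a / 2 ^ q ≠ 2 * cy := fun h4 => by
        have hmem : a ∈ O.filter fun a => a / 2 ^ q = 2 * cy := by simp [ha, h4]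
        have := List.length_pos_of_mem hmem
        omega
      omega

/-- A new candidate range arises where an entry branches off the path to `d`. -/
lemma Search.branch {q N d l r cl cr cy : ℕ} {E O : List ℕ}
    (h : Search (q + 1) N E O d l r cl cr cy) (hd : d / 2 ^ q % 2 = 0) (hdN : d / 2 ^ q + 1 < 2 * N)
    (hlt : l - zeros q E l < r - zeros q E r) :
    Search q (2 * N) (bitSort q E) O d (zeros q E l) (zeros q E r)
      (zeros q E E.length + (l - zeros q E l)) (zeros q E E.length + (r - zeros q E r))
      (d / 2 ^ q + 1) := by
  have e1 : ∀ a : ℕ, a / 2 ^ (q + 1) = a / 2 ^ q / 2 := fun a => div_pow_succ a q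
  have hm := slice_zeros_of h.hlr h.main
  have hm1 := slice_ones_of h.hlr h.hr h.main
  rw [e1, show 2 * (d / 2 ^ q / 2) = d / 2 ^ q by omega] at hm hm1
  refine ⟨(zeros_mono h.hlr).1, by rw [bitSort_length]; exact zeros_le.trans h.hr, hm, by omega, ?_,
    fun _ => ⟨by omega, hm1⟩, fun a _ hda => ⟨by omega, hda⟩, hdN⟩
  rw [bitSort_length]; exact ones_le h.hr

/-- The path to `d` turns to bit zero and no entry branches off. -/
lemma Search.no_branch {q N d l r cl cr cy : ℕ} {E O : List ℕ}
    (h : Search (q + 1) N E O d l r cl cr cy) (hd : d / 2 ^ q % 2 = 0)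
    (hle : r - zeros q E r ≤ l - zeros q E l) :
    ∀ a ∈ O, d / 2 ^ q < a / 2 ^ q → d / 2 ^ (q + 1) < a / 2 ^ (q + 1) := by
  intro a ha hda
  have e1 : ∀ a : ℕ, a / 2 ^ (q + 1) = a / 2 ^ q / 2 := fun a => div_pow_succ a q
  have hm1 := congrArg List.length (slice_ones_of h.hlr h.hr h.main)
  rw [slice_length (by rw [bitSort_length]; exact ones_le h.hr), Nat.sub_eq_zero_of_le (by omega),
    e1] at hm1
  rw [e1, e1]
  have h4 : a / 2 ^ q ≠ 2 * (d / 2 ^ q / 2) + 1 := fun h4 => by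
    have hmem : a ∈ O.filter fun a => a / 2 ^ q = 2 * (d / 2 ^ q / 2) + 1 := by simp [ha, h4]
    have := List.length_pos_of_mem hmem
    omega
  omega

/-- The number of digits with bit zero before the index `i` on the current level. -/
def rank (i o : Var) : Cmd :=
  .t ::= i >>: Var.gm ;;
  .u ::= Ex.low i Var.gm ;;
  .x ::= Var.u - .get .on (Var.off + Ex.low (.get .ww (Var.base + Var.t)) (Var.b * Var.u)) ;;
  o ::= .get .cc (Var.base + Var.t) + Var.x

/-- Following the candidate range to the next level. -/
def descend : Cmd :=
  .iflt Var.cl0 Var.cr0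
    (.cy ::= 2 * Var.cy ;; .cl ::= Var.cl0 ;; .cr ::= Var.cr0)
    (.cy ::= 2 * Var.cy + 1 ;; .cl ::= Var.z + (Var.cl - Var.cl0) ;;
      .cr ::= Var.z + (Var.cr - Var.cr0))

/-- The least digit above `d` among those with indices from `l` to before `r`, if there is one. The
search goes down the levels. It follows the range of the digits that agree with `d` in the bits seen
so far, and the range of the candidates: the digits with the least possible prefix above that of
`d`. -/
def waveQuery : Cmd :=
  .cl ::= 0 ;; .cr ::= 0 ;; .cy ::= 0 ;;
  .for_ .j Var.b (
    .base ::= Var.j * Var.st ;;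
    .off ::= (Var.b - (Var.j + 1)) * Var.tw ;;
    .z ::= .get .cc (Var.base + Var.nw) ;;
    rank .l .l0 ;; rank .r .r0 ;; rank .cl .cl0 ;; rank .cr .cr0 ;;
    .y ::= Var.d >>: (Var.b - (Var.j + 1)) ;;
    .iflt (Ex.low Var.y 1) 1
      (.iflt (Var.l - Var.l0) (Var.r - Var.r0)
        (.cy ::= Var.y + 1 ;; .cl ::= Var.z + (Var.l - Var.l0) ;; .cr ::= Var.z + (Var.r - Var.r0))
        descend ;;
        .l ::= Var.l0 ;; .r ::= Var.r0)
      (descend ;; .l ::= Var.z + (Var.l - Var.l0) ;; .r ::= Var.z + (Var.r - Var.r0)))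

lemma runs_rank {M L : ℕ} {P : Par} (h : P.Good L M) {s : St} (hs : Ctx P s) (ht : Tabs P s)
    {l : List ℕ} {j i : ℕ} {iv o : Var} (hl : l.length = P.nw * P.g) (hd : ∀ a ∈ l, a < P.B)
    (hj : j < P.b) (hW : Wave P l P.b s)
    (hoff : s.v .off = (P.b - (j + 1)) * P.tw) (hbase : s.v .base = j * P.st)
    (hiv : iv ≠ .t ∧ iv ≠ .u) (hi : s.v iv = i) (hi' : i ≤ l.length) :
    Runs M L (rank iv o) s fun s' t => t ≤ 70 ∧
      s'.v o = zeros (P.b - (j + 1)) (wmList P.b l j) i := by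
  have hM := h.le_M
  have hm2 := h.two_le_m
  have hlL := h.le_L
  have hgm := h.g_le
  have hnwg := h.nwg
  have hbs := h.b_st
  have hbt := h.b_tw
  have hg0 := P.g_pos
  have hB := h.two_le_B
  have htL := h.tw_le_L
  have hst : P.st = P.nw + 1 := rfl
  have hjs : (j + 1) * P.st ≤ (P.b + 1) * P.st := Nat.mul_le_mul_right _ (by omega)
  rw [add_mul, one_mul] at hjs
  have hoL : (P.b - (j + 1) + 1) * P.tw ≤ P.b * P.tw := Nat.mul_le_mul_right _ (by omega)
  rw [add_mul, one_mul] at hoL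
  have hgp : 2 ^ P.gm = P.g := rfl
  have hbm : ∀ i, 2 ^ (P.b * i) = P.B ^ i := fun i => by rw [Par.B, ← pow_mul]
  set E := wmList P.b l j with hE
  have hEl : E.length = P.nw * P.g := by rw [hE, wmList_length, hl]
  have hEd : ∀ a ∈ E, a < P.B := fun a ha => hd a (mem_wmList.1 ha)
  set p := P.b - (j + 1) with hp
  set k := i / P.g with hk
  set u := i % P.g with hu
  have hi0 : k * P.g + u = i := by rw [mul_comm]; exact Nat.div_add_mod i P.g
  have hug : u < P.g := Nat.mod_lt _ hg0
  have hkn : k ≤ P.nw := Nat.div_le_of_le_mul (by rw [mul_comm]; omega)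
  set X := (E.drop (k * P.g)).take u with hX
  have hXd : ∀ a ∈ X, a < P.B := fun a ha =>
    hEd a (List.mem_of_mem_drop (List.mem_of_mem_take ha))
  have hXl : X.length = u := by
    rw [hX, List.length_take, List.length_drop]; omega
  have hlow : s.a .ww (j * P.st + k) % P.B ^ u = Nat.ofDigits P.B X := by
    rcases hkn.lt_or_eq with hlt | heq
    · rw [hW.ww j hj.le k hlt, Nat.ofDigits_mod_pow_eq_ofDigits_take _ (by omega), List.take_take,
        min_eq_left hug.le]
      exact fun a ha => hEd a (List.mem_of_mem_drop (List.mem_of_mem_take ha))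
    · have : u = 0 := by rw [heq] at hi0; omega
      rw [hX, this]; simp [Nat.mod_one]
  have hon := ht.on_ofDigits (j := p) (by omega) (hXl.le.trans hug.le) hXd
  have hXlt := Nat.ofDigits_lt_base_pow_length hB hXd
  rw [hXl] at hXlt
  have hpu : P.B ^ u ≤ P.tw := by rw [P.tw_eq]; exact Nat.pow_le_pow_right P.B_pos hug.le
  have hbu : P.b * u < P.B ^ u := by rw [← hbm]; exact Nat.lt_two_pow_self
  have hsum := filter_zero_length_add X p
  rw [List.countP_eq_length_filter] at hsum hon
  have hcc := hW.cc j hj k hkn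
  have hz : zeros p E i = ((E.take (k * P.g)).filter fun a => a / 2 ^ p % 2 = 0).length +
      (X.filter fun a => a / 2 ^ p % 2 = 0).length := by
    rw [zeros, ← hi0, List.take_add, List.filter_append, List.length_append]
  have hzi := zeros_le (p := p) (E := E) (i := i)
  rw [← hE, ← hp] at hcc
  unfold rank
  simp [hiv.1, hi, hs.gm, hgp, ← hk, ← hu, hs.b, hbase, hoff, hbm, hlow, hon, hcc, and_assoc]
  repeat refine ⟨by omega, ?_⟩
  omega

lemma runs_descend {M L : ℕ} {s : St} (hM : 8 ≤ M) (h1 : 2 * s.v .cy + 1 < M)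
    (h2 : s.v .z + s.v .cl < M) (h3 : s.v .z + s.v .cr < M) (h4 : s.v .cl0 ≤ s.v .cl)
    (h5 : s.v .cr0 ≤ s.v .cr) : Runs M L descend s fun s' t => t ≤ 40 ∧
      (s.v .cl0 < s.v .cr0 ∧ s'.v .cy = 2 * s.v .cy ∧ s'.v .cl = s.v .cl0 ∧
        s'.v .cr = s.v .cr0 ∨
      s.v .cr0 ≤ s.v .cl0 ∧ s'.v .cy = 2 * s.v .cy + 1 ∧
        s'.v .cl = s.v .z + (s.v .cl - s.v .cl0) ∧
        s'.v .cr = s.v .z + (s.v .cr - s.v .cr0)) := by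
  unfold descend
  simp [runs_iflt, and_assoc]
  refine ⟨fun h => ?_, fun h => ?_⟩
  · simp [h]; omega
  · simp [h]; omega

/-- The search takes constant time on each of the `b` levels. -/
lemma runs_waveQuery {M L : ℕ} {P : Par} (h : P.Good L M) {s : St} (hs : Ctx P s) (ht : Tabs P s)
    {l : List ℕ} (hl : l.length = P.nw * P.g) (hd : ∀ a ∈ l, a < P.B) (hW : Wave P l P.b s)
    {lo hi d : ℕ} (hlo : s.v .l = lo) (hhi : s.v .r = hi) (hlh : lo ≤ hi) (hh : hi ≤ l.length)
    (hdv : s.v .d = d) (hdB : d < P.B) (hex : ∃ a ∈ slice l lo hi, d < a) :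
    Runs M L waveQuery s fun s' t => t ≤ 600 * P.b + 10 ∧ s'.v .cy ∈ slice l lo hi ∧
      d < s'.v .cy ∧ ∀ a ∈ slice l lo hi, d < a → s'.v .cy ≤ a := by
  have hM := h.le_M
  have hm2 := h.two_le_m
  have hlL := h.le_L
  have hgm := h.g_le
  have hnwg := h.nwg
  have hbs := h.b_st
  have hbt := h.b_tw
  have hg0 := P.g_pos
  have hB := h.two_le_B
  have hBt := h.B_le
  have htL := h.tw_le_L
  have hst : P.st = P.nw + 1 := rfl
  have hbL : P.b * 1 ≤ P.b * P.tw := Nat.mul_le_mul_left _ P.tw_pos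
  rw [add_mul, one_mul] at hbs
  unfold waveQuery
  simp only [runs_seq, runs_set, Ex.eval_ofNat]
  refine ⟨by simp; omega, by simp; omega, by simp; omega, ?_⟩
  refine runs_for (fun j s' T => T ≤ 600 * j ∧ Search (P.b - j) (2 ^ j) (wmList P.b l j)
    (slice l lo hi) d (s'.v .l) (s'.v .r) (s'.v .cl) (s'.v .cr) (s'.v .cy)) ?_ ?_ ?_ ?_
  · simp
  · have small : ∀ a < P.B, a / 2 ^ P.b = 0 := fun a ha => Nat.div_eq_of_lt ha
    have hmem : ∀ a ∈ slice l lo hi, a < P.B := fun a ha =>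
      hd a (List.mem_of_mem_take (List.mem_of_mem_drop ha))
    refine ⟨by simp, ⟨by simpa [hlo, hhi], by simpa [hhi, wmList], ?_, by simp, by simp, by simp,
      fun a ha hda => ?_, by simp⟩⟩
    · simp only [wmList, hlo, hhi, St.setv_v]
      symm
      rw [if_neg (by decide), if_neg (by decide), if_neg (by decide), if_neg (by decide),
        if_neg (by decide), if_neg (by decide)]
      exact List.filter_eq_self.2 fun a ha => by simp [small a (hmem a ha), small d hdB]
    · simp [small a (hmem a ha), small d hdB] at hda
  · rintro j s1 T hj hF ⟨hT, hS⟩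
    have hj : j < P.b := by simpa [hs.b] using hj
    have c0 : Ctx P ((((s.setv .cl 0).setv .cr 0).setv .cy 0)) := ((hs.setv _ (by decide)).setv _
      (by decide)).setv _ (by decide)
    have c1 := c0.frame hF (by decide)
    have a1 : s1.a = s.a := by ext a; rw [hF.a a (by simp [rank, descend, Cmd.arrs])]; rfl
    have d1 : s1.v .d = d := by rw [hF.v _ (by decide)]; simpa using hdv
    have hjs : (j + 1 + 1) * P.st ≤ (P.b + 1) * P.st := Nat.mul_le_mul_right _ (by omega)
    simp only [add_mul, one_mul] at hjs
    have hoL : (P.b - (j + 1) + 1) * P.tw ≤ P.b * P.tw := Nat.mul_le_mul_right _ (by omega)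
    rw [add_mul, one_mul] at hoL
    set E := wmList P.b l j with hE
    have hEl : E.length = P.nw * P.g := by rw [hE, wmList_length, hl]
    have hE' : wmList P.b l (j + 1) = bitSort (P.b - (j + 1)) E := rfl
    set p := P.b - (j + 1) with hp
    rw [show P.b - j = p + 1 by omega] at hS
    rw [hE', pow_succ, mul_comm (2 ^ j)]
    have hz : s.a .cc (j * P.st + P.nw) = zeros p E E.length := by
      rw [hW.cc j hj _ le_rfl, zeros, ← hE, hEl]
    have hpj : 2 * 2 ^ j ≤ P.B := by
      rw [← pow_succ']; exact Nat.pow_le_pow_right (by norm_num) hj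
    have hdp : d / 2 ^ p < 2 * 2 ^ j := by
      rw [← pow_succ', Nat.div_lt_iff_lt_mul (by positivity), ← pow_add]
      rwa [show j + 1 + p = P.b by omega]
    have e1 : ∀ a : ℕ, a / 2 ^ (p + 1) = a / 2 ^ p / 2 := fun a => div_pow_succ a p
    obtain ⟨l1, hl1⟩ : ∃ k, k = s1.v .l := ⟨_, rfl⟩
    obtain ⟨r1, hr1⟩ : ∃ k, k = s1.v .r := ⟨_, rfl⟩
    obtain ⟨cl1, hcl1⟩ : ∃ k, k = s1.v .cl := ⟨_, rfl⟩
    obtain ⟨cr1, hcr1⟩ : ∃ k, k = s1.v .cr := ⟨_, rfl⟩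
    obtain ⟨cy1, hcy1⟩ : ∃ k, k = s1.v .cy := ⟨_, rfl⟩
    rw [← hl1, ← hr1, ← hcl1, ← hcr1, ← hcy1] at hS
    have hlr := hS.hlr
    have hr := hS.hr
    have hcl := hS.hcl
    have hcr := hS.hcr
    have hcy := hS.cy_lt
    set s2 := (((s1.setv .j j).setv .base (j * P.st)).setv .off (p * P.tw)).setv .z
      (zeros p E E.length) with hs2
    have c2 : Ctx P s2 := (((c1.setv _ (by decide)).setv _ (by decide)).setv _ (by decide)).setv _
      (by decide)
    have rk : ∀ (iv o : Var) (i : ℕ) (s' : St), Frame [.t, .u, .x, .l0, .r0, .cl0, .cr0] [] s2 s' →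
        iv ∉ [Var.t, .u, .x, .l0, .r0, .cl0, .cr0] → s2.v iv = i → i ≤ E.length →
        Runs M L (rank iv o) s' fun s'' t => Frame (rank iv o).vars (rank iv o).arrs s' s'' ∧
          t ≤ 70 ∧ s''.v o = zeros p E i := by
      intro iv o i s' F' hiv hi hil
      have a' : s'.a = s.a := by ext a; rw [F'.a a (by simp)]; simp [hs2, a1]
      refine (runs_rank h (c2.frame F' (by decide)) (ht.congr (by rw [a']) (by rw [a']) (by rw [a'])
        (by rw [a'])) hl hd hj ⟨by rw [a']; exact hW.ww, by rw [a']; exact hW.cc⟩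
        (by rw [F'.v _ (by decide)]; simp [hs2, hp]) (by rw [F'.v _ (by decide)]; simp [hs2]) ?_
        (by rw [F'.v _ hiv, hi]) (by rwa [hEl, ← hl] at hil)).frame
      simp only [List.mem_cons, not_or] at hiv
      exact ⟨hiv.1, hiv.2.1⟩
    simp only [runs_seq, runs_set]
    simp [c1.b, c1.tw, c1.st, c1.nw, ← hp, a1, hz, and_assoc]
    repeat refine ⟨by omega, ?_⟩
    rw [← hs2]
    refine (rk .l .l0 l1 s2 Frame.rfl' (by decide) (by simp [hs2, hl1]) (by omega)).mono ?_
    rintro s3 u3 ⟨F3, ht3, hr3⟩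
    have G3 := F3.mono (vs' := [.t, .u, .x, .l0, .r0, .cl0, .cr0]) (as' := [])
      (by decide) (by decide)
    refine (rk .r .r0 r1 s3 G3 (by decide) (by simp [hs2, hr1]) (by omega)).mono ?_
    rintro s4 u4 ⟨F4, ht4, hr4⟩
    have G4 := G3.trans (F4.mono (by decide) (by decide))
    refine (rk .cl .cl0 cl1 s4 G4 (by decide) (by simp [hs2, hcl1]) (by omega)).mono ?_
    rintro s5 u5 ⟨F5, ht5, hr5⟩
    have G5 := G4.trans (F5.mono (by decide) (by decide))
    refine (rk .cr .cr0 cr1 s5 G5 (by decide) (by simp [hs2, hcr1]) (by omega)).mono ?_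
    rintro s6 u6 ⟨F6, ht6, hr6⟩
    have G6 := G5.trans (F6.mono (by decide) (by decide))
    have k1 : s6.v .l0 = zeros p E l1 := by
      rw [F6.v _ (by decide), F5.v _ (by decide), F4.v _ (by decide), hr3]
    have k2 : s6.v .r0 = zeros p E r1 := by rw [F6.v _ (by decide), F5.v _ (by decide), hr4]
    have k3 : s6.v .cl0 = zeros p E cl1 := by rw [F6.v _ (by decide), hr5]
    have k5 : s6.v .z = zeros p E E.length := by rw [G6.v _ (by decide)]; simp [hs2]
    have k6 : s6.v .l = l1 := by rw [G6.v _ (by decide)]; simp [hs2, hl1]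
    have k7 : s6.v .r = r1 := by rw [G6.v _ (by decide)]; simp [hs2, hr1]
    have k8 : s6.v .cl = cl1 := by rw [G6.v _ (by decide)]; simp [hs2, hcl1]
    have k9 : s6.v .cr = cr1 := by rw [G6.v _ (by decide)]; simp [hs2, hcr1]
    have k10 : s6.v .cy = cy1 := by rw [G6.v _ (by decide)]; simp [hs2, hcy1]
    have k11 : s6.v .j = j := by rw [G6.v _ (by decide)]; simp [hs2]
    have k12 : s6.v .d = d := by rw [G6.v _ (by decide)]; simp [hs2, d1]
    have k13 : s6.v .b = P.b := (c2.frame G6 (by decide)).b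
    have z1 := zeros_le (p := p) (E := E) (i := l1)
    have z2 := zeros_le (p := p) (E := E) (i := r1)
    have z3 := zeros_le (p := p) (E := E) (i := cl1)
    have z4 := zeros_le (p := p) (E := E) (i := cr1)
    have z5 := zeros_le (p := p) (E := E) (i := E.length)
    have z6 := zeros_mono (p := p) (E := E) hlr
    have hM8 : 2 ^ 6 ≤ M := by omega
    simp [runs_iflt, k1, k2, k6, k7, k11, k12, k13, ← hp, and_assoc]
    repeat refine ⟨by omega, ?_⟩
    refine ⟨fun hd0 => ⟨by omega, by omega, fun hlt => ?_, fun hle => ?_⟩, fun hd1 => ?_⟩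
    · have hB := hS.branch hd0 (by omega) hlt
      have : d / 2 ^ p + 1 < M := by omega
      simp [k5]
      repeat refine ⟨by omega, ?_⟩
      exact hB
    · have hD := hS.descend (hS.no_branch hd0 (by omega)) (l' := zeros p E l1) (r' := zeros p E r1)
        (by omega) (by omega) (by
          have := slice_zeros_of hS.hlr hS.main
          rwa [e1, show 2 * (d / 2 ^ p / 2) = d / 2 ^ p by omega] at this)
      refine (runs_descend (by omega) (by simp [k10]; omega) (by simp [k5, k8]; omega)
        (by simp [k5, k9]; omega) (by simp [k3, k8]; omega) (by simp [hr6, k9]; omega)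
          ).frame.mono ?_
      rintro s7 u7 ⟨F7, ht7, h7⟩
      have f1 : s7.v .l0 = zeros p E l1 := by rw [F7.v _ (by decide)]; simp [k1]
      have f2 : s7.v .r0 = zeros p E r1 := by rw [F7.v _ (by decide)]; simp [k2]
      simp [k3, hr6, k5, k8, k9, k10] at h7
      simp [f1, f2]
      rcases h7 with ⟨g1, g2, g3, g4⟩ | ⟨g1, g2, g3, g4⟩
      · rw [g2, g3, g4]; exact ⟨by omega, hD.1 g1⟩
      · rw [g2, g3, g4]; exact ⟨by omega, hD.2 g1⟩
    · have hm := slice_ones_of hS.hlr hS.hr hS.main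
      rw [e1, show 2 * (d / 2 ^ p / 2) + 1 = d / 2 ^ p by omega] at hm
      have hz2 := ones_le (q := p) hS.hr
      have hD := hS.descend (fun a _ hda => by rw [e1, e1]; omega) (by omega) hz2 hm
      refine (runs_descend (by omega) (by simp [k10]; omega) (by simp [k5, k8]; omega)
        (by simp [k5, k9]; omega) (by simp [k3, k8]; omega) (by simp [hr6, k9]; omega)
          ).frame.mono ?_
      rintro s7 u7 ⟨F7, ht7, h7⟩
      have f1 : s7.v .l0 = zeros p E l1 := by rw [F7.v _ (by decide)]; simp [k1]
      have f2 : s7.v .r0 = zeros p E r1 := by rw [F7.v _ (by decide)]; simp [k2]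
      have f3 : s7.v .l = l1 := by rw [F7.v _ (by decide)]; simp [k6]
      have f4 : s7.v .r = r1 := by rw [F7.v _ (by decide)]; simp [k7]
      have f5 : s7.v .z = zeros p E E.length := by rw [F7.v _ (by decide)]; simp [k5]
      simp [k3, hr6, k5, k8, k9, k10] at h7
      simp [f1, f2, f3, f4, f5]
      repeat refine ⟨by omega, ?_⟩
      rcases h7 with ⟨g1, g2, g3, g4⟩ | ⟨g1, g2, g3, g4⟩
      · rw [g2, g3, g4]; exact hD.1 g1
      · rw [g2, g3, g4]; exact hD.2 g1
  · rintro s1 T hF ⟨hT, hS⟩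
    have hbv : Ex.eval (((s.setv .cl 0).setv .cr 0).setv .cy 0) (Ex.var .b) = P.b := by
      simp [hs.b]
    rw [hbv] at hT hS
    rw [Nat.sub_self] at hS
    obtain ⟨a, ha, hda⟩ := hex
    have h1 := hS.least a ha (by simpa using hda)
    obtain ⟨h2, h3⟩ := hS.cand h1.1
    have h4 := slice_length (l := s1.v .cl) hS.hcr
    obtain ⟨x, hx⟩ := List.exists_mem_of_length_pos (h4 ▸ Nat.sub_pos_of_lt h1.1)
    rw [h3] at hx
    simp at hx h2
    refine ⟨by simp; omega, hx.2 ▸ hx.1, h2, fun a ha hda => ?_⟩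
    simpa using (hS.least a ha (by simpa using hda)).2

/-! ### Sorting by prefixes and extracting digits -/

lemma lexRank_congr {key key' : ℕ → ℕ} {m i : ℕ} (h : ∀ j < m, key j = key' j) (hi : i < m) :
    lexRank key m i = lexRank key' m i := by
  rw [lexRank_eq_card hi, lexRank_eq_card hi]
  congr 1
  refine filter_congr fun j hj => ?_
  rw [h j (mem_range.1 hj), h i hi]

/-- The items that are sorted between two items with the same key. With the ends of a query for `i`
and `j`, and prefixes for keys, these are the items in the range of the query that agree with the
query in the prefix. -/
lemma lexRank_mem_Ico {key : ℕ → ℕ} {m i j e : ℕ} (hi : i < m) (hj : j < m) (he : e < m)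
    (hk : key i = key j) : lexRank key m e ∈ Ico (lexRank key m i) (lexRank key m j) ↔
      key e = key i ∧ i ≤ e ∧ e < j := by
  rw [mem_Ico, ← not_lt, lexRank_lt_iff he hi, lexRank_lt_iff he hj]
  omega

/-- Sorting the items by the bits of `ch` from `s1` on, and building the data structure for range
maximum queries on the digits from bit `s2` on in that order. The digit of a string position is the
value of `dg`, where `t` holds the digit of `ch`; other items get the digit zero. -/
def levelPrep (dg : Ex) : Cmd :=
  .for_ .x Var.m (.put .key Var.x (.get .ch Var.x >>: Var.s1)) ;;
  rankSort ;;
  .for_ .x Var.m (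
    .t ::= Ex.low (.get .ch Var.x >>: Var.s2) Var.b ;;
    .iflt (.get .re Var.x) 1 (.put .tt (.get .pos Var.x) 0) (.put .tt (.get .pos Var.x) dg)) ;;
  buildMax

/-- The items are sorted by the bits of `ch` from `S + b` on, and `f` is the sequence of the digits
from bit `S` on in that order, transformed by `G`. -/
structure Level (P : Par) (S : ℕ) (G : ℕ → ℕ) (ch re f : ℕ → ℕ) (s : St) : Prop where
  pos : ∀ e < P.m, s.a .pos e = lexRank (fun e => ch e / 2 ^ (S + P.b)) P.m e
  val : ∀ e < P.m, f (s.a .pos e) = if re e < 1 then 0 else G (ch e / 2 ^ S % P.B)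
  zero : ∀ i, P.m ≤ i → f i = 0
  lt : ∀ i, f i < P.B
  max : MaxStruct P f s

lemma runs_levelPrep {M L : ℕ} {P : Par} (h : P.Good L M) {s : St} (hs : Ctx P s)
    (ht : Tabs P s) (hl : LogTab P s) {dg : Ex} {G : ℕ → ℕ} {S : ℕ} (hS : s.v .s2 = S)
    (hS1 : s.v .s1 = S + P.b) (hch : ∀ e < P.m, s.a .ch e ≤ P.m) (hG : ∀ a < P.B, G a < P.B)
    (hdg : dg.len ≤ 20) (hdg' : ∀ s', Ctx P s' → s'.v .t < P.B → dg.Ok M L s' ∧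
      dg.eval s' = G (s'.v .t)) :
    Runs M L (levelPrep dg) s fun s' t => t ≤ 42000 * P.m ∧
      ∃ f, Level P S G (s.a .ch) (s.a .re) f s' := by
  have hm2 := h.two_le_m
  have hlL := h.le_L
  have hM := h.le_M
  have hBt := h.B_le
  have htL := h.tw_le_L
  have hB0 := P.B_pos
  have hBp : 2 ^ P.b = P.B := rfl
  unfold levelPrep
  simp only [runs_seq]
  refine runs_for (fun k s' T => T ≤ 30 * k ∧ ∀ i < k, s'.a .key i = s.a .ch i / 2 ^ (S + P.b))
    ?_ ?_ ?_ ?_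
  · simp
  · simp
  · rintro k s1 T hk hF ⟨hT, hI⟩
    rw [Ex.eval_var, hs.m] at hk
    have e1 : s1.v .s1 = S + P.b := by rw [hF.v _ (by decide), hS1]
    have e2 : s1.a .ch = s.a .ch := hF.a _ (by decide)
    simp [e1, e2]
    repeat refine ⟨by omega, ?_⟩
    intro i hi
    rw [Function.update_apply]
    split
    · rename_i h; rw [h]
    · exact hI i (by omega)
  rintro s1 T1 F1 ⟨hT1, hI1⟩
  rw [Ex.eval_var, hs.m] at hT1 hI1
  have c1 := hs.frame F1 (by decide)
  set key : ℕ → ℕ := fun e => s.a .ch e / 2 ^ (S + P.b) with hkey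
  refine (runs_rankSort c1.m (by omega) (by omega) (fun i hi => ?_)).frame.mono ?_
  · rw [hI1 i hi]
    have := Nat.div_le_self (s.a .ch i) (2 ^ (S + P.b))
    have := hch i hi
    omega
  rintro s2 T2 ⟨F2, hT2, hI2⟩
  have hpos : ∀ i < P.m, s2.a .pos i = lexRank key P.m i := fun i hi => by
    rw [hI2 i hi]; exact lexRank_congr hI1 hi
  have c2 := c1.frame F2 (by decide)
  have b1 : s2.v .s2 = S := by rw [F2.v _ (by decide), F1.v _ (by decide), hS]
  have b2 : s2.a .ch = s.a .ch := by rw [F2.a _ (by decide), F1.a _ (by decide)]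
  have b3 : s2.a .re = s.a .re := by rw [F2.a _ (by decide), F1.a _ (by decide)]
  set val : ℕ → ℕ := fun e => if s.a .re e < 1 then 0 else G (s.a .ch e / 2 ^ S % P.B) with hval
  refine runs_for (fun k s' T => T ≤ 70 * k ∧ ∀ i < k, s'.a .tt (lexRank key P.m i) = val i)
    ?_ ?_ ?_ ?_
  · simp
  · simp
  · rintro k s3 T hk F3 ⟨hT, hI⟩
    rw [Ex.eval_var, c2.m] at hk
    have d1 : s3.v .s2 = S := by rw [F3.v _ (by simp [Cmd.vars]), b1]
    have d2 : s3.a .ch = s.a .ch := by rw [F3.a _ (by simp [Cmd.arrs]), b2]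
    have d3 : s3.a .re = s.a .re := by rw [F3.a _ (by simp [Cmd.arrs]), b3]
    have d4 : s3.a .pos k = lexRank key P.m k := by
      rw [F3.a _ (by simp [Cmd.arrs]), hpos k hk]
    have c3 := c2.frame F3 (by simp [Cmd.vars, parVars])
    have hr := lexRank_lt (key := key) hk
    have hmod := Nat.mod_lt (s.a .ch k / 2 ^ S) hB0
    have c4 : Ctx P ((s3.setv .x k).setv .t (s.a .ch k / 2 ^ S % P.B)) :=
      (c3.setv _ (by decide)).setv _ (by decide)
    obtain ⟨g1, g2⟩ := hdg' _ c4 (by simpa using hmod)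
    simp at g2
    simp [runs_iflt, d1, d2, d3, d4, c3.b, hBp, g1, g2, and_assoc]
    repeat refine ⟨by omega, ?_⟩
    have upd : ∀ v, v = val k → ∀ i ≤ k, Function.update (s3.a .tt) (lexRank key P.m k) v
        (lexRank key P.m i) = val i := by
      intro v hv i hi
      rw [Function.update_apply]
      split
      · rename_i h; rw [hv, lexRank_inj (by omega) hk h]
      · refine hI i (lt_of_le_of_ne hi ?_)
        rintro rfl; contradiction
    refine ⟨fun h0 => ?_, fun h0 => ?_⟩
    · repeat refine ⟨by omega, ?_⟩
      exact fun i hi => upd 0 (by simp [hval, h0]) i (by omega)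
    · repeat refine ⟨by omega, ?_⟩
      exact fun i hi => upd _ (by simp [hval, show s.a .re k ≠ 0 by omega]) i (by omega)
  rintro s3 T3 F3 ⟨hT3, hI3⟩
  rw [Ex.eval_var, c2.m] at hT3 hI3
  have c3 := c2.frame F3 (by simp [Cmd.vars, parVars])
  have t3 : Tabs P s3 := ((ht.frame F1 (by decide)).frame F2 (by decide)).frame F3
    (by simp [Cmd.arrs])
  have l3 : LogTab P s3 := fun i hi => by
    rw [F3.a _ (by simp [Cmd.arrs]), F2.a _ (by decide), F1.a _ (by decide), hl i hi]
  have hvB : ∀ i, val i < P.B := fun i => by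
    simp only [hval]
    split
    · exact hB0
    · exact hG _ (Nat.mod_lt _ hB0)
  refine (runs_buildMax h c3 t3 l3 (f := fun i => if i < P.m then s3.a .tt i else 0)
    (fun i hi => if_neg (by omega)) (fun i => ?_) (fun k hk => (if_pos hk).symm)).frame.mono ?_
  · split
    · rename_i hi
      obtain ⟨e, he, rfl⟩ := exists_lexRank (key := key) hi
      rw [hI3 e he]; exact hvB e
    · exact hB0
  rintro s4 T4 ⟨F4, hT4, hI4⟩
  have hp4 : ∀ e < P.m, s4.a .pos e = lexRank key P.m e := fun e he => by
    rw [F4.a _ (by decide), F3.a _ (by simp [Cmd.arrs]), hpos e he]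
  refine ⟨by simp; omega, _, ⟨hp4, fun e he => ?_, fun i hi => if_neg (by omega), fun i => ?_, hI4⟩⟩
  · simp only [hp4 e he, lexRank_lt he, if_true]
    exact hI3 e he
  · split
    · rename_i hi
      obtain ⟨e, he, rfl⟩ := exists_lexRank (key := key) hi
      rw [hI3 e he]; exact hvB e
    · exact hB0

/-! ### Resolving queries digit by digit -/

/-- A batch of queries on a sequence of items. The items `e` with `1 ≤ re e` are characters with
value `c e`; the query with number `i < q` asks for the least character above `c (el i)` that is
between the items `el i` and `eh i`. -/
structure Inst where
  q : ℕ
  re : ℕ → ℕ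
  el : ℕ → ℕ
  eh : ℕ → ℕ
  c : ℕ → ℕ

/-- The item `e` is a character in the range of the query with number `i`. -/
def Inst.In (I : Inst) (i e : ℕ) : Prop := ¬ I.re e < 1 ∧ I.el i < e ∧ e < I.eh i

/-- The candidates for the answer of a query. -/
def Inst.V (I : Inst) (i : ℕ) : Set ℕ := {v | ∃ e, I.In i e ∧ I.c e = v ∧ I.c (I.el i) < v}

/-- The items and their characters are in bounds, both ends of a query carry the same character,
ends are not string positions, and all ends are different items. -/
structure Inst.Good (I : Inst) (P : Par) : Prop where
  q_le : I.q ≤ P.m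
  el_lt : ∀ i < I.q, I.el i < P.m
  eh_lt : ∀ i < I.q, I.eh i < P.m
  re_el : ∀ i < I.q, I.re (I.el i) < 1
  re_eh : ∀ i < I.q, I.re (I.eh i) < 1
  el_inj : ∀ i < I.q, ∀ j < I.q, I.el i = I.el j → i = j
  eh_inj : ∀ i < I.q, ∀ j < I.q, I.eh i = I.eh j → i = j
  el_ne : ∀ i < I.q, ∀ j < I.q, I.el i ≠ I.eh j
  c_le : ∀ e < P.m, I.c e ≤ P.m
  c_eh : ∀ i < I.q, I.c (I.eh i) = I.c (I.el i)
  c_lt : ∀ e < P.m, I.c e < 2 ^ (P.b * P.b)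

/-- The state of a query with candidates `V` and character `c`: `ρ` is what is stored in `res`, and
`x` the current value of the end items. Either no candidate agrees with `c` in the bits from `S` on;
or the answer first differs from `c` in the digit with number `ρ`, counted from the top, and `x`
consists of the first `max ρ lv` digits of the answer. -/
def QState (b : ℕ) (V : Set ℕ) (c S lv ρ x : ℕ) : Prop :=
  (ρ = 0 ∧ x = c ∧ ∀ v ∈ V, v / 2 ^ S ≠ c / 2 ^ S) ∨
  (1 ≤ ρ ∧ ρ ≤ b ∧ ∃ a, IsLeast V a ∧ c / 2 ^ (b * (b - ρ)) < a / 2 ^ (b * (b - ρ)) ∧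
    x = a / 2 ^ (b * (b - max ρ lv)) * 2 ^ (b * (b - max ρ lv)))

/-- The queries with number `i` are in a state with the parameters `S i` and `lv i`. -/
structure Prog (P : Par) (I : Inst) (S lv : ℕ → ℕ) (s : St) : Prop where
  q : s.v .q = I.q
  re : ∀ e < P.m, s.a .re e = I.re e
  el : ∀ i < I.q, s.a .el i = I.el i
  eh : ∀ i < I.q, s.a .eh i = I.eh i
  ch : ∀ e < P.m, ¬ I.re e < 1 → s.a .ch e = I.c e
  le : ∀ e < P.m, s.a .ch e ≤ P.m
  eq : ∀ i < I.q, s.a .ch (I.eh i) = s.a .ch (I.el i)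
  st : ∀ i < I.q, QState P.b (I.V i) (I.c (I.el i)) (S i) (lv i) (s.a .res i) (s.a .ch (I.el i))

lemma div_split (v S b : ℕ) : v / 2 ^ S = v / 2 ^ (S + b) * 2 ^ b + v / 2 ^ S % 2 ^ b := by
  rw [pow_add, ← Nat.div_div_eq_div_mul]
  exact (Nat.div_add_mod' _ _).symm

/-- The digits of a level in the range of a query. -/
lemma Level.mem {P : Par} {S : ℕ} {G : ℕ → ℕ} {I : Inst} (hI : I.Good P) {ch f : ℕ → ℕ} {s : St}
    (hL : Level P S G ch I.re f s) (hch : ∀ e < P.m, ¬ I.re e < 1 → ch e = I.c e)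
    {i : ℕ} (hi : i < I.q) (heq : ch (I.eh i) = ch (I.el i)) :
    (∀ p ∈ Ico (s.a .pos (I.el i)) (s.a .pos (I.eh i)), f p = 0 ∨ ∃ e, I.In i e ∧
      I.c e / 2 ^ (S + P.b) = ch (I.el i) / 2 ^ (S + P.b) ∧ f p = G (I.c e / 2 ^ S % P.B)) ∧
    ∀ e, I.In i e → I.c e / 2 ^ (S + P.b) = ch (I.el i) / 2 ^ (S + P.b) →
      ∃ p ∈ Ico (s.a .pos (I.el i)) (s.a .pos (I.eh i)), f p = G (I.c e / 2 ^ S % P.B) := by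
  have h1 := hI.el_lt i hi
  have h2 := hI.eh_lt i hi
  have hkey : ∀ e < P.m, (s.a .pos e ∈ Ico (s.a .pos (I.el i)) (s.a .pos (I.eh i)) ↔
      ch e / 2 ^ (S + P.b) = ch (I.el i) / 2 ^ (S + P.b) ∧ I.el i ≤ e ∧ e < I.eh i) := by
    intro e he
    rw [hL.pos _ h1, hL.pos _ h2, hL.pos _ he]
    exact lexRank_mem_Ico h1 h2 he (by simp [heq])
  constructor
  · intro p hp
    have hpm : p < P.m := by
      have := lexRank_lt (key := fun e => ch e / 2 ^ (S + P.b)) h2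
      rw [← hL.pos _ h2] at this
      exact (mem_Ico.1 hp).2.trans this
    obtain ⟨e, he, hep⟩ := exists_lexRank (key := fun e => ch e / 2 ^ (S + P.b)) hpm
    rw [← hL.pos e he] at hep
    rw [← hep] at hp ⊢
    obtain ⟨k1, k2, k3⟩ := (hkey e he).1 hp
    rw [hL.val e he]
    by_cases hr : I.re e < 1
    · left; rw [if_pos hr]
    · right
      rw [if_neg hr]
      rw [hch e he hr] at k1 ⊢
      refine ⟨e, ⟨hr, lt_of_le_of_ne k2 ?_, k3⟩, k1, rfl⟩
      intro h; exact hr (h ▸ hI.re_el i hi)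
  · intro e he hk
    have hem : e < P.m := he.2.2.trans h2
    have hce := hch e hem he.1
    refine ⟨_, (hkey e hem).2 ⟨by rw [hce, hk], he.2.1.le, he.2.2⟩, ?_⟩
    rw [hL.val e hem, if_neg he.1, hce]

/-- If no digit in the range exceeds that of the query, then the query remains unresolved. -/
lemma unresolved_step {P : Par} {S : ℕ} {I : Inst} {f : ℕ → ℕ} {i l r : ℕ}
    (hA : ∀ e, I.In i e → I.c e / 2 ^ (S + P.b) = I.c (I.el i) / 2 ^ (S + P.b) →
      ∃ p ∈ Ico l r, f p = I.c e / 2 ^ S % P.B)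
    (hU : ∀ v ∈ I.V i, v / 2 ^ S ≠ I.c (I.el i) / 2 ^ S)
    (hmax : (Ico l r).sup f ≤ I.c (I.el i) / 2 ^ S % P.B) :
    ∀ v ∈ I.V i, v / 2 ^ (S + P.b) ≠ I.c (I.el i) / 2 ^ (S + P.b) := by
  rintro v ⟨e, he, rfl, hlt⟩ hk
  obtain ⟨p, hp, hfp⟩ := hA e he hk
  have h1 : f p ≤ (Ico l r).sup f := le_sup hp
  have h2 := hU _ ⟨e, he, rfl, hlt⟩
  have h3 := Nat.div_le_div_right (c := 2 ^ S) hlt.le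
  have h4 := div_split (I.c e) S P.b
  have h5 := div_split (I.c (I.el i)) S P.b
  unfold Par.B at *
  rw [hk] at h4
  omega

/-- If there is a digit in the range that exceeds that of the query, then the least such digit is
the digit of the answer. -/
lemma resolve_step {P : Par} {S : ℕ} {I : Inst} {f : ℕ → ℕ} {i l r y : ℕ}
    (hA : ∀ e, I.In i e → I.c e / 2 ^ (S + P.b) = I.c (I.el i) / 2 ^ (S + P.b) →
      ∃ p ∈ Ico l r, f p = I.c e / 2 ^ S % P.B)
    (hB : ∀ p ∈ Ico l r, f p = 0 ∨ ∃ e, I.In i e ∧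
      I.c e / 2 ^ (S + P.b) = I.c (I.el i) / 2 ^ (S + P.b) ∧ f p = I.c e / 2 ^ S % P.B)
    (hU : ∀ v ∈ I.V i, v / 2 ^ S ≠ I.c (I.el i) / 2 ^ S)
    (hy : ∃ p ∈ Ico l r, f p = y) (hdy : I.c (I.el i) / 2 ^ S % P.B < y)
    (hmin : ∀ p ∈ Ico l r, I.c (I.el i) / 2 ^ S % P.B < f p → y ≤ f p) :
    ∃ a, IsLeast (I.V i) a ∧ I.c (I.el i) / 2 ^ S < a / 2 ^ S ∧
      a / 2 ^ S = I.c (I.el i) / 2 ^ (S + P.b) * 2 ^ P.b + y := by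
  obtain ⟨c, hc⟩ : ∃ c, I.c (I.el i) = c := ⟨_, rfl⟩
  unfold Par.B at *
  rw [hc] at hA hB hU hdy hmin ⊢
  obtain ⟨p, hp, hfp⟩ := hy
  obtain ⟨e, he, hk, hfe⟩ := (hB p hp).resolve_left (by omega)
  have h5 := div_split c S P.b
  have h6 := div_split (I.c e) S P.b
  have hce : c / 2 ^ S < I.c e / 2 ^ S := by rw [h5, h6, hk]; omega
  have hcl : c < I.c e := by
    by_contra hn
    have := Nat.div_le_div_right (c := 2 ^ S) (not_lt.1 hn)
    omega
  have hne : (I.V i).Nonempty := ⟨_, e, he, rfl, hc ▸ hcl⟩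
  obtain ⟨e', he', hae, hca⟩ := Nat.sInf_mem hne
  have hU' := hU _ (Nat.sInf_mem hne)
  have hle : sInf (I.V i) ≤ I.c e := Nat.sInf_le ⟨e, he, rfl, hc ▸ hcl⟩
  obtain ⟨a, ha⟩ : ∃ a, sInf (I.V i) = a := ⟨_, rfl⟩
  rw [ha] at hae hca hU' hle
  rw [hc] at hca
  have g1 := Nat.div_le_div_right (c := 2 ^ S) hle
  have g2 := Nat.div_le_div_right (c := 2 ^ S) hca.le
  have g3 := Nat.div_le_div_right (c := 2 ^ (S + P.b)) hle
  have g4 := Nat.div_le_div_right (c := 2 ^ (S + P.b)) hca.le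
  have g5 := div_split a S P.b
  have hka : a / 2 ^ (S + P.b) = c / 2 ^ (S + P.b) := by omega
  obtain ⟨p', hp', hfp'⟩ := hA e' he' (by rw [hae, hka])
  rw [hae] at hfp'
  rw [hka] at g5
  have := hmin p' hp' (by omega)
  rw [hk] at h6
  exact ⟨a, ⟨ha ▸ Nat.sInf_mem hne, fun v hv => ha ▸ Nat.sInf_le hv⟩, by omega, by omega⟩

/-- The least digit in the range of a resolved query is the next digit of the answer. -/
lemma refine_step {P : Par} {S : ℕ} {I : Inst} {f : ℕ → ℕ} {i l r a : ℕ}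
    (ha : IsLeast (I.V i) a) (hc : I.c (I.el i) / 2 ^ (S + P.b) < a / 2 ^ (S + P.b))
    (hA : ∀ e, I.In i e → I.c e / 2 ^ (S + P.b) = a / 2 ^ (S + P.b) →
      ∃ p ∈ Ico l r, f p = P.B - 1 - I.c e / 2 ^ S % P.B)
    (hB : ∀ p ∈ Ico l r, f p = 0 ∨ ∃ e, I.In i e ∧ I.c e / 2 ^ (S + P.b) = a / 2 ^ (S + P.b) ∧
      f p = P.B - 1 - I.c e / 2 ^ S % P.B) :
    a / 2 ^ S % P.B + ((Ico l r).sup f + 1) = P.B := by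
  obtain ⟨⟨e, he, hea, hce⟩, hmin⟩ := ha
  obtain ⟨p, hp, hfp⟩ := hA e he (by rw [hea])
  rw [hea] at hfp
  have hBp := P.B_pos
  have hmod := Nat.mod_lt (a / 2 ^ S) hBp
  have h1 : f p ≤ (Ico l r).sup f := le_sup hp
  have h2 : (Ico l r).sup f ≤ P.B - 1 - a / 2 ^ S % P.B := by
    refine Finset.sup_le fun p' hp' => ?_
    rcases hB p' hp' with h0 | ⟨e', he', hk', hf'⟩
    · omega
    · have hlt : I.c (I.el i) < I.c e' := by
        by_contra hn
        have := Nat.div_le_div_right (c := 2 ^ (S + P.b)) (not_lt.1 hn)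
        omega
      have := hmin ⟨e', he', rfl, hlt⟩
      have := Nat.div_le_div_right (c := 2 ^ S) this
      have h5 := div_split a S P.b
      have h6 := div_split (I.c e') S P.b
      rw [hk'] at h6
      unfold Par.B at *
      omega
  omega

lemma slice_map_range {f : ℕ → ℕ} {N l r : ℕ} (hr : r ≤ N) :
    slice ((List.range N).map f) l r = (List.range' l (r - l)).map f := by
  rw [slice, ← List.map_take, ← List.map_drop, List.take_range, min_eq_left hr,
    List.range_eq_range', List.drop_range']
  simp

lemma mem_slice_map_range {f : ℕ → ℕ} {N l r a : ℕ} (hr : r ≤ N) :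
    a ∈ slice ((List.range N).map f) l r ↔ ∃ p ∈ Ico l r, f p = a := by
  rw [slice_map_range hr, List.mem_map]
  refine exists_congr fun p => ?_
  rw [List.mem_range'_1, mem_Ico]
  refine and_congr_left fun _ => ?_
  omega

lemma Level.congr {P : Par} {S : ℕ} {G : ℕ → ℕ} {ch re f : ℕ → ℕ} {s s' : St}
    (h : Level P S G ch re f s) (h1 : s'.a .pos = s.a .pos)
    (h2 : ∀ k < P.nw, s'.a .ww k = s.a .ww k) (h3 : s'.a .w1 = s.a .w1) (h4 : s'.a .sp = s.a .sp) :
    Level P S G ch re f s' :=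
  ⟨h1 ▸ h.pos, h1 ▸ h.val, h.zero, h.lt,
    ⟨fun k hk => by rw [h2 k hk, h.max.ww k hk], h3 ▸ h.max.w1, h4 ▸ h.max.sp⟩⟩

lemma Wave.congr {P : Par} {l : List ℕ} {j : ℕ} {s s' : St} (h : Wave P l j s)
    (h1 : s'.a .ww = s.a .ww) (h2 : s'.a .cc = s.a .cc) : Wave P l j s' :=
  ⟨h1 ▸ h.ww, h2 ▸ h.cc⟩

/-- The query `i` gets the new value `x` at both ends and the new entry `ρ` in `res`. Its ends are
not ends of other queries, whose states are thus unchanged. -/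
lemma Prog.update {P : Par} {I : Inst} (hI : I.Good P) {S lv S' lv' : ℕ → ℕ} {s s' : St}
    (h : Prog P I S lv s) {i x ρ : ℕ} (hi : i < I.q) (hx : x ≤ P.m)
    (hq : QState P.b (I.V i) (I.c (I.el i)) (S' i) (lv' i) ρ x)
    (hS : ∀ j, j ≠ i → S' j = S j ∧ lv' j = lv j) (h0 : s'.v .q = s.v .q)
    (h1 : s'.a .re = s.a .re) (h2 : s'.a .el = s.a .el) (h3 : s'.a .eh = s.a .eh)
    (h4 : s'.a .ch = Function.update (Function.update (s.a .ch) (I.el i) x) (I.eh i) x)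
    (h5 : s'.a .res = Function.update (s.a .res) i ρ) :
    Prog P I S' lv' s' ∧ ∀ j < I.q, j ≠ i → s'.a .ch (I.el j) = s.a .ch (I.el j) := by
  have hne : ∀ j < I.q, j ≠ i → s'.a .ch (I.el j) = s.a .ch (I.el j) := fun j hj hji => by
    rw [h4, Function.update_of_ne (hI.el_ne j hj i hi),
      Function.update_of_ne fun e => hji (hI.el_inj _ hj _ hi e)]
  have hel : s'.a .ch (I.el i) = x := by
    rw [h4, Function.update_of_ne (hI.el_ne i hi i hi), Function.update_self]
  refine ⟨⟨h0.trans h.q, h1 ▸ h.re, h2 ▸ h.el, h3 ▸ h.eh, fun e he hr => ?_, fun e he => ?_,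
    fun j hj => ?_, fun j hj => ?_⟩, hne⟩
  · rw [h4, Function.update_of_ne, Function.update_of_ne, h.ch e he hr]
    · rintro rfl; exact hr (hI.re_el i hi)
    · rintro rfl; exact hr (hI.re_eh i hi)
  · rw [h4, Function.update_apply, Function.update_apply]
    have := h.le e he
    split
    · exact hx
    · split
      · exact hx
      · exact this
  · rcases eq_or_ne j i with rfl | hji
    · rw [hel, h4, Function.update_self]
    · rw [hne j hj hji, h4, Function.update_of_ne fun e => hji (hI.eh_inj _ hj _ hi e),
        Function.update_of_ne (hI.el_ne i hi j hj).symm, h.eq j hj]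
  · rcases eq_or_ne j i with rfl | hji
    · rw [hel, h5, Function.update_self]; exact hq
    · rw [hne j hj hji, h5, Function.update_of_ne hji, (hS j hji).1, (hS j hji).2]
      exact h.st j hj

/-- The query `i` proceeds to the next level with its value and its entry in `res` unchanged. -/
lemma Prog.keep {P : Par} {I : Inst} {S lv S' lv' : ℕ → ℕ} {s s' : St}
    (h : Prog P I S lv s) {i : ℕ}
    (hq : QState P.b (I.V i) (I.c (I.el i)) (S' i) (lv' i) (s.a .res i) (s.a .ch (I.el i)))
    (hS : ∀ j, j ≠ i → S' j = S j ∧ lv' j = lv j) (h0 : s'.v .q = s.v .q)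
    (h1 : s'.a .re = s.a .re) (h2 : s'.a .el = s.a .el) (h3 : s'.a .eh = s.a .eh)
    (h4 : s'.a .ch = s.a .ch) (h5 : s'.a .res = s.a .res) :
    Prog P I S' lv' s' := by
  refine ⟨h0.trans h.q, h1 ▸ h.re, h2 ▸ h.el, h3 ▸ h.eh, h4 ▸ h.ch, h4 ▸ h.le, h4 ▸ h.eq,
    fun j hj => ?_⟩
  rw [h4, h5]
  rcases eq_or_ne j i with rfl | hji
  · exact hq
  · rw [(hS j hji).1, (hS j hji).2]; exact h.st j hj

/-- An unresolved query is resolved on the current level if possible. -/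
def resolveQuery : Cmd :=
  .iflt (.get .res Var.qi) 1 (
    .l ::= .get .pos (.get .el Var.qi) ;; .r ::= .get .pos (.get .eh Var.qi) ;;
    .acc ::= .get .ch (.get .el Var.qi) ;;
    .d ::= Ex.low (Var.acc >>: Var.s2) Var.b ;;
    rangeMax ;;
    .iflt Var.d Var.mo (
      waveQuery ;;
      .acc ::= (((Var.acc >>: Var.s1) <<: Var.b) + Var.cy) <<: Var.s2 ;;
      .put .res Var.qi (Var.b - Var.lv) ;;
      .put .ch (.get .el Var.qi) Var.acc ;; .put .ch (.get .eh Var.qi) Var.acc) .skip) .skip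

/-- The number of resolved queries. -/
def resolved (q : ℕ) (s : St) : ℕ := #{i ∈ range q | s.a .res i ≠ 0}

lemma resolved_update {q i ρ : ℕ} {s s' : St} (hi : i < q) (h0 : s.a .res i = 0) (hρ : ρ ≠ 0)
    (h : s'.a .res = Function.update (s.a .res) i ρ) : resolved q s' = resolved q s + 1 := by
  unfold resolved
  have : ({j ∈ range q | s'.a .res j ≠ 0} : Finset ℕ) =
      insert i {j ∈ range q | s.a .res j ≠ 0} := by
    ext j
    simp only [mem_filter, mem_range, mem_insert, h, Function.update_apply]
    split <;> grind
  rw [this, card_insert_of_notMem (by simp [h0])]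

/-- The time is constant, apart from `700 * b` steps for the search in the wavelet matrix. These are
charged to the increase of the number of resolved queries. -/
lemma runs_resolveQuery {M L : ℕ} {P : Par} (h : P.Good L M) {I : Inst} (hI : I.Good P) {s : St}
    (hs : Ctx P s) (ht : Tabs P s) (hlg : LogTab P s) {k i : ℕ} (hk : k < P.b)
    (hlv : s.v .lv = k) (hs2 : s.v .s2 = P.b * k) (hs1 : s.v .s1 = P.b * k + P.b)
    (hqi : s.v .qi = i) (hi : i < I.q) {chL f S lv : ℕ → ℕ}
    (hL : Level P (P.b * k) id chL I.re f s) (hch : ∀ e < P.m, ¬ I.re e < 1 → chL e = I.c e)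
    (hel : s.a .ch (I.el i) = chL (I.el i)) (heh : chL (I.eh i) = chL (I.el i))
    (hW : Wave P ((List.range (P.nw * P.g)).map f) P.b s) (hP : Prog P I S lv s)
    (hSi : S i = P.b * k) (hlvi : lv i = 0) :
    Runs M L resolveQuery s fun s' t =>
      t + 700 * P.b * resolved I.q s ≤ 600 + 700 * P.b * resolved I.q s' ∧
      Prog P I (Function.update S i (P.b * k + P.b)) lv s' ∧
      ∀ j < I.q, j ≠ i → s'.a .ch (I.el j) = s.a .ch (I.el j) := by
  have hm2 := h.two_le_m
  have hlL := h.le_L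
  have hM := h.le_M
  have hBt := h.B_le
  have htL := h.tw_le_L
  have hB0 := P.B_pos
  have hBp : 2 ^ P.b = P.B := rfl
  have hqm := hI.q_le
  have g1 := hI.el_lt i hi
  have g2 := hI.eh_lt i hi
  have g3 := lexRank_lt (key := fun e => chL e / 2 ^ (P.b * k + P.b)) g1
  have g4 := lexRank_lt (key := fun e => chL e / 2 ^ (P.b * k + P.b)) g2
  rw [← hL.pos _ g1] at g3
  rw [← hL.pos _ g2] at g4
  obtain ⟨lo, hlo⟩ : ∃ k, s.a .pos (I.el i) = k := ⟨_, rfl⟩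
  obtain ⟨hi', hhi⟩ : ∃ k, s.a .pos (I.eh i) = k := ⟨_, rfl⟩
  have hUp : ∀ j, j ≠ i → Function.update S i (P.b * k + P.b) j = S j ∧ lv j = lv j := fun j hj =>
    ⟨Function.update_of_ne hj _ _, rfl⟩
  have hst := hP.st i hi
  obtain ⟨hm1, hm3⟩ := hL.mem hI hch hi heh
  rw [hlo] at g3 hm1 hm3
  rw [hhi] at g4 hm1 hm3
  unfold resolveQuery
  rw [runs_iflt]
  refine ⟨by simp [hqi]; omega, by simp; omega, fun h0 => ?_, fun h0 => ?_⟩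
  swap
  · simp
    refine hP.keep ?_ hUp rfl rfl rfl rfl rfl rfl
    rcases hst with ⟨h1, -⟩ | hst
    · simp [hqi, h1] at h0
    · exact Or.inr hst
  simp [hqi] at h0
  obtain ⟨-, hc, hU⟩ := hst.resolve_right (by rw [h0]; omega)
  rw [hSi] at hU
  rw [hel] at hc
  rw [hc] at hm1 hm3
  obtain ⟨c, hcc⟩ : ∃ c, I.c (I.el i) = c := ⟨_, rfl⟩
  obtain ⟨d, hd⟩ : ∃ d, d = c / 2 ^ (P.b * k) % P.B := ⟨_, rfl⟩
  have hdB : d < P.B := hd ▸ Nat.mod_lt _ hB0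
  set s2 := (((s.setv .l lo).setv .r hi').setv .acc c).setv .d d with hs2'
  have c2 : Ctx P s2 := (((hs.setv _ (by decide)).setv _ (by decide)).setv _ (by decide)).setv _
    (by decide)
  have t2 : Tabs P s2 := ht.congr rfl rfl rfl rfl
  simp only [runs_seq, runs_set]
  simp [hqi, hP.el i hi, hP.eh i hi, hlo, hhi, hel, hc, hcc, hs2, hs.b, hBp, ← hd, and_assoc]
  repeat refine ⟨by omega, ?_⟩
  rw [← hs2']
  refine (runs_rangeMax h c2 t2 (fun i hi => hlg i hi) hL.lt (s := s2)
    ⟨hL.max.ww, hL.max.w1, hL.max.sp⟩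
    (l := lo) (r := hi') (by simp [hs2']) (by simp [hs2']) g4.le).frame.mono ?_
  rintro s3 u3 ⟨F3, ht3, hmo⟩
  have c3 := c2.frame F3 (by decide)
  have t3 := t2.frame F3 (by decide)
  have a3 : s3.a = s.a := by
    ext a; rw [F3.a a (by simp [rangeMax, packedMax, sparseMax, upd, Cmd.arrs])]; simp [hs2']
  have v3 : ∀ x ∉ rangeMax.vars, s3.v x = s2.v x := F3.v
  have d3 : s3.v .d = d := by rw [v3 _ (by decide)]; simp [hs2']
  rw [runs_iflt]
  refine ⟨by simp, by simp, fun hlt => ?_, fun hge => ?_⟩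
  swap
  · simp [d3, hmo] at hge
    simp [a3]
    have hr : resolved I.q s3 = resolved I.q s := by simp [resolved, a3]
    refine ⟨by rw [hr]; omega, hP.keep ?_ hUp ?_ (by rw [a3]) (by rw [a3]) (by rw [a3]) (by rw [a3])
      (by rw [a3])⟩
    · refine Or.inl ⟨h0, by rw [hel, hc], ?_⟩
      rw [Function.update_self]
      refine unresolved_step (l := lo) (r := hi') hm3 hU ?_
      rw [hcc, ← hd]
      exact Finset.sup_le fun p hp => hge p (mem_Ico.1 hp).1 (mem_Ico.1 hp).2
    · rw [v3 _ (by decide)]; simp [hs2']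
  simp [d3, hmo, -Finset.lt_sup_iff] at hlt
  have hex : ∃ p ∈ Ico lo hi', d < f p := by
    by_contra hn
    push Not at hn
    exact absurd (Finset.sup_le hn) (not_le.2 hlt)
  have hhl : hi' ≤ P.nw * P.g := by have := P.m_lt_nw; omega
  have hmem : ∀ a, a ∈ slice ((List.range (P.nw * P.g)).map f) lo hi' ↔ ∃ p ∈ Ico lo hi', f p = a :=
    fun a => mem_slice_map_range hhl
  have hlohi : lo ≤ hi' := by
    obtain ⟨p, hp, -⟩ := hex
    have := mem_Ico.1 hp; omega
  rw [runs_seq]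
  refine (runs_waveQuery h c3 t3 (l := (List.range (P.nw * P.g)).map f) (by simp)
    (by simp only [List.mem_map]; rintro _ ⟨p, -, rfl⟩; exact hL.lt p)
    (hW.congr (by rw [a3]) (by rw [a3])) (lo := lo) (hi := hi') (d := d)
    (by rw [v3 _ (by decide)]; simp [hs2']) (by rw [v3 _ (by decide)]; simp [hs2']) hlohi
    (by simpa using hhl) d3 hdB ?_).frame.mono ?_
  · obtain ⟨p, hp, hdp⟩ := hex
    exact ⟨f p, (hmem _).2 ⟨p, hp, rfl⟩, hdp⟩
  rintro s4 u4 ⟨F4, ht4, hcy, hdcy, hmin⟩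
  have c4 := c3.frame F4 (by decide)
  have a4 : s4.a = s.a := by
    ext a; rw [F4.a a (by simp [waveQuery, rank, descend, Cmd.arrs]), a3]
  have v4 : ∀ x ∈ [Var.acc, .s1, .s2, .qi, .lv, .q], s4.v x = s2.v x := fun x hx => by
    rw [F4.v x (by revert x; decide), v3 x (by revert x; decide)]
  have w1 : s4.v .acc = c := by rw [v4 _ (by simp)]; simp [hs2']
  have w2 : s4.v .s1 = P.b * k + P.b := by rw [v4 _ (by simp)]; simp [hs2', hs1]
  have w3 : s4.v .s2 = P.b * k := by rw [v4 _ (by simp)]; simp [hs2', hs2]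
  have w4 : s4.v .qi = i := by rw [v4 _ (by simp)]; simp [hs2', hqi]
  have w5 : s4.v .lv = k := by rw [v4 _ (by simp)]; simp [hs2', hlv]
  have w6 : s4.v .q = s.v .q := by rw [v4 _ (by simp)]; simp [hs2']
  obtain ⟨y, hy⟩ : ∃ y, y = s4.v .cy := ⟨_, rfl⟩
  rw [← hy] at hcy hdcy hmin
  obtain ⟨a, ha, hca, hax⟩ := resolve_step (l := lo) (r := hi') (f := f) (y := y) hm3 hm1 hU
    ((hmem y).1 hcy) (by rw [hcc, ← hd]; exact hdcy) (fun p hp hdp =>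
      hmin _ ((hmem _).2 ⟨p, hp, rfl⟩) (by rw [hcc, ← hd] at hdp; exact hdp))
  rw [hcc, hBp] at hax
  have ham : a ≤ P.m := by
    obtain ⟨e, he, rfl, -⟩ := ha.1
    exact hI.c_le e (he.2.2.trans g2)
  have haS : a / 2 ^ (P.b * k) * 2 ^ (P.b * k) ≤ a := Nat.div_mul_le_self _ _
  have haS' : a / 2 ^ (P.b * k) ≤ a := Nat.div_le_self _ _
  have hcB : c / 2 ^ (P.b * k + P.b) * P.B < M := by omega
  have hne : I.el i ≠ I.eh i := hI.el_ne i hi i hi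
  have g5 : I.el i < L := by omega
  have g6 : I.eh i < L := by omega
  simp only [runs_seq, runs_set, runs_put]
  simp [w1, w2, w3, w4, w5, c4.b, ← hy, hBp, a4, ← hax, hP.el i hi, hP.eh i hi, hcB, g5, g6,
    and_assoc]
  repeat refine ⟨by omega, ?_⟩
  obtain ⟨s5, hs5⟩ : ∃ s5, s5 =
    (((s4.setv .acc (a / 2 ^ (P.b * k) * 2 ^ (P.b * k))).seta .res i (P.b - k)).seta .ch
      (I.el i) (a / 2 ^ (P.b * k) * 2 ^ (P.b * k))).seta .ch (I.eh i)
      (a / 2 ^ (P.b * k) * 2 ^ (P.b * k)) := ⟨_, rfl⟩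
  have hres : s5.a .res = Function.update (s.a .res) i (P.b - k) := by simp [hs5, a4]
  have hup := Prog.update hI hP (S' := Function.update S i (P.b * k + P.b)) (lv' := lv) (s' := s5)
    (i := i) (x := a / 2 ^ (P.b * k) * 2 ^ (P.b * k)) (ρ := P.b - k) hi (by omega) ?_ hUp
    (by simpa [hs5] using w6) (by simp [hs5, a4]) (by simp [hs5, a4]) (by simp [hs5, a4])
    (by simp [hs5, a4]) hres
  · rw [← hs5]
    refine ⟨?_, hup.1, by simpa [hs5, a4] using hup.2⟩
    rw [resolved_update hi h0 (by omega) hres, show ∀ x, 700 * P.b * (x + 1) =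
      700 * P.b * x + 700 * P.b from fun x => by ring]
    omega
  · refine Or.inr ⟨by omega, by omega, a, ha, ?_⟩
    rw [hlvi, Nat.max_zero, show P.b - (P.b - k) = k by omega]
    exact ⟨hca, rfl⟩

/-- Determining for all queries where the answer first differs from the query character. The levels
are taken from the lowest digit up, since the least character above `c` is one with the longest
possible common prefix with `c`. -/
def resolvePass : Cmd :=
  .for_ .lv Var.b (
    .s2 ::= Var.b * Var.lv ;; .s1 ::= Var.s2 + Var.b ;;
    levelPrep Var.t ;; buildWave ;;
    .for_ .qi Var.q resolveQuery)

lemma resolved_le (q : ℕ) (s : St) : resolved q s ≤ q :=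
  (card_filter_le _ _).trans_eq (card_range q)

lemma drop_take_map_range {f : ℕ → ℕ} {N a g : ℕ} (h : a + g ≤ N) :
    (((List.range N).map f).drop a).take g = (List.range' a g).map f := by
  rw [← List.map_drop, ← List.map_take, List.range_eq_range', List.drop_range',
    List.take_range'_of_length_ge]
  · simp
  · omega

/-- The searches in wavelet matrices take time `700 * b` once for each of the at most `m` queries;
all the rest takes time linear in `m` on each of the `b` levels. -/
lemma runs_resolvePass {M L : ℕ} {P : Par} (h : P.Good L M) {I : Inst} (hI : I.Good P) {s : St}
    (hs : Ctx P s) (ht : Tabs P s) (hlg : LogTab P s)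
    (hP : Prog P I (fun _ => 0) (fun _ => 0) s) :
    Runs M L resolvePass s fun s' t => t ≤ 100000 * (P.b * P.m) ∧
      Prog P I (fun _ => P.b * P.b) (fun _ => 0) s' := by
  have hm2 := h.two_le_m
  have hlL := h.le_L
  have hM := h.le_M
  have hqm := hI.q_le
  have hbt := h.b_tw
  have hbb : P.b * P.b ≤ P.b * P.tw := Nat.mul_le_mul_left _
    ((Nat.le_mul_of_pos_right _ P.g_pos).trans Nat.lt_two_pow_self.le)
  have hb1 : P.b ≤ P.b * P.b := Nat.le_mul_self _
  unfold resolvePass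
  refine runs_for (fun k s' T => T + 700 * P.b * resolved I.q s ≤
    90000 * (k * P.m) + 700 * P.b * resolved I.q s' ∧
    Prog P I (fun _ => P.b * k) (fun _ => 0) s') ?_ ?_ ?_ ?_
  · simp
  · exact ⟨by simp, hP⟩
  · rintro k s1 T hk F ⟨hT, hP1⟩
    have hk : k < P.b := by simpa [hs.b] using hk
    have hkb : P.b * (k + 1) ≤ P.b * P.b := Nat.mul_le_mul_left _ hk
    rw [mul_add, mul_one] at hkb
    have c1 := hs.frame F (by decide)
    have t1 := ht.frame F (by decide)
    have l1 : LogTab P s1 := fun i hi => by rw [F.a _ (by decide), hlg i hi]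
    set s2 := ((s1.setv .lv k).setv .s2 (P.b * k)).setv .s1 (P.b * k + P.b) with hs2
    have c2 : Ctx P s2 := ((c1.setv _ (by decide)).setv _ (by decide)).setv _ (by decide)
    simp only [runs_seq, runs_set]
    simp [c1.b]
    repeat refine ⟨by omega, ?_⟩
    rw [← hs2]
    refine (runs_levelPrep h c2 (t1.congr rfl rfl rfl rfl) (fun i hi => l1 i hi) (G := id)
      (S := P.b * k) (by simp [hs2]) (by simp [hs2]) (fun e he => hP1.le e he) (fun a ha => ha)
      (by simp) (fun s' _ _ => ⟨by simp, by simp⟩)).frame.mono ?_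
    rintro s3 u3 ⟨F3, ht3, f, hL⟩
    have c3 := c2.frame F3 (by decide)
    have t3 : Tabs P s3 := (show Tabs P s2 from t1.congr rfl rfl rfl rfl).frame F3 (by decide)
    set T := (List.range (P.nw * P.g)).map f with hTd
    refine (runs_buildWave h c3 t3 (l := T) (by simp [hTd]) (by
      simp only [hTd, List.mem_map]; rintro _ ⟨p, -, rfl⟩; exact hL.lt p)
      (fun i hi => ?_)).frame.mono ?_
    · rw [hL.max.ww i hi, word, hTd, drop_take_map_range]
      have : (i + 1) * P.g ≤ P.nw * P.g := Nat.mul_le_mul_right _ hi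
      rwa [add_mul, one_mul] at this
    rintro s4 u4 ⟨F4, ht4, hW4, hw4⟩
    have c4 := c3.frame F4 (by decide)
    have t4 := t3.frame F4 (by decide)
    have l4 : LogTab P s4 := fun i hi => by
      rw [F4.a _ (by decide), F3.a _ (by decide)]; exact l1 i hi
    have a4 : ∀ a ∈ [Arr.re, .el, .eh, .ch, .res], s4.a a = s1.a a := fun a ha => by
      rw [F4.a _ (by revert a; decide), F3.a _ (by revert a; decide)]; rfl
    have v4 : ∀ x ∈ [Var.lv, .s1, .s2, .q], s4.v x = s2.v x := fun x hx => by
      rw [F4.v _ (by revert x; decide), F3.v _ (by revert x; decide)]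
    have hP4 : Prog P I (fun _ => P.b * k) (fun _ => 0) s4 :=
      ⟨by rw [v4 _ (by simp)]; simpa [hs2] using hP1.q, by rw [a4 _ (by simp)]; exact hP1.re,
        by rw [a4 _ (by simp)]; exact hP1.el, by rw [a4 _ (by simp)]; exact hP1.eh,
        by rw [a4 .ch (by simp)]; exact hP1.ch, by rw [a4 .ch (by simp)]; exact hP1.le,
        by rw [a4 .ch (by simp)]; exact hP1.eq,
        by rw [a4 .ch (by simp), a4 .res (by simp)]; exact hP1.st⟩
    have hr4 : resolved I.q s4 = resolved I.q s1 := by unfold resolved; rw [a4 .res (by simp)]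
    have hL3 : Level P (P.b * k) id (s1.a .ch) I.re f s4 := by
      have : Level P (P.b * k) id (s1.a .ch) I.re f s3 := by
        refine ⟨hL.pos, fun e he => ?_, hL.zero, hL.lt, hL.max⟩
        rw [hL.val e he, ← hP1.re e he]; rfl
      exact this.congr (F4.a _ (by decide)) (fun k hk => hw4 k (by unfold Par.st; omega))
        (F4.a _ (by decide)) (F4.a _ (by decide))
    refine runs_for (fun i s' T => T + 700 * P.b * resolved I.q s4 ≤
      605 * i + 700 * P.b * resolved I.q s' ∧
      Prog P I (fun j => if j < i then P.b * k + P.b else P.b * k) (fun _ => 0) s' ∧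
      ∀ j < I.q, i ≤ j → s'.a .ch (I.el j) = s1.a .ch (I.el j)) ?_ ?_ ?_ ?_
    · simp
    · exact ⟨by simp, by simpa using hP4, fun j _ _ => by rw [a4 .ch (by simp)]⟩
    · rintro i s5 T5 hi F5 ⟨hT5, hP5, h5⟩
      have hi : i < I.q := by simpa [hP4.q] using hi
      have c5 := c4.frame F5 (by decide)
      have a5 : ∀ a, a ≠ .ch → a ≠ .res → s5.a a = s4.a a := fun a h1 h2 =>
        F5.a a (by simp [resolveQuery, rangeMax, packedMax, sparseMax, upd, waveQuery, rank,
          descend,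
          Cmd.arrs, h1, h2])
      have v5 : ∀ x ∈ [Var.lv, .s1, .s2], s5.v x = s2.v x := fun x hx => by
        rw [F5.v _ (by revert x; decide), v4 _ (by revert x; decide)]
      have t5 := t4.frame F5 (by decide)
      refine (runs_resolveQuery h hI (s := s5.setv .qi i) (c5.setv _ (by decide))
        (t5.congr rfl rfl rfl rfl) (fun j hj => ?_) (i := i) hk ?_ ?_ ?_
        (by simp) hi (hL3.congr (a5 _ (by decide) (by decide))
          (fun _ _ => by rw [St.setv_a, a5 _ (by decide) (by decide)])
          (a5 _ (by decide) (by decide)) (a5 _ (by decide) (by decide))) hP1.ch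
        (h5 i hi le_rfl) (hP1.eq i hi)
        (hW4.congr (a5 _ (by decide) (by decide)) (a5 _ (by decide) (by decide)))
        (S := fun j => if j < i then P.b * k + P.b else P.b * k) (lv := fun _ => 0)
        ⟨by simpa using hP5.q, hP5.re, hP5.el, hP5.eh, hP5.ch, hP5.le, hP5.eq, hP5.st⟩
        (by simp) rfl).mono ?_
      · rw [St.setv_a, a5 _ (by decide) (by decide)]; exact l4 j hj
      · simp [v5 .lv (by simp)]; simp [hs2]
      · simp [v5 .s2 (by simp)]; simp [hs2]
      · simp [v5 .s1 (by simp)]; simp [hs2]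
      rintro s6 u6 ⟨ht6, hP6, h6⟩
      have hr5 : resolved I.q (s5.setv .qi i) = resolved I.q s5 := rfl
      rw [hr5] at ht6
      refine ⟨by omega, ?_, fun j hj hij => ?_⟩
      · convert hP6 using 1
        ext j
        rw [Function.update_apply]
        split <;> split <;> (try split) <;> omega
      · rw [h6 j hj (by omega)]
        exact h5 j hj (by omega)
    · rintro s5 T5 F5 ⟨hT5, hP5, -⟩
      have hq4 : Ex.eval s4 (Ex.var .q) = I.q := hP4.q
      rw [hq4] at hT5 hP5
      rw [hr4] at hT5
      refine ⟨?_, ?_⟩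
      · rw [add_mul, one_mul]; simp; omega
      · refine ⟨hP5.q, hP5.re, hP5.el, hP5.eh, hP5.ch, hP5.le, hP5.eq, fun j hj => ?_⟩
        have := hP5.st j hj
        rw [if_pos hj] at this
        rwa [mul_add, mul_one]
  · rintro s1 T F ⟨hT, hP1⟩
    have hb : Ex.eval s (Ex.var .b) = P.b := hs.b
    rw [hb] at hT hP1
    refine ⟨?_, hP1⟩
    have h1 := resolved_le I.q s1
    have h2 : 700 * P.b * resolved I.q s1 ≤ 700 * (P.b * P.m) :=
      (Nat.mul_le_mul_left _ (by omega)).trans_eq (mul_assoc _ _ _)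
    have h3 : 1 * P.m ≤ P.b * P.m := Nat.mul_le_mul_right _ h.one_le_b
    simp; omega

/-- The next digit of the answer of a resolved query: the least digit in its range, which is
`2 ^ b - 1` minus the greatest complemented digit. -/
def refineQuery : Cmd :=
  .iflt (.get .res Var.qi) (Var.lv + 1) (
    .iflt 0 (.get .res Var.qi) (
      .l ::= .get .pos (.get .el Var.qi) ;; .r ::= .get .pos (.get .eh Var.qi) ;;
      rangeMax ;;
      .acc ::= .get .ch (.get .el Var.qi) + ((((1 : Ex) <<: Var.b) - (Var.mo + 1)) <<: Var.s2) ;;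
      .put .ch (.get .el Var.qi) Var.acc ;; .put .ch (.get .eh Var.qi) Var.acc) .skip) .skip

lemma runs_refineQuery {M L : ℕ} {P : Par} (h : P.Good L M) {I : Inst} (hI : I.Good P) {s : St}
    (hs : Ctx P s) (ht : Tabs P s) (hlg : LogTab P s) {k i S₀ : ℕ} (hk : k < P.b)
    (hlv : s.v .lv = k) (hs2 : s.v .s2 = P.b * (P.b - (k + 1)))
    (hqi : s.v .qi = i) (hi : i < I.q) {chL f lv : ℕ → ℕ}
    (hL : Level P (P.b * (P.b - (k + 1))) (fun x => P.B - 1 - x) chL I.re f s)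
    (hch : ∀ e < P.m, ¬ I.re e < 1 → chL e = I.c e)
    (hel : s.a .ch (I.el i) = chL (I.el i)) (heh : chL (I.eh i) = chL (I.el i))
    (hP : Prog P I (fun _ => S₀) lv s) (hlvi : lv i = k) :
    Runs M L refineQuery s fun s' t => t ≤ 700 ∧
      Prog P I (fun _ => S₀) (Function.update lv i (k + 1)) s' ∧
      ∀ j < I.q, j ≠ i → s'.a .ch (I.el j) = s.a .ch (I.el j) := by
  have hm2 := h.two_le_m
  have hlL := h.le_L
  have hM := h.le_M
  have hBt := h.B_le
  have htL := h.tw_le_L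
  have hB0 := P.B_pos
  have hbt := h.b_tw
  have hbb : P.b * 1 ≤ P.b * P.tw := Nat.mul_le_mul_left _ P.tw_pos
  have hBp : 2 ^ P.b = P.B := rfl
  have hqm := hI.q_le
  have g1 := hI.el_lt i hi
  have g2 := hI.eh_lt i hi
  have g3 := lexRank_lt (key := fun e => chL e / 2 ^ (P.b * (P.b - (k + 1)) + P.b)) g1
  have g4 := lexRank_lt (key := fun e => chL e / 2 ^ (P.b * (P.b - (k + 1)) + P.b)) g2
  rw [← hL.pos _ g1] at g3
  rw [← hL.pos _ g2] at g4
  obtain ⟨lo, hlo⟩ : ∃ k, s.a .pos (I.el i) = k := ⟨_, rfl⟩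
  obtain ⟨hi', hhi⟩ : ∃ k, s.a .pos (I.eh i) = k := ⟨_, rfl⟩
  have hUp : ∀ j, j ≠ i → S₀ = S₀ ∧ Function.update lv i (k + 1) j = lv j := fun j hj =>
    ⟨rfl, Function.update_of_ne hj _ _⟩
  have hst := hP.st i hi
  obtain ⟨hm1, hm3⟩ := hL.mem hI hch hi heh
  rw [hlo] at g3 hm1 hm3
  rw [hhi] at g4 hm1 hm3
  have hSb : P.b * (P.b - (k + 1)) + P.b = P.b * (P.b - k) := by
    rw [show P.b - k = P.b - (k + 1) + 1 by omega, mul_add, mul_one]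
  obtain ⟨S, hS⟩ : ∃ S, S = P.b * (P.b - (k + 1)) := ⟨_, rfl⟩
  rw [← hS] at hs2 hL hm1 hm3 hSb
  have h1M : s.v .lv + 1 < M := by omega
  have hiL : i < L := by omega
  unfold refineQuery
  rw [runs_iflt]
  refine ⟨by simp [hqi]; omega, by simp; omega, fun h0 => ?_, fun h0 => ?_⟩
  swap
  · simp [hqi, hlv] at h0
    simp
    refine hP.keep ?_ hUp rfl rfl rfl rfl rfl rfl
    rcases hst with ⟨h1, -⟩ | hst
    · omega
    · rw [Function.update_self]
      rw [hlvi] at hst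
      rw [max_eq_left (by omega)] at hst
      refine Or.inr ?_
      rw [max_eq_left (by omega)]
      exact hst
  simp [hqi, hlv] at h0
  rw [runs_iflt]
  refine ⟨by simp; omega, by simp [hqi]; omega, fun h1 => ?_, fun h1 => ?_⟩
  swap
  · simp [hqi] at h1
    simp
    refine hP.keep ?_ hUp rfl rfl rfl rfl rfl rfl
    rcases hst with hst | ⟨h1, -⟩
    · exact Or.inl hst
    · omega
  simp [hqi] at h1
  obtain ⟨-, hρb, a, ha, hca, hax⟩ := hst.resolve_left (by rintro ⟨h2, -⟩; omega)
  rw [hlvi, max_eq_right (by omega), ← hSb] at hax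
  have hkey : chL (I.el i) / 2 ^ (S + P.b) = a / 2 ^ (S + P.b) := by
    rw [← hel, hax, Nat.mul_div_cancel _ (by positivity)]
  rw [hkey] at hm1 hm3
  have hca' : I.c (I.el i) / 2 ^ (S + P.b) < a / 2 ^ (S + P.b) := by
    by_contra hn
    have h2 := Nat.div_le_div_right (c := 2 ^ (P.b * (P.b - s.a .res i) - (S + P.b))) (not_lt.1 hn)
    have h3 : P.b * (P.b - k) ≤ P.b * (P.b - s.a .res i) := Nat.mul_le_mul_left _ (by omega)
    rw [Nat.div_div_eq_div_mul, Nat.div_div_eq_div_mul, ← pow_add,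
      show S + P.b + (P.b * (P.b - s.a .res i) - (S + P.b)) =
          P.b * (P.b - s.a .res i) by omega] at h2
    omega
  have hsum := refine_step (l := lo) (r := hi') (f := f) ha hca' hm3 hm1
  set s2 := (s.setv .l lo).setv .r hi' with hs2'
  have c2 : Ctx P s2 := (hs.setv _ (by decide)).setv _ (by decide)
  have t2 : Tabs P s2 := ht.congr rfl rfl rfl rfl
  simp only [runs_seq, runs_set]
  simp [hqi, hP.el i hi, hP.eh i hi, hlo, hhi, and_assoc]
  repeat refine ⟨by omega, ?_⟩
  rw [← hs2']
  refine (runs_rangeMax h c2 t2 (fun i hi => hlg i hi) hL.lt (s := s2)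
    ⟨hL.max.ww, hL.max.w1, hL.max.sp⟩
    (l := lo) (r := hi') (by simp [hs2']) (by simp [hs2']) g4.le).frame.mono ?_
  rintro s3 u3 ⟨F3, ht3, hmo⟩
  have c3 := c2.frame F3 (by decide)
  have a3 : s3.a = s.a := by
    ext a; rw [F3.a a (by simp [rangeMax, packedMax, sparseMax, upd, Cmd.arrs])]; simp [hs2']
  have v3 : ∀ x ∈ [Var.s2, .qi, .q], s3.v x = s.v x := fun x hx => by
    rw [F3.v x (by revert x; decide)]; revert x; simp [hs2']
  obtain ⟨y, hy⟩ : ∃ y, y = (Ico lo hi').sup f := ⟨_, rfl⟩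
  rw [← hy] at hmo hsum
  have ham : a ≤ P.m := by
    obtain ⟨e, he, rfl, -⟩ := ha.1
    exact hI.c_le e (he.2.2.trans g2)
  have haS : a / 2 ^ S * 2 ^ S ≤ a := Nat.div_mul_le_self _ _
  have hxa : s.a .ch (I.el i) + (P.B - (y + 1)) * 2 ^ S = a / 2 ^ S * 2 ^ S := by
    rw [div_split a S P.b, hax, hBp, show P.B - (y + 1) = a / 2 ^ S % P.B by omega, add_mul,
      pow_add, hBp]
    ring
  have hne : I.el i ≠ I.eh i := hI.el_ne i hi i hi
  have g5 : I.el i < L := by omega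
  have g6 : I.eh i < L := by omega
  obtain ⟨s5, hs5⟩ : ∃ s5, s5 = ((s3.setv .acc (a / 2 ^ S * 2 ^ S)).seta .ch
      (I.el i) (a / 2 ^ S * 2 ^ S)).seta .ch (I.eh i) (a / 2 ^ S * 2 ^ S) := ⟨_, rfl⟩
  have hup := Prog.update hI hP (S' := fun _ => S₀) (lv' := Function.update lv i (k + 1))
    (s' := s5) (i := i) (x := a / 2 ^ S * 2 ^ S) (ρ := s.a .res i) hi (by omega) ?_ hUp
    (by simp [hs5, v3 .q]) (by simp [hs5, a3]) (by simp [hs5, a3]) (by simp [hs5, a3])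
    (by simp [hs5, a3]) (by simp [hs5, a3])
  · simp [v3 .s2, v3 .qi, hs2, hqi, c3.b, hBp, a3, hmo, hP.el i hi, hP.eh i hi, hxa, g5, g6]
    repeat refine ⟨by omega, ?_⟩
    rw [← hs5]
    exact ⟨hup.1, by simpa [hs5, a3] using hup.2⟩
  · refine Or.inr ⟨h1, hρb, a, ha, hca, ?_⟩
    rw [Function.update_self, max_eq_right (by omega), hS]

/-- Determining the answers of all resolved queries. The levels are taken from the top down. The
digits are complemented, so that a range maximum gives the least digit; items that are not string
positions have the digit zero and never spoil a maximum. -/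
def refinePass : Cmd :=
  .for_ .lv Var.b (
    .s2 ::= Var.b * (Var.b - (Var.lv + 1)) ;; .s1 ::= Var.s2 + Var.b ;;
    levelPrep (((1 : Ex) <<: Var.b) - (Var.t + 1)) ;;
    .for_ .qi Var.q refineQuery)

lemma runs_refinePass {M L : ℕ} {P : Par} (h : P.Good L M) {I : Inst} (hI : I.Good P) {s : St}
    (hs : Ctx P s) (ht : Tabs P s) (hlg : LogTab P s) {S₀ : ℕ}
    (hP : Prog P I (fun _ => S₀) (fun _ => 0) s) :
    Runs M L refinePass s fun s' t => t ≤ 50000 * (P.b * P.m) ∧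
      Prog P I (fun _ => S₀) (fun _ => P.b) s' := by
  have hm2 := h.two_le_m
  have hlL := h.le_L
  have hM := h.le_M
  have hqm := hI.q_le
  have hbt := h.b_tw
  have hB0 := P.B_pos
  have hBt := h.B_le
  have htL := h.tw_le_L
  have hBp : 2 ^ P.b = P.B := rfl
  have hbb : P.b * P.b ≤ P.b * P.tw := Nat.mul_le_mul_left _
    ((Nat.le_mul_of_pos_right _ P.g_pos).trans Nat.lt_two_pow_self.le)
  have hb1 : P.b ≤ P.b * P.b := Nat.le_mul_self _
  unfold refinePass
  refine runs_for (fun k s' T => T ≤ 45000 * (k * P.m) ∧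
    Prog P I (fun _ => S₀) (fun _ => k) s') ?_ ?_ ?_ ?_
  · simp
  · exact ⟨by simp, hP⟩
  · rintro k s1 T hk F ⟨hT, hP1⟩
    have hk : k < P.b := by simpa [hs.b] using hk
    have hkb : P.b * (P.b - (k + 1)) ≤ P.b * P.b := Nat.mul_le_mul_left _ (by omega)
    have c1 := hs.frame F (by simp [refineQuery, levelPrep, rangeMax, packedMax, sparseMax, upd,
      Cmd.vars, parVars, rankSort, buildMax, padZero, pack, wordMax, buildSparse])
    have arr1 : ∀ a ∈ [Arr.mx, .on, .zt, .ot, .lg], s1.a a = s.a a := fun a ha =>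
      F.a a (by revert a; decide)
    have t1 : Tabs P s1 := ht.congr (arr1 _ (by simp)) (arr1 _ (by simp)) (arr1 _ (by simp))
      (arr1 _ (by simp))
    have l1 : LogTab P s1 := fun i hi => by rw [arr1 _ (by simp), hlg i hi]
    obtain ⟨S, hS⟩ : ∃ S, S = P.b * (P.b - (k + 1)) := ⟨_, rfl⟩
    rw [← hS] at hkb
    set s2 := ((s1.setv .lv k).setv .s2 S).setv .s1 (S + P.b) with hs2
    have c2 : Ctx P s2 := ((c1.setv _ (by decide)).setv _ (by decide)).setv _ (by decide)
    simp only [runs_seq, runs_set]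
    simp [c1.b, ← hS, and_assoc]
    repeat refine ⟨by omega, ?_⟩
    rw [← hs2]
    refine (runs_levelPrep h c2 (t1.congr rfl rfl rfl rfl) (fun i hi => l1 i hi)
      (G := fun x => P.B - 1 - x)
      (S := S) (by simp [hs2]) (by simp [hs2]) (fun e he => hP1.le e he) (fun a ha => by omega)
      (by simp) (fun s' c' hlt => by simp [c'.b, hBp]; omega)).frame.mono ?_
    rintro s3 u3 ⟨F3, ht3, f, hL⟩
    have c3 := c2.frame F3 (by decide)
    have t3 : Tabs P s3 := (show Tabs P s2 from t1.congr rfl rfl rfl rfl).frame F3 (by decide)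
    have l3 : LogTab P s3 := fun i hi => by rw [F3.a _ (by decide)]; exact l1 i hi
    have a3 : ∀ a ∈ [Arr.re, .el, .eh, .ch, .res], s3.a a = s1.a a := fun a ha => by
      rw [F3.a _ (by revert a; decide)]; rfl
    have v3 : ∀ x ∈ [Var.lv, .s1, .s2, .q], s3.v x = s2.v x := fun x hx => by
      rw [F3.v _ (by revert x; decide)]
    have hP3 : Prog P I (fun _ => S₀) (fun _ => k) s3 :=
      ⟨by rw [v3 _ (by simp)]; simpa [hs2] using hP1.q, by rw [a3 _ (by simp)]; exact hP1.re,
        by rw [a3 _ (by simp)]; exact hP1.el, by rw [a3 _ (by simp)]; exact hP1.eh,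
        by rw [a3 .ch (by simp)]; exact hP1.ch, by rw [a3 .ch (by simp)]; exact hP1.le,
        by rw [a3 .ch (by simp)]; exact hP1.eq,
        by rw [a3 .ch (by simp), a3 .res (by simp)]; exact hP1.st⟩
    have hL3 : Level P S (fun x => P.B - 1 - x) (s1.a .ch) I.re f s3 := by
      refine ⟨hL.pos, fun e he => ?_, hL.zero, hL.lt, hL.max⟩
      rw [hL.val e he, ← hP1.re e he]; rfl
    refine runs_for (fun i s' T => T ≤ 705 * i ∧
      Prog P I (fun _ => S₀) (fun j => if j < i then k + 1 else k) s' ∧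
      ∀ j < I.q, i ≤ j → s'.a .ch (I.el j) = s1.a .ch (I.el j)) ?_ ?_ ?_ ?_
    · simp
    · exact ⟨by simp, by simpa using hP3, fun j _ _ => by rw [a3 .ch (by simp)]⟩
    · rintro i s5 T5 hi F5 ⟨hT5, hP5, h5⟩
      have hi : i < I.q := by simpa [hP3.q] using hi
      have c5 := c3.frame F5 (by decide)
      have a5 : ∀ a, a ≠ .ch → s5.a a = s3.a a := fun a h1 =>
        F5.a a (by simp [refineQuery, rangeMax, packedMax, sparseMax, upd, Cmd.arrs, h1])
      have v5 : ∀ x ∈ [Var.lv, .s1, .s2], s5.v x = s2.v x := fun x hx => by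
        rw [F5.v _ (by revert x; decide), v3 _ (by revert x; decide)]
      have t5 := t3.frame F5 (by decide)
      refine (runs_refineQuery h hI (s := s5.setv .qi i) (c5.setv _ (by decide))
        (t5.congr rfl rfl rfl rfl) (fun j hj => ?_) (i := i) hk ?_ ?_
        (by simp) hi (f := f) (chL := s1.a .ch) (hS ▸ hL3.congr (a5 _ (by decide))
          (fun _ _ => by rw [St.setv_a, a5 _ (by decide)])
          (a5 _ (by decide)) (a5 _ (by decide))) hP1.ch
        (h5 i hi le_rfl) (hP1.eq i hi)
        (lv := fun j => if j < i then k + 1 else k)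
        ⟨by simpa using hP5.q, hP5.re, hP5.el, hP5.eh, hP5.ch, hP5.le, hP5.eq, hP5.st⟩
        (by simp)).mono ?_
      · rw [St.setv_a, a5 _ (by decide)]; exact l3 j hj
      · simp [v5 .lv (by simp)]; simp [hs2]
      · simp [v5 .s2 (by simp)]; simp [hs2, hS]
      rintro s6 u6 ⟨ht6, hP6, h6⟩
      refine ⟨by omega, ?_, fun j hj hij => ?_⟩
      · convert hP6 using 1
        ext j
        rw [Function.update_apply]
        split <;> split <;> (try split) <;> omega
      · rw [h6 j hj (by omega)]
        exact h5 j hj (by omega)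
    · rintro s5 T5 F5 ⟨hT5, hP5, -⟩
      have hq4 : Ex.eval s3 (Ex.var .q) = I.q := hP3.q
      rw [hq4] at hT5 hP5
      refine ⟨?_, ?_⟩
      · rw [add_mul, one_mul]; simp; omega
      · refine ⟨hP5.q, hP5.re, hP5.el, hP5.eh, hP5.ch, hP5.le, hP5.eq, fun j hj => ?_⟩
        have := hP5.st j hj
        rwa [if_pos hj] at this
  · rintro s1 T F ⟨hT, hP1⟩
    have hb : Ex.eval s (Ex.var .b) = P.b := hs.b
    rw [hb] at hT hP1
    refine ⟨?_, hP1⟩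
    have h3 : 1 * P.m ≤ P.b * P.m := Nat.mul_le_mul_right _ h.one_le_b
    simp; omega

/-- The result after both passes. -/
lemma Prog.answer {P : Par} {I : Inst} (hI : I.Good P) {s : St}
    (h : Prog P I (fun _ => P.b * P.b) (fun _ => P.b) s) {i : ℕ} (hi : i < I.q) :
    (s.a .res i = 0 ∧ I.V i = ∅) ∨ (s.a .res i ≠ 0 ∧ IsLeast (I.V i) (s.a .ch (I.el i))) := by
  rcases h.st i hi with ⟨h0, -, hU⟩ | ⟨h0, hb, a, ha, -, hx⟩
  · refine Or.inl ⟨h0, Set.eq_empty_iff_forall_notMem.2 fun v hv => hU v hv ?_⟩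
    obtain ⟨e, he, rfl, -⟩ := hv
    rw [Nat.div_eq_of_lt (hI.c_lt _ (hI.el_lt i hi)),
      Nat.div_eq_of_lt (hI.c_lt _ (he.2.2.trans (hI.eh_lt i hi)))]
  · refine Or.inr ⟨by omega, ?_⟩
    rw [max_eq_right hb] at hx
    simp at hx
    rw [hx]; exact ha

/-- Writing the answers to the memory cells that follow the input. The characters of items are
larger by one than those of the string. -/
def output : Cmd :=
  .for_ .qi Var.q (
    .x ::= Var.n + 3 * Var.q + 3 + Var.qi ;;
    .iflt (.get .res Var.qi) 1 (.put .inp Var.x Var.sg)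
      (.put .inp Var.x (.get .ch (.get .el Var.qi) - 1)))

lemma runs_output {M L n q : ℕ} {s : St} (hn : s.v .n = n) (hq : s.v .q = q)
    (hL : n + 4 * q + 8 ≤ L) (hM : L ≤ M) (hel : ∀ i < q, s.a .el i < L)
    (hch : ∀ i < q, s.a .res i ≠ 0 → 1 ≤ s.a .ch (s.a .el i)) :
    Runs M L output s fun s' t => t ≤ 60 * q + 10 ∧ ∀ i < q, s'.a .inp (n + 3 * q + 3 + i) =
      if s.a .res i = 0 then s.v .sg else s.a .ch (s.a .el i) - 1 := by
  unfold output
  refine runs_for (fun k s' T => T ≤ 60 * k ∧ ∀ i < k, s'.a .inp (n + 3 * q + 3 + i) =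
      if s.a .res i = 0 then s.v .sg else s.a .ch (s.a .el i) - 1) ?_ ?_ ?_ ?_
  · simp
  · simp
  · rintro k s1 T hk F ⟨hT, hI⟩
    have hk : k < q := by simpa [hq] using hk
    have e1 : s1.v .n = n := by rw [F.v _ (by decide), hn]
    have e2 : s1.v .q = q := by rw [F.v _ (by decide), hq]
    have e3 : s1.v .sg = s.v .sg := F.v _ (by decide)
    have e4 : ∀ a ∈ [Arr.res, .el, .ch], s1.a a = s.a a := fun a ha => F.a _ (by revert a; decide)
    have g := hel k hk
    have hc := hch k hk
    simp [runs_iflt, e1, e2, e3, e4, and_assoc]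
    repeat refine ⟨by omega, ?_⟩
    refine ⟨fun h0 => ?_, fun h0 => ?_⟩
    · repeat refine ⟨by omega, ?_⟩
      intro i hi
      rcases hi.lt_or_eq with hi | rfl
      · rw [Function.update_of_ne (by omega), hI i hi]
      · simp [h0]
    · have hc := hc (by omega)
      repeat refine ⟨by omega, ?_⟩
      intro i hi
      rcases hi.lt_or_eq with hi | rfl
      · rw [Function.update_of_ne (by omega), hI i hi]
      · simp [show s.a .res i ≠ 0 by omega]
  · rintro s1 T F ⟨hT, hI⟩
    simp [hq] at hT hI ⊢
    exact ⟨by omega, hI⟩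

/-! ### Queries as items among the string positions -/

/-- The keys for merging the string positions with the ends of the query ranges: the position `i`
has key `2 * i + 1`, and the range from `lo` to `hi` has its ends directly before and after. -/
def evKey (n q : ℕ) (lo hi : ℕ → ℕ) (j : ℕ) : ℕ :=
  if j < n then 2 * j + 1 else if j < n + q then 2 * lo (j - n) else 2 * hi (j - n - q) + 2

/-- Making the keys. -/
def eventKeys : Cmd :=
  .for_ .i Var.n (.put .key Var.i (2 * Var.i + 1)) ;;
  .for_ .i Var.q (
    .x ::= Var.n + 3 + 3 * Var.i ;;
    .put .key (Var.n + Var.i) (2 * .get .inp Var.x) ;;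
    .put .key (Var.n + Var.q + Var.i) (2 * .get .inp (Var.x + 1) + 2))

/-- Making the items in sorted order. -/
def eventItems : Cmd :=
  .for_ .i Var.n (
    .x ::= .get .pos Var.i ;;
    .put .ch Var.x (.get .inp (3 + Var.i) + 1) ;; .put .re Var.x 1) ;;
  .for_ .i Var.q (
    .y ::= .get .inp (Var.n + 3 + 3 * Var.i + 2) ;;
    .x ::= .get .pos (Var.n + Var.i) ;;
    .put .ch Var.x Var.y ;; .put .re Var.x 0 ;; .put .el Var.i Var.x ;;
    .x ::= .get .pos (Var.n + Var.q + Var.i) ;;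
    .put .ch Var.x Var.y ;; .put .re Var.x 0 ;; .put .eh Var.i Var.x ;;
    .put .res Var.i 0)

/-- Making the sequence of items. -/
def events : Cmd := eventKeys ;; rankSort ;; eventItems

/-- The sequence of items has been made for the string `f` of length `n` and the queries with ranges
from `lo` to `hi` and characters `c`. String characters are stored increased by one, so that
characters that are at least `c` become those above `c`. -/
structure Events (n q : ℕ) (f lo hi c : ℕ → ℕ) (s : St) : Prop where
  re : ∀ i < n, s.a .re (lexRank (evKey n q lo hi) (n + 2 * q) i) = 1
  ch : ∀ i < n, s.a .ch (lexRank (evKey n q lo hi) (n + 2 * q) i) = f i + 1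
  el : ∀ i < q, s.a .el i = lexRank (evKey n q lo hi) (n + 2 * q) (n + i)
  eh : ∀ i < q, s.a .eh i = lexRank (evKey n q lo hi) (n + 2 * q) (n + q + i)
  re_el : ∀ i < q, s.a .re (lexRank (evKey n q lo hi) (n + 2 * q) (n + i)) = 0
  re_eh : ∀ i < q, s.a .re (lexRank (evKey n q lo hi) (n + 2 * q) (n + q + i)) = 0
  ch_el : ∀ i < q, s.a .ch (lexRank (evKey n q lo hi) (n + 2 * q) (n + i)) = c i
  ch_eh : ∀ i < q, s.a .ch (lexRank (evKey n q lo hi) (n + 2 * q) (n + q + i)) = c i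
  res : ∀ i < q, s.a .res i = 0

lemma runs_eventKeys {M L n q : ℕ} {lo hi : ℕ → ℕ} {s : St} (hn : s.v .n = n) (hq : s.v .q = q)
    (hL : 4 * (n + 2 * q) + 20 ≤ L) (hM : 4 * L ≤ M)
    (hlo : ∀ i < q, s.a .inp (n + 3 + 3 * i) = lo i)
    (hhi : ∀ i < q, s.a .inp (n + 3 + 3 * i + 1) = hi i)
    (hlon : ∀ i < q, lo i < n) (hhin : ∀ i < q, hi i < n) :
    Runs M L eventKeys s fun s' t => t ≤ 60 * (n + 2 * q) + 10 ∧
      ∀ j < n + 2 * q, s'.a .key j = evKey n q lo hi j := by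
  unfold eventKeys
  simp only [runs_seq]
  refine runs_for (fun k s' T => T ≤ 20 * k ∧ ∀ j < k, s'.a .key j = evKey n q lo hi j) ?_ ?_ ?_ ?_
  · simp
  · simp
  · rintro k s1 T hk F ⟨hT, hI⟩
    have hk : k < n := by simpa [hn] using hk
    simp [and_assoc]
    repeat refine ⟨by omega, ?_⟩
    intro j hj
    rcases hj.lt_or_eq with hj | rfl
    · rw [Function.update_of_ne (by omega), hI j hj]
    · simp [evKey, hk]
  rintro s1 T1 F1 ⟨hT1, hI1⟩
  have n1 : s1.v .n = n := by rw [F1.v _ (by decide), hn]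
  have q1 : s1.v .q = q := by rw [F1.v _ (by decide), hq]
  have i1 : s1.a .inp = s.a .inp := F1.a _ (by decide)
  have hn' : Ex.eval s (Ex.var .n) = n := hn
  rw [hn'] at hT1 hI1
  refine runs_for (fun k s' T => T ≤ 60 * k ∧ (∀ j < n, s'.a .key j = evKey n q lo hi j) ∧
    ∀ j < k, s'.a .key (n + j) = 2 * lo j ∧ s'.a .key (n + q + j) = 2 * hi j + 2) ?_ ?_ ?_ ?_
  · simp
  · simpa using hI1
  · rintro k s2 T hk F ⟨hT, hI, hI'⟩
    have hk : k < q := by simpa [q1] using hk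
    have n2 : s2.v .n = n := by rw [F.v _ (by decide), n1]
    have q2 : s2.v .q = q := by rw [F.v _ (by decide), q1]
    have i2 : s2.a .inp = s.a .inp := by rw [F.a _ (by decide), i1]
    have := hlon k hk
    have := hhin k hk
    simp [n2, q2, i2, hlo k hk, hhi k hk, and_assoc]
    repeat refine ⟨by omega, ?_⟩
    refine ⟨fun j hj => ?_, fun j hj => ?_⟩
    · rw [Function.update_of_ne (by omega), Function.update_of_ne (by omega), hI j hj]
    · rcases hj.lt_or_eq with hj | rfl
      · rw [Function.update_of_ne (by omega), Function.update_of_ne (by omega),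
          Function.update_of_ne (by omega), Function.update_of_ne (by omega)]
        exact hI' j hj
      · rw [Function.update_of_ne (by omega), Function.update_self, Function.update_self]
        simp
  · rintro s2 T2 F2 ⟨hT2, hI2, hI2'⟩
    have hq' : Ex.eval s1 (Ex.var .q) = q := q1
    rw [hq'] at hT2 hI2'
    refine ⟨by simp; omega, fun j hj => ?_⟩
    by_cases h1 : j < n
    · exact hI2 j h1
    · by_cases h2 : j < n + q
      · have := (hI2' (j - n) (by omega)).1
        rw [show n + (j - n) = j by omega] at this
        simp [evKey, h1, h2, this]
      · have := (hI2' (j - n - q) (by omega)).2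
        rw [show n + q + (j - n - q) = j by omega] at this
        simp [evKey, h1, h2, this]

lemma runs_eventItems {M L n q m : ℕ} {f c R : ℕ → ℕ} {s3 : St} (n3 : s3.v .n = n)
    (q3 : s3.v .q = q) (hmd : m = n + 2 * q) (hL : 4 * m + 20 ≤ L) (hM : 4 * L ≤ M)
    (hpos : ∀ i < m, s3.a .pos i = R i) (hRm : ∀ i < m, R i < m)
    (hRne : ∀ i < m, ∀ j < m, i ≠ j → R i ≠ R j) (hf : ∀ i < n, s3.a .inp (3 + i) = f i)
    (hc : ∀ i < q, s3.a .inp (n + 3 + 3 * i + 2) = c i) (hfn : ∀ i < n, f i < n) :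
    Runs M L eventItems s3 fun s' t => t ≤ 140 * m + 20 ∧ (∀ j < n, s'.a .re (R j) = 1 ∧
      s'.a .ch (R j) = f j + 1) ∧ ∀ j < q, s'.a .el j = R (n + j) ∧ s'.a .eh j = R (n + q + j) ∧
      s'.a .re (R (n + j)) = 0 ∧ s'.a .re (R (n + q + j)) = 0 ∧ s'.a .ch (R (n + j)) = c j ∧
      s'.a .ch (R (n + q + j)) = c j ∧ s'.a .res j = 0 := by
  unfold eventItems
  simp only [runs_seq]
  refine runs_for (fun k s' T => T ≤ 60 * k ∧ ∀ j < k, s'.a .re (R j) = 1 ∧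
    s'.a .ch (R j) = f j + 1) ?_ ?_ ?_ ?_
  · simp
  · simp
  · rintro k s4 T hk F ⟨hT, hI⟩
    have hk : k < n := by simpa [n3] using hk
    have p4 : s4.a .pos k = R k := by rw [F.a _ (by decide), hpos k (by omega)]
    have i4 : s4.a .inp = s3.a .inp := by rw [F.a _ (by decide)]
    have := hfn k hk
    have := hRm k (by omega)
    simp [p4, i4, hf k hk, and_assoc]
    repeat refine ⟨by omega, ?_⟩
    intro j hj
    rcases hj.lt_or_eq with hj | rfl
    · rw [Function.update_of_ne (hRne j (by omega) k (by omega) hj.ne),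
        Function.update_of_ne (hRne j (by omega) k (by omega) hj.ne)]
      exact hI j hj
    · simp
  rintro s4 T4 F4 ⟨hT4, hI4⟩
  have n4 : s4.v .n = n := by rw [F4.v _ (by decide), n3]
  have q4 : s4.v .q = q := by rw [F4.v _ (by decide), q3]
  have i4 : s4.a .inp = s3.a .inp := by rw [F4.a _ (by decide)]
  have hpos4 : ∀ i < m, s4.a .pos i = R i := fun i hi => by rw [F4.a _ (by decide), hpos i hi]
  have hn3 : Ex.eval s3 (Ex.var .n) = n := n3
  rw [hn3] at hT4 hI4
  refine runs_for (fun k s' T => T ≤ 140 * k ∧ (∀ j < n, s'.a .re (R j) = 1 ∧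
    s'.a .ch (R j) = f j + 1) ∧ ∀ j < k, s'.a .el j = R (n + j) ∧ s'.a .eh j = R (n + q + j) ∧
    s'.a .re (R (n + j)) = 0 ∧ s'.a .re (R (n + q + j)) = 0 ∧ s'.a .ch (R (n + j)) = c j ∧
    s'.a .ch (R (n + q + j)) = c j ∧ s'.a .res j = 0) ?_ ?_ ?_ ?_
  · simp
  · simpa using hI4
  · rintro k s5 T hk F ⟨hT, hI, hI'⟩
    have hk : k < q := by simpa [q4] using hk
    have n5 : s5.v .n = n := by rw [F.v _ (by decide), n4]
    have q5 : s5.v .q = q := by rw [F.v _ (by decide), q4]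
    have i5 : s5.a .inp = s3.a .inp := by rw [F.a _ (by decide), i4]
    have p5 : ∀ i < m, s5.a .pos i = R i := fun i hi => by rw [F.a _ (by decide), hpos4 i hi]
    have r1 := hRm (n + k) (by omega)
    have r2 := hRm (n + q + k) (by omega)
    have U : ∀ (g : ℕ → ℕ) (x : ℕ) (j : ℕ), j < m → j ≠ n + k → j ≠ n + q + k →
        Function.update (Function.update g (R (n + k)) x) (R (n + q + k)) x (R j) = g (R j) := by
      intro g x j hj h1 h2
      rw [Function.update_of_ne (hRne _ hj _ (by omega) h2),
        Function.update_of_ne (hRne _ hj _ (by omega) h1)]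
    have U' : ∀ (g : ℕ → ℕ) (x : ℕ),
        Function.update (Function.update g (R (n + k)) x) (R (n + q + k)) x (R (n + k)) = x := by
      intro g x
      rw [Function.update_of_ne (hRne _ (by omega) _ (by omega) (by omega)), Function.update_self]
    simp [n5, q5, i5, hc k hk, p5 (n + k) (by omega), p5 (n + q + k) (by omega), and_assoc]
    repeat refine ⟨by omega, ?_⟩
    refine ⟨fun j hj => ?_, fun j hj => ?_⟩
    · rw [U _ _ _ (by omega) (by omega) (by omega), U _ _ _ (by omega) (by omega) (by omega)]
      exact hI j hj
    · rcases hj.lt_or_eq with hj | rfl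
      · simp only [U _ _ (n + j) (by omega) (by omega) (by omega),
          U _ _ (n + q + j) (by omega) (by omega) (by omega), Function.update_of_ne hj.ne]
        exact hI' j hj
      · simp [U']
  · rintro s5 T5 F5 ⟨hT5, hI5, hI5'⟩
    have hq4 : Ex.eval s4 (Ex.var .q) = q := q4
    rw [hq4] at hT5 hI5'
    exact ⟨by simp; omega, hI5, hI5'⟩

lemma runs_events {M L n q : ℕ} {f lo hi c : ℕ → ℕ} {s : St} (hn : s.v .n = n) (hq : s.v .q = q)
    (hm : s.v .m = n + 2 * q) (hL : 4 * (n + 2 * q) + 20 ≤ L) (hM : 4 * L ≤ M)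
    (hf : ∀ i < n, s.a .inp (3 + i) = f i) (hlo : ∀ i < q, s.a .inp (n + 3 + 3 * i) = lo i)
    (hhi : ∀ i < q, s.a .inp (n + 3 + 3 * i + 1) = hi i)
    (hc : ∀ i < q, s.a .inp (n + 3 + 3 * i + 2) = c i) (hfn : ∀ i < n, f i < n)
    (hlon : ∀ i < q, lo i < n) (hhin : ∀ i < q, hi i < n) :
    Runs M L events s fun s' t => t ≤ 500 * (n + 2 * q) + 400 ∧ Events n q f lo hi c s' := by
  unfold events
  simp only [runs_seq]
  refine (runs_eventKeys hn hq hL hM hlo hhi hlon hhin).frame.mono ?_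
  rintro s2 T2 ⟨F2, hT2, hkey⟩
  have m2 : s2.v .m = n + 2 * q := by rw [F2.v _ (by decide), hm]
  refine (runs_rankSort m2 (by omega) (by omega) (fun j hj => ?_)).frame.mono ?_
  · rw [hkey j hj, evKey]
    split
    · omega
    · split
      · have := hlon (j - n) (by omega); omega
      · have := hhin (j - n - q) (by omega); omega
  rintro s3 T3 ⟨F3, hT3, hI3⟩
  have e3 : s3.a .inp = s.a .inp := by rw [F3.a _ (by decide), F2.a _ (by decide)]
  refine (runs_eventItems (f := f) (c := c) (R := lexRank (evKey n q lo hi) (n + 2 * q))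
    (by rw [F3.v _ (by decide), F2.v _ (by decide), hn])
    (by rw [F3.v _ (by decide), F2.v _ (by decide), hq]) rfl hL hM
    (fun i hi => by rw [hI3 i hi]; exact lexRank_congr hkey hi) (fun i hi => lexRank_lt hi)
    (fun i hi j hj hne e => hne (lexRank_inj hi hj e)) (by rw [e3]; exact hf)
    (by rw [e3]; exact hc) hfn).mono ?_
  rintro s5 T5 ⟨hT5, hI5, hI5'⟩
  exact ⟨by omega, ⟨fun i hi => (hI5 i hi).1, fun i hi => (hI5 i hi).2,
    fun i hi => (hI5' i hi).1, fun i hi => (hI5' i hi).2.1, fun i hi => (hI5' i hi).2.2.1,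
    fun i hi => (hI5' i hi).2.2.2.1, fun i hi => (hI5' i hi).2.2.2.2.1,
    fun i hi => (hI5' i hi).2.2.2.2.2.1, fun i hi => (hI5' i hi).2.2.2.2.2.2⟩⟩

/-- The batch of queries on the items. -/
def inst (q : ℕ) (s : St) : Inst := ⟨q, s.a .re, s.a .el, s.a .eh, s.a .ch⟩

lemma Events.good {P : Par} {n q σ : ℕ} {f lo hi c : ℕ → ℕ} {s : St} (h : Events n q f lo hi c s)
    (hm : P.m = n + 2 * q) (hσ : σ ≤ n) (hb : σ < 2 ^ (P.b * P.b)) (hf : ∀ i < n, f i < σ)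
    (hc : ∀ i < q, c i < σ) : (inst q s).Good P := by
  have hch : ∀ e < P.m, s.a .ch e ≤ σ := by
    intro e he
    rw [hm] at he
    obtain ⟨i, hi, rfl⟩ := exists_lexRank (key := evKey n q lo hi) he
    by_cases h1 : i < n
    · rw [h.ch i h1]; exact hf i h1
    · by_cases h2 : i < n + q
      · have := h.ch_el (i - n) (by omega)
        rw [show n + (i - n) = i by omega] at this
        rw [this]; exact (hc _ (by omega)).le
      · have := h.ch_eh (i - n - q) (by omega)
        rw [show n + q + (i - n - q) = i by omega] at this
        rw [this]; exact (hc _ (by omega)).le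
  refine ⟨by simp [inst]; omega, ?_, ?_, ?_, ?_, ?_, ?_, ?_,
    fun e he => (hch e he).trans (by omega),
    ?_, fun e he => (hch e he).trans_lt hb⟩ <;> simp only [inst] <;> intro i hi'
  · rw [h.el i hi', hm]; exact lexRank_lt (by omega)
  · rw [h.eh i hi', hm]; exact lexRank_lt (by omega)
  · rw [h.el i hi', h.re_el i hi']; omega
  · rw [h.eh i hi', h.re_eh i hi']; omega
  · intro j hj e
    rw [h.el i hi', h.el j hj] at e
    have := lexRank_inj (by omega) (by omega) e
    omega
  · intro j hj e
    rw [h.eh i hi', h.eh j hj] at e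
    have := lexRank_inj (by omega) (by omega) e
    omega
  · intro j hj e
    rw [h.el i hi', h.eh j hj] at e
    have := lexRank_inj (by omega) (by omega) e
    omega
  · rw [h.el i hi', h.eh i hi', h.ch_el i hi', h.ch_eh i hi']

/-- The candidates of a query are the characters that are asked for. -/
lemma Events.mem_V {P : Par} {n q : ℕ} {f lo hi c : ℕ → ℕ} {s : St} (h : Events n q f lo hi c s)
    {i v : ℕ} (hi' : i < q) (hm : P.m = n + 2 * q) (hG : (inst q s).Good P) :
    v ∈ (inst q s).V i ↔ c i < v ∧ ∃ k < n, lo i ≤ k ∧ k ≤ hi i ∧ f k + 1 = v := by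
  have k1 : evKey n q lo hi (n + i) = 2 * lo i := by simp [evKey, hi']
  have k2 : evKey n q lo hi (n + q + i) = 2 * hi i + 2 := by
    simp [evKey, show ¬ n + q + i < n by omega]
    congr 1; omega
  have k3 : ∀ k < n, evKey n q lo hi k = 2 * k + 1 := fun k hk => by simp [evKey, hk]
  have hin : ∀ k < n, ((inst q s).In i (lexRank (evKey n q lo hi) (n + 2 * q) k) ↔
      lo i ≤ k ∧ k ≤ hi i) := by
    intro k hk
    simp only [Inst.In, inst, h.re k hk, h.el i hi', h.eh i hi']
    rw [lexRank_lt_iff (by omega) (by omega), lexRank_lt_iff (by omega) (by omega), k1, k2, k3 k hk]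
    omega
  have hce : (inst q s).c ((inst q s).el i) = c i := by
    simp only [inst, h.el i hi', h.ch_el i hi']
  constructor
  · rintro ⟨e, he, rfl, hlt⟩
    have hem : e < P.m := he.2.2.trans (hG.eh_lt i hi')
    rw [hm] at hem
    obtain ⟨k, hk, rfl⟩ := exists_lexRank (key := evKey n q lo hi) hem
    have hkn : k < n := by
      by_contra hkn
      have hre := he.1
      simp only [inst] at hre
      by_cases h2 : k < n + q
      · have := h.re_el (k - n) (by omega)
        rw [show n + (k - n) = k by omega] at this
        omega
      · have := h.re_eh (k - n - q) (by omega)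
        rw [show n + q + (k - n - q) = k by omega] at this
        omega
    obtain ⟨g1, g2⟩ := (hin k hkn).1 he
    exact ⟨hce ▸ hlt, k, hkn, g1, g2, (h.ch k hkn).symm⟩
  · rintro ⟨hlt, k, hk, g1, g2, rfl⟩
    exact ⟨_, (hin k hk).2 ⟨g1, g2⟩, h.ch k hk, hce ▸ hlt⟩

lemma Events.prog {P : Par} {n q : ℕ} {f lo hi c : ℕ → ℕ} {s : St} (h : Events n q f lo hi c s)
    (hq : s.v .q = q) (hG : (inst q s).Good P) :
    Prog P (inst q s) (fun _ => 0) (fun _ => 0) s := by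
  refine ⟨hq, fun _ _ => rfl, fun _ _ => rfl, fun _ _ => rfl, fun _ _ _ => rfl, hG.c_le, hG.c_eh,
    fun i hi => Or.inl ⟨h.res i hi, rfl, ?_⟩⟩
  rintro v ⟨e, -, rfl, hlt⟩
  simpa using hlt.ne'

/-! ### Choosing the parameters -/

/-- The number of bits of a digit is the least positive `b` such that numbers up to `σ` have at most
`b` digits. The bound includes `σ` because characters are stored increased by one. -/
def IsDigitSize (σ b : ℕ) : Prop :=
  1 ≤ b ∧ σ < 2 ^ (b * b) ∧ (b = 1 ∨ 2 ^ ((b - 1) * (b - 1)) ≤ σ)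

/-- The number `g = 2 ^ gm` of digits in a word is about the square root of the logarithm of `m`:
the logarithm is between `16 * g ^ 2` and `64 * g ^ 2`, unless `g = 1` and it is smaller. -/
def IsPackSize (m gm : ℕ) : Prop :=
  m < 2 ^ (64 * (2 ^ gm * 2 ^ gm)) ∧ (gm = 0 ∨ 2 ^ (16 * (2 ^ gm * 2 ^ gm)) ≤ m)

/-- The chosen sizes are suitable. As `b - 1` is at most the square root of the logarithm of `m`,
the upper bound for the latter gives `b ≤ 8 * g`, and the lower bound gives `2 ^ (3 * b * g) ≤ m`
for the size of the tables; without lower bound `g = 1`, and the size is bounded by a constant. -/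
lemma Par.good_of_size {P : Par} {L M σ : ℕ} (hσ : 2 ≤ σ) (hm : σ ≤ P.m) (hb : IsDigitSize σ P.b)
    (hg : IsPackSize P.m P.gm) (hL : 2 ^ 26 * P.m ≤ L) (hM : 64 * L ≤ M) : P.Good L M := by
  obtain ⟨hb1, hb2, hb3⟩ := hb
  obtain ⟨hg1, hg2⟩ := hg
  have hg0 := P.g_pos
  have hgp : 2 ^ P.gm = P.g := rfl
  rw [hgp] at hg1 hg2
  have hb8 : P.b ≤ 8 * P.g := by
    rcases hb3 with hb3 | hb3
    · omega
    · have h1 := (Nat.pow_lt_pow_iff_right (by norm_num)).1 (hb3.trans_lt (hm.trans_lt hg1))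
      have h2 : P.b - 1 < 8 * P.g := by
        by_contra hn
        have := Nat.mul_le_mul (not_lt.1 hn) (not_lt.1 hn)
        nlinarith
      omega
  refine ⟨by omega, hb1, hb8, ?_, hg1, ?_, hL, hM⟩
  · rcases hg2 with h0 | h0
    · have : P.g = 1 := by rw [Par.g, h0]; rfl
      rw [this]; omega
    · have : 16 * (P.g * P.g) < 2 ^ (16 * (P.g * P.g)) := Nat.lt_two_pow_self
      omega
  · have h1 : P.b * P.tw * P.tw ≤ 2 ^ (3 * (P.b * P.g)) := by
      have h2 : P.b ≤ P.tw := ((Nat.le_mul_of_pos_right _ hg0).trans Nat.lt_two_pow_self.le)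
      calc P.b * P.tw * P.tw ≤ P.tw * P.tw * P.tw := by gcongr
        _ = 2 ^ (3 * (P.b * P.g)) := by rw [Par.tw, ← pow_add, ← pow_add]; congr 1; ring
    refine h1.trans ?_
    rcases hg2 with h0 | h0
    · have : P.g = 1 := by rw [Par.g, h0]; rfl
      calc 2 ^ (3 * (P.b * P.g)) ≤ 2 ^ 24 := Nat.pow_le_pow_right (by norm_num) (by
          rw [this] at hb8 ⊢; omega)
        _ ≤ 2 ^ 24 * P.m := Nat.le_mul_of_pos_right _ (by omega)
    · -- Both `b - 1` and `4 * g` are at most the square root of the logarithm of `m`.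
      have hm0 : P.m ≠ 0 := by omega
      have h2 := (Nat.le_log_iff_pow_le (by norm_num) hm0).2 h0
      have h3 : (P.b - 1) * (P.b - 1) ≤ Nat.log 2 P.m := by
        rcases hb3 with hb3 | hb3
        · rw [hb3]; omega
        · exact (Nat.le_log_iff_pow_le (by norm_num) hm0).2 (hb3.trans hm)
      obtain ⟨x, hx⟩ : ∃ x, P.b = x + 1 := ⟨P.b - 1, by omega⟩
      rw [hx, Nat.add_sub_cancel] at h3
      have h4 : 3 * (P.b * P.g) ≤ Nat.log 2 P.m := by
        rw [hx]
        have : x * (4 * P.g) * 2 ≤ x * x + 4 * P.g * (4 * P.g) := by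
          have := two_mul_le_add_sq x (4 * P.g)
          nlinarith
        nlinarith
      calc 2 ^ (3 * (P.b * P.g)) ≤ P.m := (Nat.le_log_iff_pow_le (by norm_num) hm0).1 h4
        _ ≤ 2 ^ 24 * P.m := Nat.le_mul_of_pos_left _ (by norm_num)

/-- Choosing the number of bits of a digit. -/
def chooseB : Cmd :=
  .b ::= 1 ;;
  .for_ .i Var.n (.iflt 0 (Var.sg >>: (Var.b * Var.b)) (.b ::= Var.b + 1) .skip)

lemma runs_chooseB {M L n σ : ℕ} {s : St} (hn : s.v .n = n) (hσ : s.v .sg = σ) (h2 : σ ≤ n)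
    (hM : 8 * n + 8 ≤ M) :
    Runs M L chooseB s fun s' t => t ≤ 30 * n + 10 ∧ IsDigitSize σ (s'.v .b) := by
  unfold chooseB
  simp only [runs_seq, runs_set, Ex.eval_ofNat]
  refine ⟨by simp; omega, ?_⟩
  refine runs_for (fun k s' T => T ≤ 30 * k ∧ 1 ≤ s'.v .b ∧ s'.v .b ≤ k + 1 ∧
    (σ < 2 ^ (s'.v .b * s'.v .b) ∨ s'.v .b = k + 1) ∧
    (s'.v .b = 1 ∨ 2 ^ ((s'.v .b - 1) * (s'.v .b - 1)) ≤ σ)) ?_ ?_ ?_ ?_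
  · simp
  · simp
  · rintro k s1 T hk F ⟨hT, hb1, hbk, hb2, hb3⟩
    have e1 : s1.v .sg = σ := by rw [F.v _ (by decide)]; simpa using hσ
    have hk : k < n := by simpa [hn] using hk
    obtain ⟨b, hb⟩ : ∃ b, b = s1.v .b := ⟨_, rfl⟩
    rw [← hb] at hb1 hbk hb2 hb3
    have hbb : b * b ≤ 4 * n + 4 := by
      rcases hb3 with rfl | hb3
      · omega
      · have : (b - 1) * (b - 1) < 2 ^ ((b - 1) * (b - 1)) := Nat.lt_two_pow_self
        obtain ⟨x, rfl⟩ : ∃ x, b = x + 1 := ⟨b - 1, by omega⟩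
        rw [Nat.add_sub_cancel] at this hb3
        nlinarith
    have hpos : 0 < 2 ^ (b * b) := by positivity
    simp [runs_iflt, e1, ← hb, and_assoc]
    repeat refine ⟨by omega, ?_⟩
    exact fun h3 => ⟨by omega, hb1, by omega, Or.inl h3, hb3⟩
  · rintro s1 T F ⟨hT, hb1, hbk, hb2, hb3⟩
    simp [hn] at hT hb2 ⊢
    refine ⟨by omega, hb1, ?_, hb3⟩
    rcases hb2 with h | h
    · exact h
    · have h4 : s1.v .b * s1.v .b < 2 ^ (s1.v .b * s1.v .b) := Nat.lt_two_pow_self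
      have := Nat.le_mul_self (s1.v .b)
      omega

/-- Choosing the number of digits in a word. -/
def chooseG : Cmd :=
  .gm ::= 0 ;;
  .for_ .i Var.m (
    .g ::= (1 : Ex) <<: Var.gm ;;
    .iflt 0 (Var.m >>: (64 * (Var.g * Var.g))) (.gm ::= Var.gm + 1) .skip)

lemma runs_chooseG {M L m : ℕ} {s : St} (hm : s.v .m = m) (hM : 200 * m + 200 ≤ M) (hm1 : 1 ≤ m) :
    Runs M L chooseG s fun s' t => t ≤ 40 * m + 10 ∧ IsPackSize m (s'.v .gm) := by
  unfold chooseG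
  simp only [runs_seq, runs_set, Ex.eval_ofNat]
  refine ⟨by simp; omega, ?_⟩
  refine runs_for (fun k s' T => T ≤ 40 * k ∧ s'.v .gm ≤ k ∧
    (m < 2 ^ (64 * (2 ^ s'.v .gm * 2 ^ s'.v .gm)) ∨ s'.v .gm = k) ∧
    (s'.v .gm = 0 ∨ 2 ^ (16 * (2 ^ s'.v .gm * 2 ^ s'.v .gm)) ≤ m)) ?_ ?_ ?_ ?_
  · simp
  · simp
  · rintro k s1 T hk F ⟨hT, hbk, hb2, hb3⟩
    have e1 : s1.v .m = m := by rw [F.v _ (by decide)]; simpa using hm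
    have hk : k < m := by simpa [hm] using hk
    obtain ⟨x, hx⟩ : ∃ x, x = s1.v .gm := ⟨_, rfl⟩
    rw [← hx] at hbk hb2 hb3
    have hgg : 16 * (2 ^ x * 2 ^ x) ≤ 16 * m := by
      rcases hb3 with rfl | hb3
      · omega
      · have : 16 * (2 ^ x * 2 ^ x) < 2 ^ (16 * (2 ^ x * 2 ^ x)) := Nat.lt_two_pow_self
        omega
    have hg : 2 ^ x ≤ 2 ^ x * 2 ^ x := Nat.le_mul_self _
    have hpos : 0 < 2 ^ (64 * (2 ^ x * 2 ^ x)) := by positivity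
    simp [runs_iflt, e1, ← hx, and_assoc]
    repeat refine ⟨by omega, ?_⟩
    have e16 : 16 * (2 ^ (x + 1) * 2 ^ (x + 1)) = 64 * (2 ^ x * 2 ^ x) := by ring
    refine ⟨fun h0 => ?_, fun h0 => ?_⟩
    · repeat refine ⟨by omega, ?_⟩
      rw [e16]
      exact h0
    · have h3 : m < 2 ^ (64 * (2 ^ x * 2 ^ x)) := by
        exact h0
      exact ⟨by omega, by omega, Or.inl h3, hb3⟩
  · rintro s1 T F ⟨hT, hbk, hb2, hb3⟩
    simp [hm] at hT hb2 ⊢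
    refine ⟨by omega, ?_, hb3⟩
    rcases hb2 with h | h
    · exact h
    · have h4 : s1.v .gm < 2 ^ s1.v .gm := Nat.lt_two_pow_self
      have h5 : 2 ^ s1.v .gm ≤ 2 ^ s1.v .gm * 2 ^ s1.v .gm := Nat.le_mul_self _
      have h6 : 64 * (2 ^ s1.v .gm * 2 ^ s1.v .gm) < 2 ^ (64 * (2 ^ s1.v .gm * 2 ^ s1.v .gm)) :=
        Nat.lt_two_pow_self
      omega

/-- The table of logarithms. -/
def buildLog : Cmd :=
  .for_ .i (Var.m + 3) (
    .iflt Var.i 2 (.put .lg Var.i 0) (.put .lg Var.i (.get .lg (Var.i >>: 1) + 1)))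

lemma runs_buildLog {M L : ℕ} {P : Par} (h : P.Good L M) {s : St} (hs : Ctx P s) :
    Runs M L buildLog s fun s' t => t ≤ 40 * P.m + 150 ∧ LogTab P s' := by
  have hm2 := h.two_le_m
  have hlL := h.le_L
  have hM := h.le_M
  unfold buildLog
  refine runs_for (fun k s' T => T ≤ 40 * k ∧ ∀ i < k, s'.a .lg i = Nat.log 2 i) ?_ ?_ ?_ ?_
  · simp [hs.m]; omega
  · simp
  · rintro k s1 T hk F ⟨hT, hI⟩
    have hk : k < P.m + 3 := by simpa [hs.m] using hk
    simp [runs_iflt, and_assoc]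
    repeat refine ⟨by omega, ?_⟩
    have hlog : k / 2 < M := by omega
    refine ⟨fun h0 => ?_, fun h0 => ?_⟩
    · repeat refine ⟨by omega, ?_⟩
      intro i hi
      rcases hi.lt_or_eq with hi | rfl
      · rw [Function.update_of_ne hi.ne, hI i hi]
      · rw [Function.update_self, Nat.log_of_lt (by omega)]
    · rw [hI (k / 2) (by omega)]
      have h1 : Nat.log 2 (k / 2) ≤ k / 2 := Nat.log_le_self _ _
      have h2 : Nat.log 2 k = Nat.log 2 (k / 2) + 1 := Nat.log_of_one_lt_of_le (by norm_num) h0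
      repeat refine ⟨by omega, ?_⟩
      intro i hi
      rcases hi.lt_or_eq with hi | rfl
      · rw [Function.update_of_ne hi.ne, hI i hi]
      · rw [Function.update_self, h2]
  · rintro s1 T F ⟨hT, hI⟩
    simp [hs.m] at hT hI ⊢
    exact ⟨by omega, fun i hi => hI i (by omega)⟩

/-- Reading the sizes of the input and choosing the parameters. -/
def setup : Cmd :=
  .n ::= .get .inp 0 ;; .sg ::= .get .inp 1 ;; .q ::= .get .inp 2 ;; .m ::= Var.n + 2 * Var.q ;;
  chooseB ;; chooseG ;;
  .g ::= (1 : Ex) <<: Var.gm ;; .tw ::= (1 : Ex) <<: (Var.b * Var.g) ;;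
  .nw ::= (Var.m >>: Var.gm) + 1 ;; .st ::= Var.nw + 1 ;; .n1 ::= (Var.nw >>: Var.gm) + 1

lemma runs_setup {M L n σ q : ℕ} {s : St} (hn : s.a .inp 0 = n) (hσ : s.a .inp 1 = σ)
    (hq : s.a .inp 2 = q) (h2 : 2 ≤ σ) (h3 : σ ≤ n) (hL : 2 ^ 26 * (n + 2 * q) ≤ L)
    (hM : 64 * L ≤ M) :
    Runs M L setup s fun s' t => t ≤ 100 * (n + 2 * q) + 200 ∧ s'.v .n = n ∧ s'.v .sg = σ ∧
      s'.v .q = q ∧ ∃ P : Par, P.m = n + 2 * q ∧ IsDigitSize σ P.b ∧ P.Good L M ∧ Ctx P s' := by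
  unfold setup
  simp only [runs_seq, runs_set]
  simp [hn, hσ, hq, and_assoc]
  repeat refine ⟨by omega, ?_⟩
  refine (runs_chooseB (n := n) (σ := σ) (by simp) (by simp) h3 (by omega)).frame.mono ?_
  rintro s1 T1 ⟨F1, hT1, hb⟩
  have v1 : ∀ x ∈ [Var.n, .sg, .q, .m], s1.v x = ((((s.setv .n n).setv .sg σ).setv .q q).setv .m
    (n + 2 * q)).v x := fun x hx => F1.v _ (by revert x; decide)
  refine (runs_chooseG (m := n + 2 * q) (by rw [v1 _ (by simp)]; simp) (by omega)
    (by omega)).frame.mono ?_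
  rintro s2 T2 ⟨F2, hT2, hg⟩
  have v2 : ∀ x ∈ [Var.n, .sg, .q, .m], s2.v x = ((((s.setv .n n).setv .sg σ).setv .q q).setv .m
    (n + 2 * q)).v x := fun x hx => by rw [F2.v _ (by revert x; decide), v1 x hx]
  have b2 : s2.v .b = s1.v .b := F2.v _ (by decide)
  set P : Par := ⟨n + 2 * q, s1.v .b, s2.v .gm⟩ with hP
  have hgood : P.Good L M := Par.good_of_size (σ := σ) h2 (by simp [hP]; omega) hb hg hL hM
  have hlL := hgood.le_L
  have hgle := hgood.g_le
  have htL := hgood.tw_le_L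
  have g1 : 2 ^ s2.v .gm = P.g := rfl
  have g2 : 2 ^ (s1.v .b * P.g) = P.tw := rfl
  have hbg : s1.v .b * P.g < P.tw := Nat.lt_two_pow_self
  have hPm : P.m = n + 2 * q := rfl
  have g3 : (n + 2 * q) / P.g + 1 = P.nw := rfl
  have g4 : P.nw / P.g + 1 = P.n1 := rfl
  have hnw := P.nw_le
  have hn1 := P.n1_le
  simp [b2, g1, g2, g3, g4, v2 .n, v2 .sg, v2 .q, v2 .m]
  iterate 12 refine ⟨by omega, ?_⟩
  refine ⟨P, hPm, hb, hgood, ?_⟩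
  constructor <;> simp [b2, v2 .m, hP, Par.st]

/-! ### The program -/

/-- The algorithm in the structured language. -/
def algorithm : Cmd :=
  setup ;; buildLog ;; buildTabs ;; events ;; resolvePass ;; refinePass ;; output

/-- Correctness and running time of the algorithm. The set `V` consists of the candidates of a
query, increased by one. -/
lemma runs_algorithm {M L n σ q : ℕ} {f lo hi c : ℕ → ℕ} {s : St} (hn : s.a .inp 0 = n)
    (hσ : s.a .inp 1 = σ) (hq : s.a .inp 2 = q) (h2 : 2 ≤ σ) (h3 : σ ≤ n)
    (hL : 2 ^ 26 * (n + 2 * q) ≤ L) (hM : 64 * L ≤ M)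
    (hf : ∀ i < n, s.a .inp (3 + i) = f i) (hlo : ∀ i < q, s.a .inp (n + 3 + 3 * i) = lo i)
    (hhi : ∀ i < q, s.a .inp (n + 3 + 3 * i + 1) = hi i)
    (hc : ∀ i < q, s.a .inp (n + 3 + 3 * i + 2) = c i) (hfn : ∀ i < n, f i < σ)
    (hlon : ∀ i < q, lo i < n) (hhin : ∀ i < q, hi i < n) (hcσ : ∀ i < q, c i < σ) :
    Runs M L algorithm s fun s' t => ∃ b, IsDigitSize σ b ∧ t ≤ 2 ^ 33 * (b * (n + 2 * q)) ∧
      ∀ i < q, ∃ V : Set ℕ,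
        (∀ v, v ∈ V ↔ c i < v ∧ ∃ k < n, lo i ≤ k ∧ k ≤ hi i ∧ f k + 1 = v) ∧
        ((V = ∅ ∧ s'.a .inp (n + 3 * q + 3 + i) = σ) ∨
          IsLeast V (s'.a .inp (n + 3 * q + 3 + i) + 1)) := by
  unfold algorithm
  simp only [runs_seq]
  refine (runs_setup hn hσ hq h2 h3 hL hM).frame.mono ?_
  rintro s1 T1 ⟨F1, hT1, n1, sg1, q1, P, hPm, hb, hP, c1⟩
  refine (runs_buildLog hP c1).frame.mono ?_
  rintro s2 T2 ⟨F2, hT2, l2⟩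
  have c2 := c1.frame F2 (by decide)
  refine (runs_buildTabs hP c2).frame.mono ?_
  rintro s3 T3 ⟨F3, hT3, t3⟩
  have c3 := c2.frame F3 (by decide)
  have l3 : LogTab P s3 := fun i hi => by rw [F3.a _ (by decide), l2 i hi]
  have v3 : ∀ x ∈ [Var.n, .sg, .q], s3.v x = s1.v x := fun x hx => by
    rw [F3.v _ (by revert x; decide), F2.v _ (by revert x; decide)]
  have i3 : s3.a .inp = s.a .inp := by
    rw [F3.a _ (by decide), F2.a _ (by decide), F1.a _ (by decide)]
  refine (runs_events (n := n) (q := q) (f := f) (lo := lo) (hi := hi) (c := c)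
    (by rw [v3 _ (by simp), n1]) (by rw [v3 _ (by simp), q1]) (by rw [c3.m, hPm]) (by omega)
    (by omega) (by rw [i3]; exact hf) (by rw [i3]; exact hlo) (by rw [i3]; exact hhi)
    (by rw [i3]; exact hc) (fun i hi => (hfn i hi).trans_le h3) hlon hhin).frame.mono ?_
  rintro s4 T4 ⟨F4, hT4, hE⟩
  have c4 := c3.frame F4 (by decide)
  have t4 := t3.frame F4 (by decide)
  have l4 : LogTab P s4 := fun i hi => by rw [F4.a _ (by decide), l3 i hi]
  have v4 : ∀ x ∈ [Var.n, .sg, .q], s4.v x = s1.v x := fun x hx => by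
    rw [F4.v _ (by revert x; decide), v3 x hx]
  have hI : (inst q s4).Good P := hE.good hPm h3 hb.2.1 hfn hcσ
  refine (runs_resolvePass hP hI c4 t4 l4 (hE.prog (by rw [v4 _ (by simp), q1]) hI)).frame.mono ?_
  rintro s5 T5 ⟨F5, hT5, hP5⟩
  have c5 := c4.frame F5 (by decide)
  have t5 := t4.frame F5 (by decide)
  have l5 : LogTab P s5 := fun i hi => by rw [F5.a _ (by decide), l4 i hi]
  refine (runs_refinePass hP hI c5 t5 l5 hP5).frame.mono ?_
  rintro s6 T6 ⟨F6, hT6, hP6⟩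
  have v6 : ∀ x ∈ [Var.n, .sg, .q], s6.v x = s1.v x := fun x hx => by
    rw [F6.v _ (by revert x; decide), F5.v _ (by revert x; decide), v4 x hx]
  have hlL := hP.le_L
  refine (runs_output (n := n) (q := q) (by rw [v6 _ (by simp), n1]) (by rw [v6 _ (by simp), q1])
    (by omega) (by omega) (fun i hi => ?_) (fun i hi h0 => ?_)).mono ?_
  · rw [hP6.el i hi]
    have := hI.el_lt i hi
    omega
  · rw [hP6.el i hi]
    rcases hP6.answer hI hi with h | h
    · exact absurd h.1 h0
    · obtain ⟨e, -, -, hlt⟩ := h.2.1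
      omega
  rintro s7 T7 ⟨hT7, ho⟩
  refine ⟨P.b, hb, ?_, fun i hi => ⟨(inst q s4).V i, fun v => hE.mem_V hi hPm hI, ?_⟩⟩
  · rw [← hPm] at hT1 hT4 ⊢
    have h5 : 1 * P.m ≤ P.b * P.m := Nat.mul_le_mul_right _ hP.one_le_b
    omega
  · rw [ho i hi, hP6.el i hi, v6 _ (by simp), sg1]
    rcases hP6.answer hI hi with h | h
    · rw [if_pos h.1]; exact Or.inl ⟨h.2, rfl⟩
    · obtain ⟨e, -, -, hlt⟩ := h.2.1
      rw [if_neg h.1, Nat.sub_add_cancel (by omega)]; exact Or.inr h.2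

/-- The code that computes the common length `2 ^ 27 * (n + q)` of the arrays and puts it into
register `1`, which is `tmp 0`. This length is at least `2 ^ 26 * (n + 2 * q)`, as `Par.Good`
asks. -/
def lengthCode : Program :=
  [.const 1 0, .load 1 1, .const 3 2, .load 3 3, .bin .add 1 1 3, .const 3 (2 ^ 27),
    .bin .mul 1 1 3]

/-- The program for the word RAM. -/
def program : Program := lengthCode ++ algorithm.code 7 1

lemma getD_flatMap {α : Type*} (l : List α) (a b c : α → ℕ) {i r : ℕ} {x : α} (hi : l[i]? = some x)
    (hr : r < 3) :
    (l.flatMap fun x => [a x, b x, c x]).getD (3 * i + r) 0 = [a x, b x, c x].getD r 0 := by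
  induction l generalizing i with
  | nil => simp at hi
  | cons y l ih =>
    rw [List.flatMap_cons]
    cases i with
    | zero =>
      simp at hi
      subst hi
      rw [List.getD_append _ _ _ _ (by simpa using hr)]
      simp
    | succ i =>
      rw [List.getD_append_right _ _ _ _ (by simp; omega)]
      rw [← ih (i := i) (by simpa using hi)]
      congr 1
      simp; omega

section input
variable {n σ q : ℕ} (s : Fin n → Fin σ) (Q : Fin q → Query n σ)

lemma input_string (i : Fin n) : (encodeInput s Q).getD (3 + i) 0 = s i := by
  unfold encodeInput
  rw [List.getD_append _ _ _ _ (by simp; omega), List.getD_append_right _ _ _ _ (by simp)]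
  simp

lemma input_query (i : Fin q) {r : ℕ} (hr : r < 3) :
    (encodeInput s Q).getD (n + 3 + 3 * i + r) 0 =
      [((Q i).lo : ℕ), ((Q i).hi : ℕ), ((Q i).char : ℕ)].getD r 0 := by
  unfold encodeInput
  rw [List.getD_append_right _ _ _ _ (by simp; omega), ← getD_flatMap (List.ofFn Q)
    (fun x => (x.lo : ℕ)) (fun x => (x.hi : ℕ)) (fun x => (x.char : ℕ)) (i := i) (x := Q i)
    (by simp) hr]
  congr 1
  simp; omega

lemma input_le (hσ : σ ≤ n) (i : ℕ) : (encodeInput s Q).getD i 0 ≤ n + q := by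
  have h : ∀ x ∈ encodeInput s Q, x ≤ n + q := by
    intro x hx
    simp only [encodeInput, List.mem_append, List.mem_cons, List.not_mem_nil, or_false,
      List.mem_ofFn, List.mem_flatMap] at hx
    rcases hx with ((rfl | rfl | rfl) | ⟨k, rfl⟩) | ⟨y, -, rfl | rfl | rfl⟩
    · omega
    · omega
    · omega
    · have := (s k).isLt; omega
    · have := y.lo.isLt; omega
    · have := y.hi.isLt; omega
    · have := y.char.isLt; omega
  by_cases hi : i < (encodeInput s Q).length
  · rw [List.getD_eq_getElem _ _ hi]
    exact h _ (List.getElem_mem hi)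
  · rw [List.getD_eq_default _ _ (not_lt.1 hi)]; omega

end input

/-- The state of the structured program at the beginning. -/
def initSt (L : ℕ) (input : List ℕ) : St := ⟨fun _ => 0, fun a i => input.getD (a.idx * L + i) 0⟩

/-- After the first instructions the machine represents the initial state. -/
lemma reach_lengthCode {n σ q w : ℕ} (s : Fin n → Fin σ) (Q : Fin q → Query n σ) (h2 : 2 ≤ σ)
    (hσ : σ ≤ n) (hK : 2 ^ 33 * (n + q) ≤ 2 ^ w) :
    ∃ x : Config w, Reach program (init w (encodeInput s Q)) 7 x ∧ x.pc = 7 ∧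
      Rel (2 ^ 27 * (n + q)) x (initSt (2 ^ 27 * (n + q)) (encodeInput s Q)) := by
  have hcode : CodeAt program 0 lengthCode := ⟨[], algorithm.code 7 1, rfl, rfl⟩
  unfold lengthCode at hcode
  have r1 := hcode.reach (x := init w (encodeInput s Q)) rfl
  have r2 := r1.trans (hcode.tail.reach rfl)
  have r3 := r2.trans (hcode.tail.tail.reach rfl)
  have r4 := r3.trans (hcode.tail.tail.tail.reach rfl)
  have r5 := r4.trans (hcode.tail.tail.tail.tail.reach rfl)
  have r6 := r5.trans (hcode.tail.tail.tail.tail.tail.reach rfl)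
  have r7 := r6.trans (hcode.tail.tail.tail.tail.tail.tail.reach rfl)
  refine ⟨_, r7, rfl, ?_⟩
  have hle := input_le s Q hσ
  have hmod : ∀ i, (encodeInput s Q).getD i 0 % 2 ^ w = (encodeInput s Q).getD i 0 := fun i =>
    Nat.mod_eq_of_lt (by have := hle i; omega)
  have i0 : (encodeInput s Q).getD 0 0 = n := rfl
  have i2 : (encodeInput s Q).getD 2 0 = q := rfl
  refine ⟨fun y => ?_, ?_, fun a i hi => ?_⟩
  · have h1 : y.reg ≠ 1 := by unfold Var.reg; omega
    have h3 : y.reg ≠ 3 := by unfold Var.reg; omega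
    simp [Instr.exec, h1, h3, init, initSt]
  · have e2 : 2 % 2 ^ w = 2 := Nat.mod_eq_of_lt (by omega)
    simp only [Instr.exec, tmp, init, BinOp.eval]
    norm_num
    rw [e2, ← List.getD_eq_getElem?_getD, ← List.getD_eq_getElem?_getD, i0, i2,
      Nat.mod_eq_of_lt (by omega), mul_comm]
  · have h1 : a.idx * (2 ^ 27 * (n + q)) + i < 2 ^ w := addr_lt (by unfold numArr; omega) a hi
    simp only [Instr.exec, init, initSt]
    rw [BitVec.toNat_ofNat, BitVec.toNat_ofNat, Nat.mod_eq_of_lt h1, hmod]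

/-- The number of levels is within the time bound. The factor `2` is for the rounding from `b - 1`
to `b`. -/
lemma IsDigitSize.le_sqrt {σ b : ℕ} (h2 : 2 ≤ σ) (hb : IsDigitSize σ b) :
    (b : ℝ) ≤ 2 * Real.sqrt (Real.logb 2 σ) := by
  obtain ⟨h1, -, h⟩ := hb
  have hσ : (0 : ℝ) < σ := by exact_mod_cast (by omega : 0 < σ)
  have hlog : ∀ k : ℕ, 2 ^ (k * k) ≤ σ → (k : ℝ) ≤ Real.sqrt (Real.logb 2 σ) := by
    intro k hk
    apply Real.le_sqrt_of_sq_le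
    rw [Real.le_logb_iff_rpow_le (by norm_num) hσ, sq, ← Nat.cast_mul, Real.rpow_natCast]
    exact_mod_cast hk
  rcases h with rfl | h
  · have := hlog 1 (by simpa using h2)
    push_cast at this ⊢
    linarith
  · obtain rfl | hb : b = 1 ∨ 2 ≤ b := by omega
    · have := hlog 1 (by simpa using h2)
      push_cast at this ⊢
      linarith
    · have := hlog _ h
      have hb' : (b : ℝ) ≤ 2 * (b - 1 : ℕ) := by exact_mod_cast (by omega : b ≤ 2 * (b - 1))
      linarith

/-- From candidates increased by one to the answer. -/
lemma isAnswer_of_isLeast {n σ : ℕ} {s : Fin n → Fin σ} {Q : Query n σ} {V : Set ℕ} {o : ℕ}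
    (hV : ∀ v, v ∈ V ↔ (Q.char : ℕ) < v ∧
      ∃ k : Fin n, (Q.lo : ℕ) ≤ k ∧ (k : ℕ) ≤ Q.hi ∧ (s k : ℕ) + 1 = v)
    (h : (V = ∅ ∧ o = σ) ∨ IsLeast V (o + 1)) : IsAnswer s Q o := by
  have key : ∀ c : Fin σ, c ∈ candidates s Q ↔ (c : ℕ) + 1 ∈ V := by
    intro c
    simp only [candidates, Set.mem_ofPred_eq, hV, Fin.le_def, Fin.ext_iff]
    simp
  rcases h with ⟨h, rfl⟩ | ⟨h, h'⟩
  · right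
    refine ⟨?_, rfl⟩
    ext c
    simp [key, h]
  · left
    obtain ⟨-, k, -, -, hk⟩ := (hV _).1 h
    obtain rfl : (s k : ℕ) = o := by omega
    refine ⟨s k, ⟨(key _).2 h, fun c hc => ?_⟩, rfl⟩
    have := h' ((key _).1 hc)
    rw [Fin.le_def]
    omega

lemma Rel.outputWord_eq {w L n q j : ℕ} {x : Config w} {s : St} (h : Rel L x s)
    (hj : n + 3 * q + 3 + j < L) : outputWord n q x j = s.a .inp (n + 3 * q + 3 + j) := by
  rw [← h.mem .inp _ hj, outputWord, show Arr.inp.idx = 0 from rfl, zero_mul, zero_add]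
  congr 3
  omega

/-- The bound for the word length is `64` times the length of the arrays: it leaves room for all
arrays and for all intermediate results. -/
lemma program_correct {n σ q w : ℕ} (h2 : 2 ≤ σ) (h3 : σ ≤ n) (hK : 2 ^ 33 * (n + q) ≤ 2 ^ w)
    (s : Fin n → Fin σ) (Q : Fin q → Query n σ) :
    ∃ b t, IsDigitSize σ b ∧ t ≤ 2 ^ 35 * ((n + q) * b) ∧
      Halted program (run program w (encodeInput s Q) t) ∧
      ∀ j : Fin q, IsAnswer s (Q j) (outputWord n q (run program w (encodeInput s Q) t) j) := by
  obtain ⟨x, hx, hpc, hrel⟩ := reach_lengthCode s Q h2 h3 hK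
  have hQ : ∀ i (hi : i < q) r, r < 3 → (encodeInput s Q).getD (n + 3 + 3 * i + r) 0 =
      [((Q ⟨i, hi⟩).lo : ℕ), ((Q ⟨i, hi⟩).hi : ℕ), ((Q ⟨i, hi⟩).char : ℕ)].getD r 0 :=
    fun i hi r hr => input_query s Q ⟨i, hi⟩ hr
  have e0 : ∀ i, (initSt (2 ^ 27 * (n + q)) (encodeInput s Q)).a .inp i =
      (encodeInput s Q).getD i 0 := fun i => by
    change (encodeInput s Q).getD (0 * _ + i) 0 = _
    rw [zero_mul, zero_add]
  obtain ⟨hOk, b, hb, hcost, hans⟩ := runs_algorithm (M := 2 ^ w) (L := 2 ^ 27 * (n + q))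
    (n := n) (σ := σ) (q := q) (s := initSt (2 ^ 27 * (n + q)) (encodeInput s Q))
    (f := fun i => (encodeInput s Q).getD (3 + i) 0)
    (lo := fun i => (encodeInput s Q).getD (n + 3 + 3 * i) 0)
    (hi := fun i => (encodeInput s Q).getD (n + 3 + 3 * i + 1) 0)
    (c := fun i => (encodeInput s Q).getD (n + 3 + 3 * i + 2) 0)
    (e0 0) (e0 1) (e0 2) h2 h3 (by omega) (by omega) (fun i _ => e0 _) (fun i _ => e0 _)
    (fun i _ => e0 _) (fun i _ => e0 _)
    (fun i hi => by rw [input_string s Q ⟨i, hi⟩]; exact (s _).isLt)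
    (fun i hi => by
      have := hQ i hi 0 (by omega)
      rw [add_zero] at this
      rw [this]; exact (Q _).lo.isLt)
    (fun i hi => by rw [hQ i hi 1 (by omega)]; exact (Q _).hi.isLt)
    (fun i hi => by rw [hQ i hi 2 (by omega)]; exact (Q _).char.isLt)
  have hcode : CodeAt program x.pc (algorithm.code x.pc 1) := by
    rw [hpc]
    exact ⟨lengthCode, [], by simp [program], rfl⟩
  obtain ⟨y, hy, hres⟩ := Cmd.reach (L := 2 ^ 27 * (n + q)) (by unfold numArr; omega) algorithm
    (d := 1) le_rfl hrel hOk hcode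
  have hrun : run program w (encodeInput s Q)
      (7 + algorithm.cost (initSt _ (encodeInput s Q))) = y :=
    hx.trans hy
  refine ⟨b, 7 + algorithm.cost (initSt (2 ^ 27 * (n + q)) (encodeInput s Q)), hb, ?_, ?_,
    fun j => ?_⟩
  · have h5 : b * (n + 2 * q) ≤ b * (2 * (n + q)) := Nat.mul_le_mul_left _ (by omega)
    have h6 : 1 * 1 ≤ (n + q) * b := Nat.mul_le_mul (by omega) hb.1
    have h7 : b * (2 * (n + q)) = 2 * ((n + q) * b) := by ring
    omega
  · have h : lengthCode.length = 7 := rfl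
    rw [Halted, hrun, hres.pc, hpc, program, List.length_append, Cmd.length_code, h]
  · obtain ⟨V, hV, ho⟩ := hans j j.isLt
    rw [hrun, hres.rel.outputWord_eq (by omega)]
    refine isAnswer_of_isLeast (fun v => ?_) ho
    have q0 := hQ j j.isLt 0 (by omega)
    have q1 := hQ j j.isLt 1 (by omega)
    have q2 := hQ j j.isLt 2 (by omega)
    rw [add_zero] at q0
    rw [hV, q0, q1, q2]
    refine and_congr Iff.rfl ⟨?_, ?_⟩
    · rintro ⟨k, hk, h⟩
      rw [input_string s Q ⟨k, hk⟩] at h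
      exact ⟨⟨k, hk⟩, h⟩
    · rintro ⟨k, h⟩
      refine ⟨k, k.isLt, ?_⟩
      rw [input_string s Q k]
      exact h

end RangeSuccessor

theorem mainTheorem4 :
    ∃ (P : WordRAM.Program) (K C : ℕ),
      ∀ (n σ q w : ℕ), 2 ≤ σ → σ ≤ n → K * (n + q) ≤ 2 ^ w →
        ∀ (s : Fin n → Fin σ) (Q : Fin q → RangeSuccessor.Query n σ),
          ∃ t : ℕ,
            (t : ℝ) ≤ C * ((n : ℝ) + (q : ℝ)) * Real.sqrt (Real.logb 2 (σ : ℝ)) ∧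
            WordRAM.Halted P (WordRAM.run P w (RangeSuccessor.encodeInput s Q) t) ∧
            ∀ j : Fin q,
              RangeSuccessor.IsAnswer s (Q j)
                (RangeSuccessor.outputWord n q
                  (WordRAM.run P w (RangeSuccessor.encodeInput s Q) t) j) := by
  refine ⟨RangeSuccessor.program, 2 ^ 33, 2 ^ 36, fun n σ q w h2 h3 hK s Q => ?_⟩
  obtain ⟨b, t, hb, ht, hhalt, hans⟩ := RangeSuccessor.program_correct h2 h3 hK s Q
  refine ⟨t, ?_, hhalt, hans⟩
  calc (t : ℝ) ≤ ((2 ^ 35 * ((n + q) * b) : ℕ) : ℝ) := by exact_mod_cast ht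
    _ = 2 ^ 35 * (((n : ℝ) + q) * b) := by push_cast; ring
    _ ≤ 2 ^ 35 * (((n : ℝ) + q) * (2 * Real.sqrt (Real.logb 2 σ))) := by
      gcongr
      exact hb.le_sqrt h2
    _ = _ := by push_cast; ring
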